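/- **Conventions.** All function spaces are over $\mathbb{R}^2$ and complex-valued. Let $\widehat f(\xi)=\mathscr F[f](\xi)=\int_{\mathbb{R}^2}e^{-ix\cdot\xi}f(x)\,dx$. Fix a dyadic partition of unity $\{\phi_j\}_{j\in\mathbb{Z}}$: $\widehat{\phi_0}\in C^\infty(\mathbb{R}^2)$, $0\le\widehat{\phi_0}\le1$, $\operatorname{supp}\widehat{\phi_0}\subset\{2^{-1}\le|\xi|\le2\}$, $\widehat{\phi_0}=1$ for $\frac78\le|\xi|\le\frac54$, $\widehat{\phi_j}(\xi)=\widehat{\phi_0}(2^{-j}\xi)$ and $\sum_{j}\widehat{\phi_j}(\xi)=1$ for $\xi\ne0$. For $s\in\mathbb{R}$ and $1\le p,q\le\infty$, let $\mathscr P$ be the polynomials and $$\|f\|_{\dot B^s_{p,q}}=\Big\|\big\{2^{sj}\|\phi_j*f\|_{L^p}\big\}_{j\in\mathbb{Z}}\Big\|_{\ell^q},\qquad \dot B^s_{p,q}(\mathbb{R}^2)=\{f\in\mathscr S'(\mathbb{R}^2)/\mathscr P(\mathbb{R}^2):\ \|f\|_{\dot B^s_{p,q}}<\infty\}.$$ With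 $\nabla^\perp=(-\partial_{x_2},\partial_{x_1})$, put $$\mathcal B[\theta_1,\theta_2]=(-\Delta)^{-1}\operatorname{div}\operatorname{div}\,\mathcal T\big[(-\Delta)^{-\frac12}\theta_1,\ \nabla^\perp(-\Delta)^{-\frac12}\theta_2\big],$$ $$\mathcal T[\theta,v]=\mathscr F^{-1}\Big[\int_{\mathbb{R}^2}\frac{\xi-2\eta}{2(|\eta|+|\xi-\eta|)}\otimes\big(\widehat\theta(\xi-\eta)\,\widehat v(\eta)\big)\,d\eta\Big].$$ Multipliers $\sigma(D)$ that are singular at the origin are applied as $\sigma(D)u=\sum_j\mathscr F^{-1}[\widehat{\phi_j}\,\sigma\,\widehat u]$ in $\mathscr S'$. Likewise, the bilinear operator $\mathcal T$, whose symbol is singular on the axes, is the sum over $k,\ell\in\mathbb{Z}$, in $\mathscr S'$, of the operators with the additional factor $\widehat{\phi_k}(\xi-\eta)\,\widehat{\phi_\ell}(\eta)$ under the integral, the integral being read in the sense of distributions. For $f,g\in\mathscr S'/\mathscr P$, one sets $$\mathcal B[f,g]=\sum_{k,\ell\in\mathbb{Z}}\mathcal B[\phi_k*f,\ \phi_\ell*g],$$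 whenever the series converges unconditionally in $\mathscr S'$, the terms being given by the formula above. **Lemma.** Let $1\le p<4$ and $1\le q\le\infty$, or $(p,q)=(4,2)$. Then there is a constant $C=C(p,q)>0$ (for the fixed partition $\{\phi_j\}$) such that for all $f,g\in\dot B^{\frac2p-1}_{p,q}(\mathbb{R}^2)$ the distribution $\mathcal B[f,g]$ is well defined and $$\|\mathcal B[f,g]\|_{\dot B^{\frac2p-1}_{p,q}}\le C\,\|f\|_{\dot B^{\frac2p-1}_{p,q}}\,\|g\|_{\dot B^{\frac2p-1}_{p,q}}.$$ -/

import Mathlib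

open MeasureTheory
open scoped SchwartzMap FourierTransform LineDeriv ENNReal

noncomputable section

namespace QG

/-- The plane `ℝ²` with its Euclidean norm. -/
abbrev Plane := EuclideanSpace ℝ (Fin 2)

/-- The coordinate vectors of the plane. -/
abbrev e (i : Fin 2) : Plane := EuclideanSpace.single i 1

/-- A dyadic partition of unity on the frequency side: `χ` is the function `φ̂₀`, and
`φ̂_j ξ = χ (2^(-j) ξ)`. -/
structure DyadicPartition where
  χ : Plane → ℝ
  smooth : ContDiff ℝ (⊤ : ℕ∞) χ
  nonneg : ∀ ξ, 0 ≤ χ ξ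
  le_one : ∀ ξ, χ ξ ≤ 1
  support_subset : tsupport χ ⊆ {ξ | 2⁻¹ ≤ ‖ξ‖ ∧ ‖ξ‖ ≤ 2}
  eq_one : ∀ ξ, 7 / 8 ≤ ‖ξ‖ → ‖ξ‖ ≤ 5 / 4 → χ ξ = 1
  hasSum_one : ∀ ξ, ξ ≠ 0 → HasSum (fun j : ℤ => χ ((2 : ℝ) ^ (-j) • ξ)) 1

/-- `φ̂_j` in the frequency variable of Mathlib. Mathlib's Fourier transform has the kernel
`exp (-2πi x·ξ)`, so Mathlib's `ξ` is the frequency `2πξ` for the kernel `exp (-i x·ξ)`. -/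
def DyadicPartition.cutoff (φ : DyadicPartition) (j : ℤ) (ξ : Plane) : ℂ :=
  (φ.χ ((2 : ℝ) ^ (-j) • ((2 * Real.pi) • ξ)) : ℂ)

/-- The dyadic block `φ_j * u` of a tempered distribution, i.e. the distribution with Fourier
transform `φ̂_j û`. -/
def block (φ : DyadicPartition) (j : ℤ) : 𝓢'(Plane, ℂ) →L[ℂ] 𝓢'(Plane, ℂ) :=
  TemperedDistribution.fourierMultiplierCLM ℂ (φ.cutoff j)

/-- The distributions given by integration against a polynomial. -/
def polynomials : Submodule ℂ 𝓢'(Plane, ℂ) :=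
  Submodule.span ℂ {u | ∃ P : MvPolynomial (Fin 2) ℂ, ∀ ψ : 𝓢(Plane, ℂ),
    u ψ = ∫ x, ψ x * MvPolynomial.eval (fun i => (x i : ℂ)) P}

/-- Tempered distributions modulo polynomials. -/
abbrev HomDistribution := 𝓢'(Plane, ℂ) ⧸ polynomials

theorem integral_fourier_mul_polynomial (P : MvPolynomial (Fin 2) ℂ) :
    ∀ s : 𝓢(Plane, ℂ), (0 : Plane) ∉ tsupport s →
      Integrable (fun x => 𝓕 s x * MvPolynomial.eval (fun i => (x i : ℂ)) P) ∧
      ∫ x, 𝓕 s x * MvPolynomial.eval (fun i => (x i : ℂ)) P = 0 := by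
  induction P using MvPolynomial.induction_on with
  | C a =>
    intro s hs
    simp only [MvPolynomial.eval_C]
    refine ⟨(𝓕 s).integrable.mul_const a, ?_⟩
    have h0 : (𝓕⁻ (𝓕 s) : 𝓢(Plane, ℂ)) 0 = 0 := by
      rw [FourierTransform.fourierInv_fourier_eq]
      exact image_eq_zero_of_notMem_tsupport hs
    rw [SchwartzMap.fourierInv_coe, Real.fourierInv_eq] at h0
    simp only [inner_zero_right, AddChar.map_zero_eq_one, one_smul] at h0
    rw [integral_mul_const, h0, zero_mul]
  | add P Q hP hQ =>
    intro s hs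
    simp only [map_add, mul_add]
    refine ⟨(hP s hs).1.add (hQ s hs).1, ?_⟩
    rw [integral_add (hP s hs).1 (hQ s hs).1, (hP s hs).2, (hQ s hs).2, add_zero]
  | mul_X P i hP =>
    intro s hs
    have hd : (0 : Plane) ∉ tsupport (∂_{e i} s : 𝓢(Plane, ℂ)) :=
      fun h => hs (SchwartzMap.tsupport_lineDerivOp_subset (e i) s h)
    obtain ⟨h1, h2⟩ := hP _ hd
    have hc : (2 * Real.pi * Complex.I : ℂ) ≠ 0 := by simp [Real.pi_ne_zero]
    have key : (fun x : Plane => 𝓕 s x *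
          MvPolynomial.eval (fun i => (x i : ℂ)) (P * MvPolynomial.X i)) =
        fun x => (2 * Real.pi * Complex.I : ℂ)⁻¹ * (𝓕 (∂_{e i} s : 𝓢(Plane, ℂ)) x *
          MvPolynomial.eval (fun i => (x i : ℂ)) P) := by
      funext x
      have hg : (fun y : Plane => inner ℝ y (e i)).HasTemperateGrowth := by fun_prop
      rw [SchwartzMap.fourier_lineDerivOp_eq, smul_apply,
        SchwartzMap.smulLeftCLM_apply_apply hg]
      simp [EuclideanSpace.inner_single_right]
      field_simp
      rw [Complex.I_sq]
      ring
    rw [key]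
    exact ⟨h1.const_mul _, by rw [integral_const_mul, h2, mul_zero]⟩

theorem cutoff_support (φ : DyadicPartition) (j : ℤ) :
    (0 : Plane) ∉ tsupport (φ.cutoff j) := by
  rw [notMem_tsupport_iff_eventuallyEq]
  have h0 : (0 : Plane) ∉ tsupport φ.χ := by
    intro h
    have := (φ.support_subset h).1
    norm_num at this
  rw [notMem_tsupport_iff_eventuallyEq] at h0
  have hc : Filter.Tendsto (fun ξ : Plane => (2 : ℝ) ^ (-j) • ((2 * Real.pi) • ξ))
      (nhds 0) (nhds 0) := by
    have : Continuous (fun ξ : Plane => (2 : ℝ) ^ (-j) • ((2 * Real.pi) • ξ)) := by fun_prop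
    simpa using this.tendsto 0
  filter_upwards [hc.eventually h0] with ξ hξ
  simp only [DyadicPartition.cutoff, hξ]
  simp

theorem block_polynomial (φ : DyadicPartition) (j : ℤ) :
    polynomials ≤ LinearMap.ker (block φ j : 𝓢'(Plane, ℂ) →ₗ[ℂ] 𝓢'(Plane, ℂ)) := by
  refine Submodule.span_le.2 ?_
  rintro u ⟨P, hP⟩
  change block φ j u = 0
  ext ψ
  have : block φ j u ψ = u (𝓕 (SchwartzMap.smulLeftCLM ℂ (φ.cutoff j) (𝓕⁻ ψ))) := rfl
  rw [this, hP]
  refine (integral_fourier_mul_polynomial P _ fun h => ?_).2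
  exact cutoff_support φ j (SchwartzMap.tsupport_smulLeftCLM_subset _ _ h).2

/-- The dyadic blocks are well defined modulo polynomials. -/
def homBlock (φ : DyadicPartition) (j : ℤ) : HomDistribution →ₗ[ℂ] 𝓢'(Plane, ℂ) :=
  polynomials.liftQ (block φ j : 𝓢'(Plane, ℂ) →ₗ[ℂ] 𝓢'(Plane, ℂ)) (block_polynomial φ j)

/-- The `L^p` norm of a distribution; it is `∞` if the distribution is not given by an
`L^p` function. -/
def distLpNorm (p : ℝ≥0∞) (u : 𝓢'(Plane, ℂ)) : ℝ≥0∞ :=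
  ⨅ (g : Plane → ℂ) (_ : MemLp g p volume ∧ ∀ ψ : 𝓢(Plane, ℂ), u ψ = ∫ x, ψ x * g x),
    eLpNorm g p volume

/-- The `ℓ^q(ℤ)` norm of a sequence of extended nonnegative numbers. -/
def seqNorm (q : ℝ≥0∞) (a : ℤ → ℝ≥0∞) : ℝ≥0∞ :=
  if q = ∞ then ⨆ j, a j else (∑' j, a j ^ q.toReal) ^ (1 / q.toReal)

/-- The norm of the homogeneous Besov space `Ḃ^s_{p,q}(ℝ²)`, with value `∞` outside the space. -/
def besovNorm (φ : DyadicPartition) (s : ℝ) (p q : ℝ≥0∞) (f : HomDistribution) : ℝ≥0∞ :=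
  seqNorm q fun j => ENNReal.ofReal ((2 : ℝ) ^ (s * (j : ℝ))) * distLpNorm p (homBlock φ j f)

/-- The homogeneous Besov space `Ḃ^s_{p,q}(ℝ²)`. -/
def besovSpace (φ : DyadicPartition) (s : ℝ) (p q : ℝ≥0∞) : Set HomDistribution :=
  {f | besovNorm φ s p q f < ∞}

/-- `w = σ(D) u` for a symbol `σ` that may be singular at the origin (a function of Mathlib's
frequency variable): `w = ∑_j 𝓕⁻¹ (φ̂_j σ û)`, with convergence in the space of tempered
distributions. -/
def IsHomMultiplier (φ : DyadicPartition) (σ : Plane → ℂ) (u w : 𝓢'(Plane, ℂ)) : Prop :=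
  HasSum (fun j : ℤ => TemperedDistribution.fourierMultiplierCLM ℂ
    (fun ξ => φ.cutoff j ξ * σ ξ) u) w

/-- `w = (-Δ)^(-α) u`. -/
def IsInvLaplacianPow (φ : DyadicPartition) (α : ℝ) (u w : 𝓢'(Plane, ℂ)) : Prop :=
  IsHomMultiplier φ (fun ξ => ((‖(2 * Real.pi) • ξ‖ ^ (-2 * α) : ℝ) : ℂ)) u w

/-- The perpendicular gradient `∇^⊥ u = (-∂₂ u, ∂₁ u)`. -/
def perpGrad (u : 𝓢'(Plane, ℂ)) : Fin 2 → 𝓢'(Plane, ℂ) :=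
  ![-∂_{e 1} u, ∂_{e 0} u]

/-- The double divergence `div div A = ∑_{i,j} ∂_i ∂_j A_{ij}` of a matrix field. -/
def divDiv (A : Fin 2 → Fin 2 → 𝓢'(Plane, ℂ)) : 𝓢'(Plane, ℂ) :=
  ∑ i, ∑ j, ∂_{e i} (∂_{e j} (A i j))

/-- `c` is the value `⟨u ⊗ v, Φ⟩ = ⟨u(ξ), ⟨v(η), Φ(ξ, η)⟩⟩` of the tensor product of two tempered
distributions at a test function `Φ` of two variables. -/
def IsTensorPairing (u v : 𝓢'(Plane, ℂ)) (Φ : Plane → Plane → ℂ) (c : ℂ) : Prop :=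
  ∃ s : 𝓢(Plane, ℂ), (∀ ξ, ∃ r : 𝓢(Plane, ℂ), (∀ η, r η = Φ ξ η) ∧ s ξ = v r) ∧ c = u s

/-- The `i`-th component of `(ζ - 2η) / (2(|η| + |ζ - η|))` at `ζ = ξ + η`. It is homogeneous of
degree `0`, hence does not see the normalization of the frequency variable. -/
def symbolT (i : Fin 2) (ξ η : Plane) : ℂ :=
  (((ξ i - η i) / (2 * (‖ξ‖ + ‖η‖)) : ℝ) : ℂ)

/-- `w` is the tempered distribution with Fourier transform
`ζ ↦ ∫ φ̂_k(ζ-η) φ̂_l(η) m_i(ζ-η,η) θ̂(ζ-η) v̂(η) dη`, for the symbol `m_i = symbolT i`. The integral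
is read as a distribution in `ζ`: tested with `ψ` it is the tensor product of `θ̂` and `v̂` applied to
`φ̂_k(ξ) φ̂_l(η) m_i(ξ,η) ψ(ξ+η)`. The factor `(2π)²` comes from the passage to Mathlib's
frequency variable. -/
def IsTBlock (φ : DyadicPartition) (i : Fin 2) (k l : ℤ) (θ v w : 𝓢'(Plane, ℂ)) : Prop :=
  ∀ ψ : 𝓢(Plane, ℂ), ∃ c : ℂ,
    IsTensorPairing (𝓕 θ) (𝓕 v)
      (fun ξ η => φ.cutoff k ξ * φ.cutoff l η * symbolT i ξ η * ψ (ξ + η)) c ∧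
    𝓕 w ψ = (2 * Real.pi : ℂ) ^ 2 * c

/-- `w` is the `i`-th component of the bilinear multiplier `T[θ, v]` for a scalar `v`:
its Fourier transform is `∫ (ξ-2η)_i / (2(|η|+|ξ-η|)) θ̂(ξ-η) v̂(η) dη`. The symbol is not smooth on the
axes, so it is cut into dyadic pieces, whose sum converges in the tempered distributions. -/
def IsT (φ : DyadicPartition) (i : Fin 2) (θ v w : 𝓢'(Plane, ℂ)) : Prop :=
  ∃ t : ℤ × ℤ → 𝓢'(Plane, ℂ), (∀ κ, IsTBlock φ i κ.1 κ.2 θ v (t κ)) ∧ HasSum t w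

/-- `w = (-Δ)⁻¹ div div T[(-Δ)^(-1/2) θ₁, ∇^⊥ (-Δ)^(-1/2) θ₂]`, by the formula. -/
def IsDoubleDiv (φ : DyadicPartition) (θ₁ θ₂ w : 𝓢'(Plane, ℂ)) : Prop :=
  ∃ (a b : 𝓢'(Plane, ℂ)) (A : Fin 2 → Fin 2 → 𝓢'(Plane, ℂ)),
    IsInvLaplacianPow φ (1 / 2) θ₁ a ∧ IsInvLaplacianPow φ (1 / 2) θ₂ b ∧
    (∀ i j, IsT φ i a (perpGrad b j) (A i j)) ∧
    IsInvLaplacianPow φ 1 (divDiv A) w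

/-- `h = B[f, g]` for `f, g` in the tempered distributions modulo polynomials. With the dyadic
blocks `f_k = φ_k * f` and `g_l = φ_l * g`, to which the formula for `B` applies,
`B[f, g] = ∑_{k,l} B[f_k, g_l]`, with unconditional convergence in the tempered distributions. -/
def IsB (φ : DyadicPartition) (f g : HomDistribution) (h : 𝓢'(Plane, ℂ)) : Prop :=
  ∃ b : ℤ × ℤ → 𝓢'(Plane, ℂ),
    (∀ κ, IsDoubleDiv φ (homBlock φ κ.1 f) (homBlock φ κ.2 g) (b κ)) ∧ HasSum b h

theorem IsTensorPairing.unique {u v : 𝓢'(Plane, ℂ)} {Φ : Plane → Plane → ℂ} {c c' : ℂ}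
    (h : IsTensorPairing u v Φ c) (h' : IsTensorPairing u v Φ c') : c = c' := by
  obtain ⟨s, hs, rfl⟩ := h
  obtain ⟨s', hs', rfl⟩ := h'
  congr 1
  ext ξ
  obtain ⟨r, hr, h1⟩ := hs ξ
  obtain ⟨r', hr', h2⟩ := hs' ξ
  rw [h1, h2]
  congr 1
  ext η
  rw [hr, hr']

theorem IsTBlock.unique {φ : DyadicPartition} {i : Fin 2} {k l : ℤ} {θ v w w' : 𝓢'(Plane, ℂ)}
    (h : IsTBlock φ i k l θ v w) (h' : IsTBlock φ i k l θ v w') : w = w' := by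
  have : 𝓕 w = 𝓕 w' := by
    ext ψ
    obtain ⟨c, hc, h1⟩ := h ψ
    obtain ⟨c', hc', h2⟩ := h' ψ
    rw [h1, h2, hc.unique hc']
  have h2 := congrArg (fun u : 𝓢'(Plane, ℂ) => (𝓕⁻ u : 𝓢'(Plane, ℂ))) this
  simpa using h2

theorem IsT.unique {φ : DyadicPartition} {i : Fin 2} {θ v w w' : 𝓢'(Plane, ℂ)}
    (h : IsT φ i θ v w) (h' : IsT φ i θ v w') : w = w' := by
  obtain ⟨t, ht, hw⟩ := h
  obtain ⟨t', ht', hw'⟩ := h'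
  obtain rfl : t = t' := funext fun κ => (ht κ).unique (ht' κ)
  exact hw.unique hw'

theorem IsDoubleDiv.unique {φ : DyadicPartition} {θ₁ θ₂ w w' : 𝓢'(Plane, ℂ)}
    (h : IsDoubleDiv φ θ₁ θ₂ w) (h' : IsDoubleDiv φ θ₁ θ₂ w') : w = w' := by
  obtain ⟨a, b, A, ha, hb, hA, hw⟩ := h
  obtain ⟨a', b', A', ha', hb', hA', hw'⟩ := h'
  obtain rfl : a = a' := HasSum.unique ha ha'
  obtain rfl : b = b' := HasSum.unique hb hb'
  obtain rfl : A = A' := funext fun i => funext fun j => (hA i j).unique (hA' i j)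
  exact HasSum.unique hw hw'

/-- `B[f, g]` has at most one value. -/
theorem IsB.unique {φ : DyadicPartition} {f g : HomDistribution} {h h' : 𝓢'(Plane, ℂ)}
    (H : IsB φ f g h) (H' : IsB φ f g h') : h = h' := by
  obtain ⟨b, hb, hs⟩ := H
  obtain ⟨b', hb', hs'⟩ := H'
  obtain rfl : b = b' := funext fun κ => (hb κ).unique (hb' κ)
  exact hs.unique hs'

end QG

end

open MeasureTheory
open scoped SchwartzMap FourierTransform LineDeriv ENNReal

noncomputable section

namespace QG

/-! ### `L^p` norms of distributions -/

/-! Put `t = 2/p` and `s = t - 1`. The output is split into `piece φ k l F G n`, the part at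
frequency about `2^n` of the interaction of the blocks `φ_k * F` and `φ_l * G`.

The symbol of `T` is homogeneous of degree 0 and smooth off the axes. Its dyadic pieces have kernels
bounded in `L¹` uniformly in `k, l` (`exists_symbol_kernel`), so they obey Hölder's inequality like
a pointwise product (`exists_TBlock_bound`). Together with Bernstein's inequalities
(`exists_multiplier_bound`) this bounds the `L^p` norm of a piece, relative to the product of the
norms of the two blocks, by three different factors: `2^(-k + t l)` (`exists_piece_bound`); `2^(-k +
t n)`, passing through `L^(p/2)`, for `p ≥ 2` (`exists_piece_bound_half`); and `2^(-n + t k)`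
(`exists_piece_bound_leibniz`). The third rests on a cancellation: the field `v = ∇^⊥ (-Δ)^(-1/2)
φ_l * G` is divergence free, hence `∑_j ∂_j T_i[θ, v_j] = ∑_j T_i[∂_j θ, v_j]` (`IsTBlock.leibniz`).
This replaces the factor `2^(-k)` by `2^(-n)`, which is decisive when `k` is much smaller than `l`.

By frequency support, `n ≤ max k l + 5`, and `|n - max k l| ≤ 5` when `|k - l| ≥ 8`. In the weights
of the Besov norm, separated frequencies then gain `2^(-|k-l|)` up to a constant, by the first bound
if `l ≤ k` and by the third if `k ≤ l`. Comparable frequencies gain `2^((2t-1)(n-k))` for `p ≥ 2`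
and `2^(s(n-k))` for `p < 2`. For `p < 4` these exponents are positive, so there is geometric decay
in both `k - l` and `n - k` (`exists_decay_subcritical`), and Young's inequality for sequences
concludes for every `q`.

For `p = 4` one has `2t - 1 = 0` and comparable frequencies have no decay in `n`. With `q = 2`,
Cauchy–Schwarz over comparable pairs sums the matrices themselves in `L²` (`exists_amat_sum`).
Almost orthogonality in `L²` (`tsum_block_two_le`) and Bernstein from `L²` to `L⁴` then give the
`ℓ²` bound in `n` (`exists_comparable_sum`).

The series converges because a distribution of frequency `2^n`, tested against a Schwartz function,
gains `2^(-|n|)` over its Besov weight (`exists_pairing_bound`). Bounds on the sums over `(k, l)`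
that are uniform in `n` therefore suffice (`exists_isB`). -/

theorem rpow_lintegral_le {Ω : Type*} [MeasurableSpace Ω] (ν : Measure Ω) {p : ℝ} (hp : 1 ≤ p)
    {h : Ω → ℝ≥0∞} (hh : AEMeasurable h ν) :
    (∫⁻ ω, h ω ∂ν) ^ p ≤ ν Set.univ ^ (p - 1) * ∫⁻ ω, h ω ^ p ∂ν := by
  have hp0 : 0 < p := by linarith
  have h1 := eLpNorm'_le_eLpNorm'_mul_rpow_measure_univ (μ := ν) (f := h) one_pos hp
    hh.aestronglyMeasurable
  simp only [eLpNorm', enorm_eq_self, ENNReal.rpow_one, one_div, inv_one] at h1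
  calc (∫⁻ ω, h ω ∂ν) ^ p
      ≤ ((∫⁻ ω, h ω ^ p ∂ν) ^ p⁻¹ * ν Set.univ ^ (1 - p⁻¹)) ^ p := by gcongr
    _ = ν Set.univ ^ (p - 1) * ∫⁻ ω, h ω ^ p ∂ν := by
      rw [ENNReal.mul_rpow_of_nonneg _ _ hp0.le, ← ENNReal.rpow_mul, ← ENNReal.rpow_mul,
        inv_mul_cancel₀ hp0.ne', ENNReal.rpow_one, mul_comm]
      congr 2
      field_simp

/-- Minkowski's integral inequality for a finite measure, with a uniform bound on the sections. -/
theorem lintegral_rpow_lintegral_le {α Ω : Type*} [MeasurableSpace α] [MeasurableSpace Ω]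
    (μ : Measure α) (ν : Measure Ω) [SFinite μ] [SFinite ν] {p : ℝ} (hp : 1 ≤ p)
    {F : α → Ω → ℝ≥0∞} (hF : Measurable (Function.uncurry F)) {M : ℝ≥0∞}
    (hM : ∀ ω, ∫⁻ x, F x ω ^ p ∂μ ≤ M ^ p) :
    ∫⁻ x, (∫⁻ ω, F x ω ∂ν) ^ p ∂μ ≤ (ν Set.univ * M) ^ p := by
  have hp0 : 0 < p := by linarith
  have hm : Measurable (fun z : α × Ω => F z.1 z.2 ^ p) := hF.pow_const p
  have hswap : ∫⁻ x, ∫⁻ ω, F x ω ^ p ∂ν ∂μ = ∫⁻ ω, ∫⁻ x, F x ω ^ p ∂μ ∂ν :=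
    lintegral_lintegral_swap hm.aemeasurable
  calc ∫⁻ x, (∫⁻ ω, F x ω ∂ν) ^ p ∂μ
      ≤ ∫⁻ x, ν Set.univ ^ (p - 1) * ∫⁻ ω, F x ω ^ p ∂ν ∂μ :=
        lintegral_mono fun x => rpow_lintegral_le ν hp
          (hF.comp measurable_prodMk_left).aemeasurable
    _ = ν Set.univ ^ (p - 1) * ∫⁻ ω, ∫⁻ x, F x ω ^ p ∂μ ∂ν := by
        rw [lintegral_const_mul _ hm.lintegral_prod_right', hswap]
    _ ≤ ν Set.univ ^ (p - 1) * (M ^ p * ν Set.univ) := by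
        gcongr
        calc _ ≤ ∫⁻ _, M ^ p ∂ν := lintegral_mono hM
          _ = _ := lintegral_const _
    _ = (ν Set.univ * M) ^ p := by
        rw [ENNReal.mul_rpow_of_nonneg _ _ hp0.le]
        have : ν Set.univ ^ p = ν Set.univ ^ (p - 1) * ν Set.univ := by
          conv_lhs => rw [show p = (p - 1) + 1 by ring]
          rw [ENNReal.rpow_add_of_nonneg _ _ (by linarith) zero_le_one, ENNReal.rpow_one]
        rw [this]; ring

theorem eLpNorm_le_iff_lintegral {α β : Type*} [MeasurableSpace α] {μ : Measure α}
    [NormedAddCommGroup β] {p : ℝ≥0∞} (hp : p ≠ 0) (hp' : p ≠ ∞) (f : α → β) (M : ℝ≥0∞) :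
    eLpNorm f p μ ≤ M ↔ ∫⁻ x, ‖f x‖ₑ ^ p.toReal ∂μ ≤ M ^ p.toReal := by
  have h0 : 0 < p.toReal := ENNReal.toReal_pos hp hp'
  rw [eLpNorm_eq_lintegral_rpow_enorm_toReal hp hp', one_div, ENNReal.rpow_inv_le_iff h0]

/-- Minkowski's inequality for the measure with density `|κ|`. It yields both Young's inequality for
convolutions and the bilinear bound `eLpNorm_bilinConv_le`. -/
theorem eLpNorm_integral_mul_le {α Ω : Type*} [MeasurableSpace α] [MeasurableSpace Ω]
    {μ : Measure α} {ν : Measure Ω} [SFinite μ] [SFinite ν] {p : ℝ≥0∞} (hp : 1 ≤ p) (hp' : p ≠ ∞)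
    {κ : Ω → ℂ} (hκ : Measurable κ) {F : α → Ω → ℂ} (hF : Measurable (Function.uncurry F))
    {M : ℝ≥0∞} (hM : ∀ ω, eLpNorm (fun x => F x ω) p μ ≤ M) :
    eLpNorm (fun x => ∫ ω, κ ω * F x ω ∂ν) p μ ≤ (∫⁻ ω, ‖κ ω‖ₑ ∂ν) * M := by
  have hp0 : p ≠ 0 := (zero_lt_one.trans_le hp).ne'
  have hp1 : 1 ≤ p.toReal := by
    rwa [← ENNReal.toReal_one, ENNReal.toReal_le_toReal ENNReal.one_ne_top hp']
  rw [eLpNorm_le_iff_lintegral hp0 hp']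
  have hmk : Measurable (fun ω => ‖κ ω‖ₑ) := hκ.enorm
  have hmF : Measurable (Function.uncurry fun x ω => ‖F x ω‖ₑ) := hF.enorm
  have key := lintegral_rpow_lintegral_le μ (ν.withDensity fun ω => ‖κ ω‖ₑ) hp1 hmF
    (M := M) fun ω => (eLpNorm_le_iff_lintegral hp0 hp' _ M).1 (hM ω)
  rw [withDensity_apply _ MeasurableSet.univ, Measure.restrict_univ] at key
  refine le_trans (lintegral_mono fun x => ?_) key
  gcongr
  have hx : Measurable fun ω => ‖F x ω‖ₑ := hmF.comp measurable_prodMk_left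
  rw [lintegral_withDensity_eq_lintegral_mul _ hmk hx]
  refine (enorm_integral_le_lintegral_enorm _).trans (le_of_eq ?_)
  simp [enorm_mul]

/-- The distribution `u` is integration against the function `g`. -/
def Rep (u : 𝓢'(Plane, ℂ)) (g : Plane → ℂ) : Prop :=
  ∀ ψ : 𝓢(Plane, ℂ), u ψ = ∫ x, ψ x * g x

theorem Rep.congr {u : 𝓢'(Plane, ℂ)} {g g' : Plane → ℂ} (h : Rep u g) (hg : g =ᵐ[volume] g') :
    Rep u g' := fun ψ => by
  rw [h ψ]
  exact integral_congr_ae (by filter_upwards [hg] with x hx; rw [hx])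

theorem rep_toTemperedDistribution {p : ℝ≥0∞} [Fact (1 ≤ p)] (f : Lp ℂ p (volume : Measure Plane)) :
    Rep (Lp.toTemperedDistribution f) f := fun ψ => by
  simp [Lp.toTemperedDistribution_apply]

theorem Rep.eq_toTemperedDistribution {p : ℝ≥0∞} [Fact (1 ≤ p)] {u : 𝓢'(Plane, ℂ)}
    {g : Plane → ℂ} (h : Rep u g) (hg : MemLp g p volume) :
    u = Lp.toTemperedDistribution (hg.toLp g) := by
  ext ψ
  rw [h.congr hg.coeFn_toLp.symm ψ, rep_toTemperedDistribution _ ψ]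

theorem Rep.unique {u : 𝓢'(Plane, ℂ)} {g g' : Plane → ℂ} (h : Rep u g) (h' : Rep u g')
    (hg : LocallyIntegrable g) (hg' : LocallyIntegrable g') : g =ᵐ[volume] g' := by
  refine ae_eq_of_integral_contDiff_smul_eq hg hg' fun k hk hc => ?_
  have hc1 : HasCompactSupport (Complex.ofRealCLM ∘ k) := hc.comp_left rfl
  have hk1 : ContDiff ℝ (⊤ : ℕ∞) (Complex.ofRealCLM ∘ k) := by fun_prop
  have := (h (hc1.toSchwartzMap hk1)).symm.trans (h' (hc1.toSchwartzMap hk1))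
  simpa using this

theorem Rep.add {u v : 𝓢'(Plane, ℂ)} {g k : Plane → ℂ} {p : ℝ≥0∞} (hp : 1 ≤ p) (hu : Rep u g)
    (hv : Rep v k) (hg : MemLp g p volume) (hk : MemLp k p volume) : Rep (u + v) (g + k) := by
  have : Fact (1 ≤ p) := ⟨hp⟩
  have : u + v = Lp.toTemperedDistribution (hg.toLp g + hk.toLp k) := by
    conv_lhs => rw [hu.eq_toTemperedDistribution hg, hv.eq_toTemperedDistribution hk]
    exact ((Lp.toTemperedDistributionCLM ℂ volume p).map_add _ _).symm
  rw [this]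
  refine (rep_toTemperedDistribution _).congr ?_
  filter_upwards [Lp.coeFn_add (hg.toLp g) (hk.toLp k), hg.coeFn_toLp, hk.coeFn_toLp] with x h1 h2 h3
  rw [h1, Pi.add_apply, Pi.add_apply, h2, h3]

theorem Rep.smul {u : 𝓢'(Plane, ℂ)} {g : Plane → ℂ} (c : ℂ) (hu : Rep u g) :
    Rep (c • u) (c • g) := fun ψ => by
  have : (c • u) ψ = c * u ψ := rfl
  rw [this, hu ψ, ← integral_const_mul]
  congr 1; funext x; simp; ring

theorem distLpNorm_le {p : ℝ≥0∞} {u : 𝓢'(Plane, ℂ)} {g : Plane → ℂ} (hu : Rep u g)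
    (hg : MemLp g p volume) : distLpNorm p u ≤ eLpNorm g p volume :=
  iInf₂_le g ⟨hg, hu⟩

theorem exists_rep {p : ℝ≥0∞} {u : 𝓢'(Plane, ℂ)} (h : distLpNorm p u < ∞) :
    ∃ g, MemLp g p volume ∧ Rep u g := by
  by_contra! hc
  refine h.ne ?_
  refine iInf₂_eq_top.2 fun g hg => absurd hg.2 (hc g hg.1)

/-- Representatives are locally integrable, hence equal almost everywhere, so the infimum in
`distLpNorm` runs over a single value. -/
theorem distLpNorm_eq {p : ℝ≥0∞} (hp : 1 ≤ p) {u : 𝓢'(Plane, ℂ)} {g : Plane → ℂ} (hu : Rep u g)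
    (hg : MemLp g p volume) : distLpNorm p u = eLpNorm g p volume := by
  refine le_antisymm (distLpNorm_le hu hg) (le_iInf₂ fun k hk => ?_)
  rw [eLpNorm_congr_ae (hu.unique hk.2 (hg.locallyIntegrable hp) (hk.1.locallyIntegrable hp))]

/-- A distribution of finite `L^p` norm is given by a function realizing the norm. -/
theorem exists_rep_eq {p : ℝ≥0∞} (hp : 1 ≤ p) {u : 𝓢'(Plane, ℂ)} (h : distLpNorm p u < ∞) :
    ∃ g, StronglyMeasurable g ∧ MemLp g p volume ∧ Rep u g ∧
      eLpNorm g p volume = distLpNorm p u := by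
  obtain ⟨g, hg, hu⟩ := exists_rep h
  have hae := hg.1.ae_eq_mk
  refine ⟨hg.1.mk g, hg.1.stronglyMeasurable_mk, (memLp_congr_ae hae).1 hg, hu.congr hae, ?_⟩
  exact (eLpNorm_congr_ae hae).symm.trans (distLpNorm_eq hp hu hg).symm

theorem distLpNorm_zero (p : ℝ≥0∞) : distLpNorm p 0 = 0 := by
  have h : Rep 0 (0 : Plane → ℂ) := fun ψ => by simp
  simpa using distLpNorm_le h (MemLp.zero (p := p))

theorem distLpNorm_add_le {p : ℝ≥0∞} (hp : 1 ≤ p) (u v : 𝓢'(Plane, ℂ)) :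
    distLpNorm p (u + v) ≤ distLpNorm p u + distLpNorm p v := by
  by_cases hu : distLpNorm p u = ∞
  · simp [hu]
  by_cases hv : distLpNorm p v = ∞
  · simp [hv]
  obtain ⟨g, -, hg, hug, he⟩ := exists_rep_eq hp (lt_top_iff_ne_top.2 hu)
  obtain ⟨k, -, hk, hvk, he'⟩ := exists_rep_eq hp (lt_top_iff_ne_top.2 hv)
  rw [← he, ← he']
  exact (distLpNorm_le (hug.add hp hvk hg hk) (hg.add hk)).trans (eLpNorm_add_le hg.1 hk.1 hp)

theorem distLpNorm_smul_le {p : ℝ≥0∞} (hp : 1 ≤ p) (c : ℂ) (hc : c ≠ 0) (u : 𝓢'(Plane, ℂ)) :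
    distLpNorm p (c • u) ≤ ‖c‖ₑ * distLpNorm p u := by
  by_cases hu : distLpNorm p u = ∞
  · rw [hu, ENNReal.mul_top (by simpa using hc)]; exact le_top
  obtain ⟨g, -, hg, hug, he⟩ := exists_rep_eq hp (lt_top_iff_ne_top.2 hu)
  rw [← he, ← eLpNorm_const_smul]
  exact distLpNorm_le (hug.smul c) (hg.const_smul c)

theorem distLpNorm_sum_le {p : ℝ≥0∞} (hp : 1 ≤ p) {ι : Type*} (s : Finset ι)
    (u : ι → 𝓢'(Plane, ℂ)) :
    distLpNorm p (∑ i ∈ s, u i) ≤ ∑ i ∈ s, distLpNorm p (u i) := by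
  classical
  induction s using Finset.induction_on with
  | empty => simp [distLpNorm_zero]
  | insert a s ha ih =>
    rw [Finset.sum_insert ha, Finset.sum_insert ha]
    exact (distLpNorm_add_le hp _ _).trans (by gcongr)

/-- The norm of a convergent series of distributions. -/
theorem distLpNorm_le_tsum {p : ℝ≥0∞} (hp : 1 ≤ p) {ι : Type*} {u : ι → 𝓢'(Plane, ℂ)}
    {w : 𝓢'(Plane, ℂ)} (h : HasSum u w) :
    distLpNorm p w ≤ ∑' i, distLpNorm p (u i) := by
  by_cases ht : ∑' i, distLpNorm p (u i) = ∞
  · rw [ht]; exact le_top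
  have : Fact (1 ≤ p) := ⟨hp⟩
  have hfin : ∀ i, distLpNorm p (u i) < ∞ := fun i =>
    (ENNReal.le_tsum i).trans_lt (lt_top_iff_ne_top.2 ht)
  choose g _ hg hug he using fun i => exists_rep_eq hp (hfin i)
  let f : ι → Lp ℂ p (volume : Measure Plane) := fun i => (hg i).toLp (g i)
  have hnorm : ∀ i, ‖f i‖ₑ = distLpNorm p (u i) := fun i => by
    rw [Lp.enorm_toLp, he]
  have hsum : Summable fun i => ‖f i‖ := by
    have : ∀ i, ‖f i‖ = (distLpNorm p (u i)).toReal := fun i => by rw [← hnorm, toReal_enorm]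
    simp_rw [this]
    exact ENNReal.summable_toReal ht
  have hS := hsum.of_norm.hasSum
  have hS' := hS.mapL (Lp.toTemperedDistributionCLM ℂ volume p)
  have hu : ∀ i, Lp.toTemperedDistributionCLM ℂ volume p (f i) = u i := fun i =>
    ((hug i).eq_toTemperedDistribution (hg i)).symm
  simp_rw [hu] at hS'
  have hw : w = Lp.toTemperedDistribution (∑' i, f i) := h.unique hS'
  rw [hw]
  refine (distLpNorm_le (rep_toTemperedDistribution _) (Lp.memLp _)).trans ?_
  rw [← Lp.enorm_def]
  simp_rw [← hnorm]
  rw [← ofReal_norm]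
  refine (ENNReal.ofReal_le_ofReal (norm_tsum_le_tsum_norm hsum)).trans ?_
  rw [ENNReal.ofReal_tsum_of_nonneg (fun _ => norm_nonneg _) hsum]
  simp_rw [ofReal_norm]
  exact le_rfl

theorem enorm_apply_le {u : 𝓢'(Plane, ℂ)} (ψ : 𝓢(Plane, ℂ)) :
    ‖u ψ‖ₑ ≤ distLpNorm ∞ u * ∫⁻ x, ‖ψ x‖ₑ := by
  by_cases hu : distLpNorm ∞ u = ∞
  -- Since `∞ * 0 = 0`, an infinite norm makes the bound trivial only for a nonzero test function.
  · by_cases h0 : ∫⁻ x, ‖ψ x‖ₑ = 0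
    · have : ψ = 0 := by
        rw [lintegral_eq_zero_iff ψ.continuous.measurable.enorm] at h0
        have h1 : (fun x => ψ x) =ᵐ[volume] fun _ => (0 : ℂ) := by
          filter_upwards [h0] with x hx; simpa using hx
        have h2 := (Continuous.ae_eq_iff_eq volume ψ.continuous continuous_const).1 h1
        ext x; exact congrFun h2 x
      simp [this]
    · rw [hu, ENNReal.top_mul h0]; exact le_top
  obtain ⟨g, -, hg, hug, he⟩ := exists_rep_eq le_top (lt_top_iff_ne_top.2 hu)
  rw [hug ψ, ← he]
  refine (enorm_integral_le_lintegral_enorm _).trans ?_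
  rw [← lintegral_const_mul _ ψ.continuous.measurable.enorm]
  refine lintegral_mono_ae ?_
  filter_upwards [ae_le_eLpNormEssSup (f := g) (μ := volume)] with x hx
  rw [enorm_mul, mul_comm, eLpNorm_exponent_top]
  gcongr

/-- Interpolation between `L^r` and `L^∞`. -/
theorem distLpNorm_two_mul_le {r : ℝ≥0∞} (hr : 1 ≤ r) (hr' : r ≠ ∞) {u : 𝓢'(Plane, ℂ)}
    (h1 : distLpNorm r u < ∞) (h2 : distLpNorm ∞ u < ∞) :
    distLpNorm (2 * r) u ≤ (distLpNorm ∞ u * distLpNorm r u) ^ (1 / 2 : ℝ) := by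
  obtain ⟨g, -, hg, hug, he⟩ := exists_rep_eq hr h1
  obtain ⟨k, -, hk, huk, he'⟩ := exists_rep_eq le_top h2
  have hgk := hug.unique huk (hg.locallyIntegrable hr) (hk.locallyIntegrable le_top)
  rw [← he', ← he, ← eLpNorm_congr_ae hgk]
  have hr0 : r ≠ 0 := (zero_lt_one.trans_le hr).ne'
  have hrt : 0 < r.toReal := ENNReal.toReal_pos hr0 hr'
  have h20 : 2 * r ≠ 0 := mul_ne_zero two_ne_zero hr0
  have h2t : 2 * r ≠ ∞ := ENNReal.mul_ne_top ENNReal.ofNat_ne_top hr'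
  have hle : eLpNorm g (2 * r) volume ≤
      (eLpNorm g ∞ volume * eLpNorm g r volume) ^ (1 / 2 : ℝ) := by
    rw [eLpNorm_le_iff_lintegral h20 h2t, ← ENNReal.rpow_mul]
    have e1 : (2 * r).toReal = r.toReal + r.toReal := by
      rw [ENNReal.toReal_mul, ENNReal.toReal_ofNat]; ring
    have e2 : (1 / 2 : ℝ) * (2 * r).toReal = r.toReal := by rw [e1]; ring
    rw [e2, ENNReal.mul_rpow_of_nonneg _ _ hrt.le]
    have e3 := (eLpNorm_le_iff_lintegral hr0 hr' g _).1 (le_refl (eLpNorm g r volume))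
    refine le_trans ?_ (mul_le_mul_right e3 _)
    rw [← lintegral_const_mul' _ _ (ENNReal.rpow_ne_top_of_nonneg hrt.le
      ((eLpNorm_congr_ae hgk).trans_lt hk.2).ne)]
    refine lintegral_mono_ae ?_
    filter_upwards [ae_le_eLpNormEssSup (f := g) (μ := volume)] with x hx
    -- `|g|^(2r) = |g|^r |g|^r`, with one factor bounded by the essential supremum.
    rw [e1, ENNReal.rpow_add_of_nonneg _ _ hrt.le hrt.le, eLpNorm_exponent_top]
    gcongr
  refine (distLpNorm_le hug ⟨hg.1, hle.trans_lt ?_⟩).trans hle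
  refine ENNReal.rpow_lt_top_of_nonneg (by norm_num) (ENNReal.mul_ne_top ?_ hg.2.ne)
  rw [eLpNorm_congr_ae hgk]; exact hk.2.ne

/-! ### Fourier multipliers with Schwartz symbols -/

/-- Tonelli, integrating first in the variable whose sections are uniformly bounded in `L¹`. It
justifies the exchanges of integrals below. -/
theorem integrable_mul_of_sections {α Ω : Type*} [MeasurableSpace α] [MeasurableSpace Ω]
    {μ : Measure α} {ν : Measure Ω} [SFinite μ] [SFinite ν] {κ : Ω → ℂ} (hκm : Measurable κ)
    (hκ : ∫⁻ ω, ‖κ ω‖ₑ ∂ν ≠ ∞) {F : α → Ω → ℂ} (hF : Measurable (Function.uncurry F))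
    {M : ℝ≥0∞} (hM : M ≠ ∞) (h : ∀ ω, ∫⁻ x, ‖F x ω‖ₑ ∂μ ≤ M) :
    Integrable (Function.uncurry fun x ω => κ ω * F x ω) (μ.prod ν) := by
  change Integrable (fun z : α × Ω => κ z.2 * F z.1 z.2) (μ.prod ν)
  have hm : Measurable fun z : α × Ω => κ z.2 * F z.1 z.2 :=
    (hκm.comp measurable_snd).mul hF
  refine ⟨hm.aestronglyMeasurable, ?_⟩
  rw [HasFiniteIntegral, lintegral_prod_symm' _ hm.enorm]
  calc ∫⁻ ω, ∫⁻ x, ‖κ ω * F x ω‖ₑ ∂μ ∂ν ≤ ∫⁻ ω, ‖κ ω‖ₑ * M ∂ν := by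
        refine lintegral_mono fun ω => ?_
        simp_rw [enorm_mul]
        have : Measurable fun x => ‖F x ω‖ₑ := (hF.comp measurable_prodMk_right).enorm
        rw [lintegral_const_mul _ this]
        gcongr
        exact h ω
    _ = (∫⁻ ω, ‖κ ω‖ₑ ∂ν) * M := lintegral_mul_const _ hκm.enorm
    _ < ∞ := ENNReal.mul_lt_top (lt_top_iff_ne_top.2 hκ) (lt_top_iff_ne_top.2 hM)

theorem lintegral_enorm_lt_top (m : 𝓢(Plane, ℂ)) : ∫⁻ x, ‖m x‖ₑ < ∞ := m.integrable.2

/-- The transpose of a multiplier is correlation with its kernel. The function `ψ` is reflected so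
that `𝓕⁻ ψ` becomes a Fourier transform; the product is then the transform of a convolution, and
applying `𝓕` twice reflects back. -/
theorem fourier_smulLeft_fourierInv (m ψ : 𝓢(Plane, ℂ)) (x : Plane) :
    𝓕 (SchwartzMap.smulLeftCLM ℂ m (𝓕⁻ ψ)) x = ∫ y, (𝓕⁻ m : 𝓢(Plane, ℂ)) y * ψ (x + y) := by
  let ψ' : 𝓢(Plane, ℂ) := SchwartzMap.compCLMOfContinuousLinearEquiv ℂ
    (ContinuousLinearEquiv.neg ℝ) ψ
  have hψ' : ∀ y, ψ' y = ψ (-y) := fun y => by simp [ψ']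
  have h1 : SchwartzMap.smulLeftCLM ℂ m (𝓕⁻ ψ) =
      𝓕 (SchwartzMap.convolution (ContinuousLinearMap.mul ℂ ℂ) (𝓕⁻ m : 𝓢(Plane, ℂ)) ψ') := by
    rw [SchwartzMap.fourier_convolution, FourierTransform.fourier_fourierInv_eq]
    ext ξ
    rw [SchwartzMap.smulLeftCLM_apply_apply m.hasTemperateGrowth, SchwartzMap.pairing_apply_apply,
      ContinuousLinearMap.mul_apply', smul_eq_mul]
    congr 1
    rw [SchwartzMap.fourierInv_coe, SchwartzMap.fourier_coe, Real.fourierInv_eq_fourier_comp_neg]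
    exact congrArg (fun f : Plane → ℂ => 𝓕 f ξ) (funext hψ').symm
  have h2 : ∀ h : 𝓢(Plane, ℂ), 𝓕 (𝓕 h) x = h (-x) := fun h => by
    rw [SchwartzMap.fourier_coe, ← neg_neg x, ← Real.fourierInv_eq_fourier_neg, neg_neg,
      ← SchwartzMap.fourierInv_coe, FourierTransform.fourierInv_fourier_eq]
  rw [h1, h2, SchwartzMap.convolution_apply, MeasureTheory.convolution]
  congr 1
  funext y
  rw [ContinuousLinearMap.mul_apply', hψ']
  congr 2
  abel

/-- Hölder's inequality against a translated test function. -/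
theorem lintegral_mul_translate_le {p : ℝ≥0∞} (hp : 1 ≤ p) {g : Plane → ℂ}
    (hg : MemLp g p volume) (ψ : 𝓢(Plane, ℂ)) (a : Plane) :
    ∫⁻ x, ‖g x * ψ (x + a)‖ₑ ≤ eLpNorm g p volume * eLpNorm ψ (1 - p⁻¹)⁻¹ volume := by
  -- `(1 - p⁻¹)⁻¹` is the exponent conjugate to `p`, equal to `∞` for `p = 1`.
  have := ENNReal.HolderConjugate.inv_one_sub_inv' hp
  have hs : AEStronglyMeasurable (fun x => ψ (x + a)) volume :=
    (ψ.continuous.comp (continuous_id.add continuous_const)).aestronglyMeasurable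
  have h := eLpNorm_smul_le_mul_eLpNorm (p := p) (q := (1 - p⁻¹)⁻¹) (r := 1) hs hg.1
  rw [eLpNorm_one_eq_lintegral_enorm] at h
  have e : eLpNorm (fun x => ψ (x + a)) (1 - p⁻¹)⁻¹ volume = eLpNorm ψ (1 - p⁻¹)⁻¹ volume :=
    eLpNorm_comp_measurePreserving ψ.continuous.aestronglyMeasurable
      (measurePreserving_add_right volume a)
  rw [e] at h
  exact h

theorem integral_translate_swap {p : ℝ≥0∞} (hp : 1 ≤ p) {N g : Plane → ℂ} (hNm : Measurable N)
    (hN : ∫⁻ y, ‖N y‖ₑ ≠ ∞) (hgm : Measurable g) (hg : MemLp g p volume) (ψ : 𝓢(Plane, ℂ)) :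
    ∫ x : Plane, (∫ y : Plane, N y * ψ (x + y)) * g x =
      ∫ x : Plane, ψ x * ∫ y : Plane, N y * g (x - y) := by
  have := ENNReal.HolderConjugate.inv_one_sub_inv' hp
  have hM : eLpNorm g p volume * eLpNorm ψ (1 - p⁻¹)⁻¹ volume ≠ ∞ :=
    ENNReal.mul_ne_top hg.2.ne (ψ.eLpNorm_lt_top _ volume).ne
  have hψm : Measurable ψ := ψ.continuous.measurable
  have m1 : Measurable (Function.uncurry fun x y : Plane => g x * ψ (x + y)) := by
    simp only [Function.uncurry_def]; fun_prop
  have m2 : Measurable (Function.uncurry fun x y : Plane => ψ x * g (x - y)) := by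
    simp only [Function.uncurry_def]; fun_prop
  have i1 := integrable_mul_of_sections (μ := (volume : Measure Plane)) hNm hN m1 hM
    fun y => lintegral_mul_translate_le hp hg ψ y
  have i2 := integrable_mul_of_sections (μ := (volume : Measure Plane)) hNm hN m2 hM
    fun y => by
      rw [← lintegral_add_right_eq_self _ y]
      simp_rw [add_sub_cancel_right, mul_comm (ψ _)]
      exact lintegral_mul_translate_le hp hg ψ y
  simp_rw [← integral_const_mul, ← integral_mul_const]
  calc ∫ x, ∫ y, N y * ψ (x + y) * g x = ∫ x, ∫ y, N y * (g x * ψ (x + y)) := by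
        congr 1; funext x; congr 1; funext y; ring
    _ = ∫ y, ∫ x, N y * (g x * ψ (x + y)) := integral_integral_swap i1
    _ = ∫ y, ∫ x, N y * (ψ x * g (x - y)) := by
        congr 1; funext y
        rw [← integral_add_right_eq_self (fun x => N y * (ψ x * g (x - y))) y]
        congr 1; funext x; rw [add_sub_cancel_right, mul_comm (g x)]
    _ = ∫ x, ∫ y, N y * (ψ x * g (x - y)) := (integral_integral_swap i2).symm
    _ = ∫ x, ∫ y, ψ x * (N y * g (x - y)) := by
        congr 1; funext x; congr 1; funext y; ring

/-- A Fourier multiplier with Schwartz symbol is a convolution. -/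
theorem rep_fourierMultiplier {p : ℝ≥0∞} (hp : 1 ≤ p) (m : 𝓢(Plane, ℂ)) {u : 𝓢'(Plane, ℂ)}
    {g : Plane → ℂ} (hgm : Measurable g) (hg : MemLp g p volume) (hu : Rep u g) :
    Rep (TemperedDistribution.fourierMultiplierCLM ℂ m u)
      (fun x => ∫ y, (𝓕⁻ m : 𝓢(Plane, ℂ)) y * g (x - y)) := by
  intro ψ
  have h0 : TemperedDistribution.fourierMultiplierCLM ℂ m u ψ =
      ∫ x : Plane, (∫ y : Plane, (𝓕⁻ m : 𝓢(Plane, ℂ)) y * ψ (x + y)) * g x := by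
    refine (hu _).trans ?_
    congr 1; funext x
    rw [← fourier_smulLeft_fourierInv]
    rfl
  rw [h0]
  generalize (𝓕⁻ m : 𝓢(Plane, ℂ)) = N
  exact integral_translate_swap hp N.continuous.measurable (lintegral_enorm_lt_top N).ne hgm hg ψ

/-- Young's inequality: the kernel lies in `L¹` and translations preserve the `L^p` norm. -/
theorem distLpNorm_fourierMultiplier_le {p : ℝ≥0∞} (hp : 1 ≤ p) (hp' : p ≠ ∞) (m : 𝓢(Plane, ℂ))
    {u : 𝓢'(Plane, ℂ)} (hu : distLpNorm p u < ∞) :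
    distLpNorm p (TemperedDistribution.fourierMultiplierCLM ℂ m u) ≤
      (∫⁻ y, ‖(𝓕⁻ m : 𝓢(Plane, ℂ)) y‖ₑ) * distLpNorm p u := by
  obtain ⟨g, hgm, hg, hug, he⟩ := exists_rep_eq hp hu
  have hgm := hgm.measurable
  set N : 𝓢(Plane, ℂ) := 𝓕⁻ m with hN
  have hF : Measurable (Function.uncurry fun x y : Plane => g (x - y)) := by
    simp only [Function.uncurry_def]; fun_prop
  have hle := eLpNorm_integral_mul_le (μ := (volume : Measure Plane))
    (ν := (volume : Measure Plane)) hp hp' N.continuous.measurable hF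
    (M := eLpNorm g p volume) fun y => (eLpNorm_comp_measurePreserving hg.1
      (measurePreserving_sub_right volume y)).le
  have hmeas : AEStronglyMeasurable (fun x => ∫ y, N y * g (x - y)) volume := by
    have : StronglyMeasurable (Function.uncurry fun x y : Plane => N y * g (x - y)) := by
      refine Measurable.stronglyMeasurable ?_
      have := N.continuous.measurable
      simp only [Function.uncurry_def]; fun_prop
    exact this.integral_prod_right.aestronglyMeasurable
  rw [← he]
  refine (distLpNorm_le (rep_fourierMultiplier hp m hgm hg hug) ⟨hmeas, hle.trans_lt ?_⟩).trans hle
  exact ENNReal.mul_lt_top (lintegral_enorm_lt_top N) hg.2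

/-- Jensen for the measure `|N| dy`, where `N` is the kernel, gives `|N * g|^p ≤ ‖N‖₁^(p-1) ∫ |N|
|g|^p`. Bounding the remaining `|N|` by its supremum gives Bernstein's inequality with the right
power of the frequency. -/
theorem distLpNorm_top_fourierMultiplier_le {p : ℝ≥0∞} (hp : 1 ≤ p) (hp' : p ≠ ∞)
    (m : 𝓢(Plane, ℂ)) {u : 𝓢'(Plane, ℂ)} (hu : distLpNorm p u < ∞) {S : ℝ≥0∞} (hS' : S ≠ ∞)
    (hS : ∀ y, ‖(𝓕⁻ m : 𝓢(Plane, ℂ)) y‖ₑ ≤ S) :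
    distLpNorm ∞ (TemperedDistribution.fourierMultiplierCLM ℂ m u) ≤
      ((∫⁻ y, ‖(𝓕⁻ m : 𝓢(Plane, ℂ)) y‖ₑ) ^ (p.toReal - 1) * S) ^ p.toReal⁻¹ *
        distLpNorm p u := by
  obtain ⟨g, hgm, hg, hug, he⟩ := exists_rep_eq hp hu
  have hgm := hgm.measurable
  have hp0 : p ≠ 0 := (zero_lt_one.trans_le hp).ne'
  have hp1 : 1 ≤ p.toReal := by
    rwa [← ENNReal.toReal_one, ENNReal.toReal_le_toReal ENNReal.one_ne_top hp']
  have hpos : 0 < p.toReal := by linarith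
  set N : 𝓢(Plane, ℂ) := 𝓕⁻ m with hN
  have hNm := N.continuous.measurable
  set A := ∫⁻ y, ‖N y‖ₑ with hA
  have hAt : A ≠ ∞ := (lintegral_enorm_lt_top N).ne
  have hpt : ∀ x, ‖∫ y, N y * g (x - y)‖ₑ ≤
      (A ^ (p.toReal - 1) * S) ^ p.toReal⁻¹ * eLpNorm g p volume := fun x => by
    have h1 : ‖∫ y, N y * g (x - y)‖ₑ ≤
        ∫⁻ y, ‖g (x - y)‖ₑ ∂(volume.withDensity fun y => ‖N y‖ₑ) := by
      rw [lintegral_withDensity_eq_lintegral_mul _ hNm.enorm (by fun_prop)]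
      refine (enorm_integral_le_lintegral_enorm _).trans (le_of_eq ?_)
      simp [enorm_mul]
    have h2 := rpow_lintegral_le (volume.withDensity fun y => ‖N y‖ₑ) hp1
      (h := fun y => ‖g (x - y)‖ₑ) (by fun_prop)
    have h3 := lintegral_withDensity_eq_lintegral_mul volume hNm.enorm
      (g := fun y => ‖g (x - y)‖ₑ ^ p.toReal) (by fun_prop)
    rw [withDensity_apply _ MeasurableSet.univ, Measure.restrict_univ, h3] at h2
    rw [← ENNReal.rpow_le_rpow_iff hpos, ENNReal.mul_rpow_of_nonneg _ _ hpos.le,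
      ← ENNReal.rpow_mul, inv_mul_cancel₀ hpos.ne', ENNReal.rpow_one]
    refine (ENNReal.rpow_le_rpow h1 hpos.le).trans (h2.trans ?_)
    rw [mul_assoc]
    gcongr
    calc ∫⁻ y, ((fun y => ‖N y‖ₑ) * fun y => ‖g (x - y)‖ₑ ^ p.toReal) y
        ≤ ∫⁻ y, S * ‖g (x - y)‖ₑ ^ p.toReal := by
          refine lintegral_mono fun y => ?_
          simp only [Pi.mul_apply]
          gcongr
          exact hS y
      _ = S * ∫⁻ y, ‖g (x - y)‖ₑ ^ p.toReal := lintegral_const_mul' _ _ hS'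
      _ = S * ∫⁻ y, ‖g y‖ₑ ^ p.toReal := by
          rw [lintegral_sub_left_eq_self (fun y => ‖g y‖ₑ ^ p.toReal) x]
      _ ≤ S * eLpNorm g p volume ^ p.toReal := by
          gcongr
          exact (eLpNorm_le_iff_lintegral hp0 hp' g _).1 le_rfl
  have hmeas : AEStronglyMeasurable (fun x => ∫ y, N y * g (x - y)) volume := by
    have : StronglyMeasurable (Function.uncurry fun x y : Plane => N y * g (x - y)) := by
      refine Measurable.stronglyMeasurable ?_
      simp only [Function.uncurry_def]; fun_prop
    exact this.integral_prod_right.aestronglyMeasurable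
  have hle : eLpNorm (fun x => ∫ y, N y * g (x - y)) ∞ volume ≤
      (A ^ (p.toReal - 1) * S) ^ p.toReal⁻¹ * eLpNorm g p volume := by
    rw [eLpNorm_exponent_top]
    exact essSup_le_of_ae_le _ (Filter.Eventually.of_forall hpt)
  rw [← he]
  refine (distLpNorm_le (rep_fourierMultiplier hp m hgm hg hug) ⟨hmeas, hle.trans_lt ?_⟩).trans hle
  refine ENNReal.mul_lt_top (ENNReal.rpow_lt_top_of_nonneg (by positivity) ?_) hg.2
  exact ENNReal.mul_ne_top (ENNReal.rpow_ne_top_of_nonneg (by linarith) hAt) hS'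

/-! ### Dilations of symbols and Bernstein inequalities. -/

/-- The `L¹` norm of the inverse Fourier transform is invariant under symmetric linear changes of
the frequency variable. -/
theorem lintegral_fourierInv_comp {V : Type*} [NormedAddCommGroup V] [InnerProductSpace ℝ V]
    [FiniteDimensional ℝ V] [MeasurableSpace V] [BorelSpace V] (D : V ≃L[ℝ] V)
    (hD : ∀ x y, inner ℝ (D x) y = inner ℝ x (D y)) (f : V → ℂ) :
    ∫⁻ x, ‖𝓕⁻ (fun ξ => f (D ξ)) x‖ₑ = ∫⁻ x, ‖𝓕⁻ f x‖ₑ := by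
  have hdet : LinearMap.det (D : V →ₗ[ℝ] V) ≠ 0 := (LinearEquiv.isUnit_det' D.toLinearEquiv).ne_zero
  set d : ℝ := |(LinearMap.det (D : V →ₗ[ℝ] V))⁻¹| with hd
  have hd0 : d ≠ 0 := by simp [hd, hdet]
  have hmap : Measure.map D (volume : Measure V) = ENNReal.ofReal d • volume :=
    Measure.map_linearMap_addHaar_eq_smul_addHaar volume hdet
  have hme : MeasurableEmbedding D := D.toHomeomorph.measurableEmbedding
  -- Symmetry turns `⟨ξ, D x⟩` into `⟨D ξ, x⟩`. The Jacobian of this substitution cancels the one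
  -- from integrating in `x`.
  have h1 : ∀ x, 𝓕⁻ (fun ξ => f (D ξ)) (D x) = (d : ℂ) * 𝓕⁻ f x := fun x => by
    rw [Real.fourierInv_eq, Real.fourierInv_eq]
    have : ∀ ξ, (Real.fourierChar (inner ℝ ξ (D x))) • f (D ξ) =
        (fun η => (Real.fourierChar (inner ℝ η x)) • f η) (D ξ) := fun ξ => by
      simp only [hD]
    simp_rw [this]
    rw [← hme.integral_map (fun η => (Real.fourierChar (inner ℝ η x)) • f η), hmap,
      integral_smul_measure, ENNReal.toReal_ofReal (abs_nonneg _), Complex.real_smul]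
  have h2 : ∀ G : V → ℝ≥0∞, ∫⁻ x, G (D x) = ENNReal.ofReal d * ∫⁻ x, G x := fun G => by
    rw [← hme.lintegral_map G, hmap, lintegral_smul_measure, smul_eq_mul]
  have h3 := h2 fun x => ‖𝓕⁻ (fun ξ => f (D ξ)) x‖ₑ
  simp_rw [h1, enorm_mul] at h3
  have h4 : ‖(d : ℂ)‖ₑ = ENNReal.ofReal d := by
    rw [← ofReal_norm, Complex.norm_real, Real.norm_of_nonneg (abs_nonneg _)]
  rw [lintegral_const_mul' _ _ (by simp), h4] at h3
  have hd1 : ENNReal.ofReal d ≠ 0 := by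
    rw [Ne, ENNReal.ofReal_eq_zero, not_le]; positivity
  exact ((ENNReal.mul_right_inj hd1 ENNReal.ofReal_ne_top).1 h3).symm

/-- Dilation of a Schwartz function. -/
def dil (c : ℝ) (hc : c ≠ 0) (m : 𝓢(Plane, ℂ)) : 𝓢(Plane, ℂ) :=
  SchwartzMap.compCLMOfContinuousLinearEquiv ℂ
    (ContinuousLinearEquiv.smulLeft (Units.mk0 c hc)) m

@[simp]
theorem dil_apply (c : ℝ) (hc : c ≠ 0) (m : 𝓢(Plane, ℂ)) (ξ : Plane) :
    dil c hc m ξ = m (c • ξ) := rfl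

theorem two_zpow_ne_zero (j : ℤ) : (2 : ℝ) ^ j ≠ 0 := zpow_ne_zero _ two_ne_zero

theorem lintegral_fourierInv_dil (c : ℝ) (hc : c ≠ 0) (m : 𝓢(Plane, ℂ)) :
    ∫⁻ x, ‖(𝓕⁻ (dil c hc m) : 𝓢(Plane, ℂ)) x‖ₑ = ∫⁻ x, ‖(𝓕⁻ m : 𝓢(Plane, ℂ)) x‖ₑ := by
  simp_rw [SchwartzMap.fourierInv_coe]
  refine lintegral_fourierInv_comp (ContinuousLinearEquiv.smulLeft (Units.mk0 c hc)) ?_ m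
  intro x y
  exact (real_inner_smul_left x y c).trans (real_inner_smul_right x y c).symm

/-- The supremum of the kernel is at most the `L¹` norm of the symbol, which scales by `2^(2j)` in
the plane. -/
theorem enorm_fourierInv_dil_le (j : ℤ) (m : 𝓢(Plane, ℂ)) (x : Plane) :
    ‖(𝓕⁻ (dil ((2 : ℝ) ^ (-j)) (two_zpow_ne_zero _) m) : 𝓢(Plane, ℂ)) x‖ₑ ≤
      (2 : ℝ≥0∞) ^ (2 * (j : ℝ)) * ∫⁻ ξ, ‖m ξ‖ₑ := by
  have h1 : ‖(𝓕⁻ (dil ((2 : ℝ) ^ (-j)) (two_zpow_ne_zero _) m) : 𝓢(Plane, ℂ)) x‖ ≤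
      ∫ ξ, ‖m ((2 : ℝ) ^ (-j) • ξ)‖ := by
    rw [SchwartzMap.fourierInv_coe, Real.fourierInv_eq]
    refine (norm_integral_le_integral_norm _).trans (le_of_eq ?_)
    simp [Circle.norm_smul]
  rw [Measure.integral_comp_smul volume (fun ξ => ‖m ξ‖)] at h1
  rw [← ofReal_norm]
  refine (ENNReal.ofReal_le_ofReal h1).trans (le_of_eq ?_)
  rw [smul_eq_mul, ENNReal.ofReal_mul (abs_nonneg _),
    ofReal_integral_norm_eq_lintegral_enorm m.integrable]
  congr 1
  have h2 : (2 : ℝ≥0∞) ^ (2 * (j : ℝ)) = ENNReal.ofReal ((2 : ℝ) ^ (2 * (j : ℝ))) := by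
    rw [← ENNReal.ofReal_rpow_of_pos two_pos, ENNReal.ofReal_ofNat]
  rw [h2]
  congr 1
  rw [finrank_euclideanSpace_fin, abs_of_nonneg (by positivity), mul_comm, Real.rpow_mul two_pos.le,
    Real.rpow_intCast, zpow_neg, inv_pow, inv_inv]
  norm_cast

theorem two_rpow_ne_zero (x : ℝ) : (2 : ℝ≥0∞) ^ x ≠ 0 := by simp

theorem two_rpow_ne_top (x : ℝ) : (2 : ℝ≥0∞) ^ x ≠ ∞ := by simp

theorem two_rpow_add (x y : ℝ) : (2 : ℝ≥0∞) ^ (x + y) = 2 ^ x * 2 ^ y :=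
  ENNReal.rpow_add _ _ two_ne_zero ENNReal.ofNat_ne_top

/-- Uniform bounds for dilated multipliers on `L^p`, from `L^p` to `L^∞` and from `L^p` to
`L^{2p}`. -/
theorem exists_multiplier_bound {p : ℝ≥0∞} (hp : 1 ≤ p) (hp' : p ≠ ∞) (m : 𝓢(Plane, ℂ)) :
    ∃ C : ℝ≥0∞, C ≠ 0 ∧ C ≠ ∞ ∧ ∀ (j : ℤ) (u : 𝓢'(Plane, ℂ)),
      distLpNorm p (TemperedDistribution.fourierMultiplierCLM ℂ
        (fun ξ => m ((2 : ℝ) ^ (-j) • ξ)) u) ≤ C * distLpNorm p u ∧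
      distLpNorm ∞ (TemperedDistribution.fourierMultiplierCLM ℂ
        (fun ξ => m ((2 : ℝ) ^ (-j) • ξ)) u) ≤
          C * 2 ^ (2 / p.toReal * (j : ℝ)) * distLpNorm p u ∧
      distLpNorm (2 * p) (TemperedDistribution.fourierMultiplierCLM ℂ
        (fun ξ => m ((2 : ℝ) ^ (-j) • ξ)) u) ≤
          C * 2 ^ (1 / p.toReal * (j : ℝ)) * distLpNorm p u := by
  have hp0 : p ≠ 0 := (zero_lt_one.trans_le hp).ne'
  have hp1 : 1 ≤ p.toReal := by
    rwa [← ENNReal.toReal_one, ENNReal.toReal_le_toReal ENNReal.one_ne_top hp']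
  have hpos : 0 < p.toReal := by linarith
  set A := ∫⁻ x, ‖(𝓕⁻ m : 𝓢(Plane, ℂ)) x‖ₑ with hA
  set B := ∫⁻ x, ‖m x‖ₑ with hB
  have hAt : A ≠ ∞ := (lintegral_enorm_lt_top _).ne
  have hBt : B ≠ ∞ := (lintegral_enorm_lt_top _).ne
  set C' := (A ^ (p.toReal - 1) * B) ^ p.toReal⁻¹ with hC'
  have hC't : C' ≠ ∞ := ENNReal.rpow_ne_top_of_nonneg (by positivity)
    (ENNReal.mul_ne_top (ENNReal.rpow_ne_top_of_nonneg (by linarith) hAt) hBt)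
  have hCt : A + C' + 1 ≠ ∞ := by simp [hAt, hC't]
  -- The summand `1` keeps the constant nonzero, so that the bounds are trivial when the norm of `u`
  -- is infinite.
  refine ⟨A + C' + 1, by simp, hCt, fun j u => ?_⟩
  have hC0 : A + C' + 1 ≠ 0 := by simp
  by_cases hu : distLpNorm p u = ∞
  · rw [hu, ENNReal.mul_top hC0, ENNReal.mul_top (mul_ne_zero hC0 (two_rpow_ne_zero _)),
      ENNReal.mul_top (mul_ne_zero hC0 (two_rpow_ne_zero _))]
    exact ⟨le_top, le_top, le_top⟩
  have hu' := lt_top_iff_ne_top.2 hu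
  set mj := dil ((2 : ℝ) ^ (-j)) (two_zpow_ne_zero _) m with hmj
  have hAj : ∫⁻ x, ‖(𝓕⁻ mj : 𝓢(Plane, ℂ)) x‖ₑ = A := lintegral_fourierInv_dil _ _ m
  change distLpNorm p (TemperedDistribution.fourierMultiplierCLM ℂ mj u) ≤ _ ∧
    distLpNorm ∞ (TemperedDistribution.fourierMultiplierCLM ℂ mj u) ≤ _ ∧
    distLpNorm (2 * p) (TemperedDistribution.fourierMultiplierCLM ℂ mj u) ≤ _
  have h1 := distLpNorm_fourierMultiplier_le hp hp' mj hu'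
  have h2 := distLpNorm_top_fourierMultiplier_le hp hp' mj hu'
    (ENNReal.mul_ne_top (two_rpow_ne_top _) hBt) (enorm_fourierInv_dil_le j m)
  rw [hAj] at h1 h2
  have e : (A ^ (p.toReal - 1) * (2 ^ (2 * (j : ℝ)) * B)) ^ p.toReal⁻¹ =
      C' * 2 ^ (2 / p.toReal * (j : ℝ)) := by
    rw [show A ^ (p.toReal - 1) * (2 ^ (2 * (j : ℝ)) * B) =
      (A ^ (p.toReal - 1) * B) * 2 ^ (2 * (j : ℝ)) by ring,
      ENNReal.mul_rpow_of_nonneg _ _ (by positivity), ← ENNReal.rpow_mul]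
    congr 2; field_simp
  rw [e] at h2
  have k1 : distLpNorm p (TemperedDistribution.fourierMultiplierCLM ℂ mj u) ≤
      (A + C' + 1) * distLpNorm p u := h1.trans (by gcongr; rw [add_assoc]; exact le_self_add)
  have k2 : distLpNorm ∞ (TemperedDistribution.fourierMultiplierCLM ℂ mj u) ≤
      (A + C' + 1) * 2 ^ (2 / p.toReal * (j : ℝ)) * distLpNorm p u :=
    h2.trans (by gcongr; rw [add_right_comm]; exact le_add_self)
  refine ⟨k1, k2, ?_⟩
  refine (distLpNorm_two_mul_le hp hp' (k1.trans_lt ?_) (k2.trans_lt ?_)).trans ?_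
  · exact ENNReal.mul_lt_top hCt.lt_top hu'
  · exact ENNReal.mul_lt_top (ENNReal.mul_lt_top hCt.lt_top (two_rpow_ne_top _).lt_top) hu'
  · calc _ ≤ ((A + C' + 1) * 2 ^ (2 / p.toReal * (j : ℝ)) * distLpNorm p u *
          ((A + C' + 1) * distLpNorm p u)) ^ (1 / 2 : ℝ) := by gcongr
      _ = (((A + C' + 1) * 2 ^ (1 / p.toReal * (j : ℝ)) * distLpNorm p u) ^ (2 : ℝ)) ^
          (1 / 2 : ℝ) := by
        congr 1
        rw [show 2 / p.toReal * (j : ℝ) = 1 / p.toReal * j + 1 / p.toReal * j by ring,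
          two_rpow_add, ENNReal.rpow_ofNat]
        ring
      _ = _ := by rw [← ENNReal.rpow_mul]; norm_num
      _ ≤ _ := le_rfl

/-! ### Bilinear Fourier multipliers -/

/-- Pairs of frequencies with the Euclidean norm. -/
abbrev Plane2 := WithLp 2 (Plane × Plane)

/-- The pair `(y, x)`. -/
abbrev pr (y x : Plane) : Plane2 := WithLp.toLp 2 (y, x)

theorem continuous_pr : Continuous fun z : Plane × Plane => pr z.1 z.2 :=
  WithLp.prod_continuous_toLp 2 Plane Plane

theorem inner_pr (y x a b : Plane) : inner ℝ (pr y x) (pr a b) = inner ℝ y a + inner ℝ x b := by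
  simp [WithLp.prod_inner_apply]

theorem norm_le_pr_left (y x : Plane) : ‖y‖ ≤ ‖pr y x‖ := WithLp.norm_fst_le Plane (pr y x)

theorem norm_le_pr_right (y x : Plane) : ‖x‖ ≤ ‖pr y x‖ := WithLp.norm_snd_le Plane (pr y x)

theorem hasTemperateGrowth_pr (y : Plane) :
    Function.HasTemperateGrowth fun x : Plane => pr y x := by
  let L : Plane →L[ℝ] Plane2 := (WithLp.prodContinuousLinearEquiv 2 ℝ Plane Plane).symm.toContinuousLinearMap ∘L
    ContinuousLinearMap.inr ℝ Plane Plane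
  have : (fun x : Plane => pr y x) = fun x => pr y 0 + L x := by
    funext x
    change pr y x = pr y 0 + pr 0 x
    rw [← WithLp.toLp_add, Prod.mk_add_mk, add_zero, zero_add]
  rw [this]
  fun_prop

/-- The section `x ↦ f (y, x)` of a Schwartz function. -/
def sec (f : 𝓢(Plane2, ℂ)) (y : Plane) : 𝓢(Plane, ℂ) :=
  SchwartzMap.compCLMOfAntilipschitz ℂ (K := 1) (hasTemperateGrowth_pr y)
    (fun a b => by
      rw [ENNReal.coe_one, one_mul, edist_dist, edist_dist]
      refine ENNReal.ofReal_le_ofReal ?_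
      rw [dist_eq_norm, dist_eq_norm]
      have : pr y a - pr y b = pr 0 (a - b) := by
        rw [← WithLp.toLp_sub, Prod.mk_sub_mk, sub_self]
      rw [this]
      exact norm_le_pr_right 0 (a - b)) f

@[simp]
theorem sec_apply (f : 𝓢(Plane2, ℂ)) (y x : Plane) : sec f y x = f (pr y x) := rfl

/-- The exponent 3 exceeds the dimension 2, so the bound is integrable in `x`, while the decay in
`y` is as fast as desired. -/
theorem exists_decay (f : 𝓢(Plane2, ℂ)) (n : ℕ) :
    ∃ C : ℝ, 0 ≤ C ∧ ∀ y x, ‖f (pr y x)‖ ≤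
      C * (1 + ‖y‖) ^ (-(n : ℝ)) * (1 + ‖x‖) ^ (-(3 : ℝ)) := by
  refine ⟨2 ^ (n + 3) * (Finset.Iic (n + 3, 0)).sup (schwartzSeminormFamily ℝ Plane2 ℂ) f,
    by positivity, fun y x => ?_⟩
  have h := SchwartzMap.one_add_le_sup_seminorm_apply (𝕜 := ℝ) (m := (n + 3, 0)) (le_refl (n + 3)) (le_refl 0)
    f (pr y x)
  rw [norm_iteratedFDeriv_zero] at h
  have h1 : (1 + ‖y‖) ^ n * (1 + ‖x‖) ^ 3 ≤ (1 + ‖pr y x‖) ^ (n + 3) := by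
    rw [pow_add]
    have := norm_le_pr_left y x
    have := norm_le_pr_right y x
    gcongr
  rw [Real.rpow_neg (by positivity), Real.rpow_neg (by positivity), Real.rpow_natCast,
    show (3 : ℝ) = ((3 : ℕ) : ℝ) by norm_num, Real.rpow_natCast, mul_assoc, ← mul_inv,
    ← div_eq_mul_inv, le_div_iff₀ (by positivity)]
  calc ‖f (pr y x)‖ * ((1 + ‖y‖) ^ n * (1 + ‖x‖) ^ 3)
      ≤ ‖f (pr y x)‖ * (1 + ‖pr y x‖) ^ (n + 3) := by gcongr
    _ ≤ _ := by rw [mul_comm]; exact h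

theorem integrable_decay : Integrable fun x : Plane => (1 + ‖x‖) ^ (-(3 : ℝ)) :=
  integrable_one_add_norm (by simp; norm_num)

/-- Integration of a Schwartz function of two variables against a bounded function. -/
def contract (g : Plane → ℂ) (f : 𝓢(Plane2, ℂ)) (y : Plane) : ℂ := ∫ x, g x * f (pr y x)

section contract

variable {g : Plane → ℂ} (hg : Measurable g) {B : ℝ} (hB : ∀ x, ‖g x‖ ≤ B) (f : 𝓢(Plane2, ℂ))

include hg hB

omit hg in
theorem exists_norm_contract_le (n : ℕ) :
    ∃ C : ℝ, ∀ y, ‖contract g f y‖ ≤ C * (1 + ‖y‖) ^ (-(n : ℝ)) := by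
  have hB0 : 0 ≤ B := (norm_nonneg _).trans (hB 0)
  obtain ⟨C, hC, h⟩ := exists_decay f n
  refine ⟨∫ x : Plane, B * (C * (1 + ‖x‖) ^ (-(3 : ℝ))), fun y => ?_⟩
  rw [contract, ← integral_mul_const]
  refine norm_integral_le_of_norm_le ((integrable_decay.const_mul C).const_mul B |>.mul_const _)
    (Filter.Eventually.of_forall fun x => ?_)
  rw [norm_mul]
  calc _ ≤ B * (C * (1 + ‖y‖) ^ (-(n : ℝ)) * (1 + ‖x‖) ^ (-(3 : ℝ))) :=
        mul_le_mul (hB x) (h y x) (norm_nonneg _) hB0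
    _ = _ := by ring

theorem continuous_contract : Continuous (contract g f) := by
  have hB0 : 0 ≤ B := (norm_nonneg _).trans (hB 0)
  obtain ⟨C, hC, h⟩ := exists_decay f 0
  refine continuous_of_dominated (bound := fun x => B * (C * (1 + ‖x‖) ^ (-(3 : ℝ))))
    (fun y => ?_) (fun y => Filter.Eventually.of_forall fun x => ?_)
    ((integrable_decay.const_mul C).const_mul B) (Filter.Eventually.of_forall fun x => ?_)
  · refine (hg.mul ?_).aestronglyMeasurable
    exact (f.continuous.comp (continuous_pr.comp (Continuous.prodMk_right y))).measurable
  · rw [norm_mul]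
    refine mul_le_mul (hB x) ?_ (norm_nonneg _) hB0
    simpa using h y x
  · exact continuous_const.mul (f.continuous.comp (continuous_pr.comp (Continuous.prodMk_left x)))

/-- All moments are finite, which makes the Fourier transform of the contraction smooth. -/
theorem integrable_pow_mul_contract (n : ℕ) :
    Integrable fun y => ‖y‖ ^ n * ‖contract g f y‖ := by
  obtain ⟨C, h⟩ := exists_norm_contract_le hB f (n + 3)
  refine (integrable_decay.const_mul C).mono' ?_ (Filter.Eventually.of_forall fun y => ?_)
  · exact ((continuous_norm.pow n).mul (continuous_contract hg hB f).norm).aestronglyMeasurable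
  · rw [norm_mul, norm_pow, norm_norm, norm_norm]
    have h0 : 0 < 1 + ‖y‖ := by positivity
    calc ‖y‖ ^ n * ‖contract g f y‖ ≤ (1 + ‖y‖) ^ n * (C * (1 + ‖y‖) ^ (-((n + 3 : ℕ) : ℝ))) := by
          gcongr
          · linarith
          · exact h y
      _ = C * (1 + ‖y‖) ^ (-(3 : ℝ)) := by
          rw [← Real.rpow_natCast, mul_left_comm, ← Real.rpow_add h0]
          congr 2
          push_cast; ring

theorem integrable_contract : Integrable (contract g f) := by
  have h := integrable_pow_mul_contract hg hB f 0
  simp only [pow_zero, one_mul] at h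
  exact (integrable_norm_iff (continuous_contract hg hB f).aestronglyMeasurable).1 h

theorem integrable_mul_pr :
    Integrable (Function.uncurry fun y x => g x * f (pr y x)) (volume.prod volume) := by
  have hB0 : 0 ≤ B := (norm_nonneg _).trans (hB 0)
  obtain ⟨C, hC, h⟩ := exists_decay f 3
  refine ((integrable_decay.mul_prod integrable_decay).const_mul (B * C)).mono' ?_
    (Filter.Eventually.of_forall fun z => ?_)
  · exact ((hg.comp measurable_snd).mul
      (f.continuous.comp continuous_pr).measurable).aestronglyMeasurable
  · change ‖g z.2 * f (pr z.1 z.2)‖ ≤ _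
    rw [norm_mul]
    calc _ ≤ B * (C * (1 + ‖z.1‖) ^ (-((3 : ℕ) : ℝ)) * (1 + ‖z.2‖) ^ (-(3 : ℝ))) :=
          mul_le_mul (hB _) (h _ _) (norm_nonneg _) hB0
      _ = _ := by push_cast; ring

end contract

theorem integral_plane2 (F : Plane2 → ℂ) : ∫ w, F w = ∫ z : Plane × Plane, F (pr z.1 z.2) :=
  ((WithLp.volume_preserving_toLp Plane Plane).integral_comp
    (MeasurableEquiv.toLp 2 (Plane × Plane)).measurableEmbedding F).symm

theorem lintegral_plane2 (F : Plane2 → ℝ≥0∞) :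
    ∫⁻ w, F w = ∫⁻ z : Plane × Plane, F (pr z.1 z.2) :=
  ((WithLp.volume_preserving_toLp Plane Plane).lintegral_comp_emb
    (MeasurableEquiv.toLp 2 (Plane × Plane)).measurableEmbedding F).symm

/-! ### Partial Fourier transforms of functions of two variables. -/

/-- The unitary characters of the plane. -/
def chr (x : Plane) (η : Plane) : ℂ := (Real.fourierChar (-inner ℝ η x) : ℂ)

theorem norm_chr (x η : Plane) : ‖chr x η‖ = 1 := Circle.norm_coe _

theorem continuous_chr (x : Plane) : Continuous (chr x) := by
  unfold chr
  have : Continuous fun η : Plane => -inner ℝ η x := by fun_prop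
  exact continuous_subtype_val.comp (Real.continuous_fourierChar.comp this)

theorem fourier_eq_chr (f : Plane → ℂ) (x : Plane) : 𝓕 f x = ∫ η, chr x η * f η := by
  rw [Real.fourier_eq]; rfl

theorem fourierInv_eq_chr (f : Plane → ℂ) (x : Plane) : 𝓕⁻ f x = ∫ η, chr (-x) η * f η := by
  rw [Real.fourierInv_eq]
  congr 1; funext η
  simp [chr, Circle.smul_def]

theorem fourier_sec (Φ : 𝓢(Plane2, ℂ)) (ξ x : Plane) :
    (𝓕 (sec Φ ξ) : 𝓢(Plane, ℂ)) x = contract (chr x) Φ ξ := by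
  rw [SchwartzMap.fourier_coe, fourier_eq_chr]
  simp [contract]

theorem fourier_contract_chr (Φ : 𝓢(Plane2, ℂ)) (y x : Plane) :
    𝓕 (contract (chr x) Φ) y = (𝓕 Φ : 𝓢(Plane2, ℂ)) (pr y x) := by
  rw [SchwartzMap.fourier_coe, fourier_eq_chr, Real.fourier_eq, integral_plane2]
  have hi := (integrable_mul_pr (continuous_chr x).measurable (fun η => (norm_chr x η).le) Φ)
  have hi2 : Integrable (Function.uncurry fun ξ η => chr y ξ * (chr x η * Φ (pr ξ η)))
      ((volume : Measure Plane).prod (volume : Measure Plane)) :=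
    hi.bdd_mul (f := fun z : Plane × Plane => chr y z.1) (c := 1)
      ((continuous_chr y).comp continuous_fst).aestronglyMeasurable
      (Filter.Eventually.of_forall fun z => (norm_chr y z.1).le)
  have e : ∀ z : Plane × Plane, Real.fourierChar (-inner ℝ (pr z.1 z.2) (pr y x)) • Φ (pr z.1 z.2) =
      (Function.uncurry fun ξ η => chr y ξ * (chr x η * Φ (pr ξ η))) z := fun z => by
    rw [inner_pr, neg_add, AddChar.map_add_eq_mul, Circle.smul_def]
    simp only [Function.uncurry_def, chr, Circle.coe_mul, smul_eq_mul]
    ring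
  simp_rw [e]
  rw [Measure.volume_eq_prod, integral_prod _ hi2]
  congr 1; funext ξ
  rw [contract, ← integral_const_mul]
  rfl

/-- Fourier inversion in the first variable alone recovers the transform in the second variable from
the full transform. -/
theorem contract_chr_eq (Φ : 𝓢(Plane2, ℂ)) (ξ x : Plane) :
    contract (chr x) Φ ξ = ∫ y, chr (-ξ) y * (𝓕 Φ : 𝓢(Plane2, ℂ)) (pr y x) := by
  have hm := (continuous_chr x).measurable
  have hB := fun η => (norm_chr x η).le
  have hF : 𝓕 (contract (chr x) Φ) = fun y => (𝓕 Φ : 𝓢(Plane2, ℂ)) (pr y x) :=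
    funext fun y => fourier_contract_chr Φ y x
  have hint : Integrable (𝓕 (contract (chr x) Φ)) := by
    rw [hF]
    obtain ⟨C, hC, h⟩ := exists_decay (𝓕 Φ : 𝓢(Plane2, ℂ)) 3
    refine (integrable_decay.const_mul C).mono' ?_ (Filter.Eventually.of_forall fun y => ?_)
    · exact ((𝓕 Φ : 𝓢(Plane2, ℂ)).continuous.comp
        (continuous_pr.comp (Continuous.prodMk_left x))).aestronglyMeasurable
    · refine (h y x).trans ?_
      have : (1 + ‖x‖) ^ (-(3 : ℝ)) ≤ 1 :=
        Real.rpow_le_one_of_one_le_of_nonpos (by simp) (by norm_num)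
      push_cast
      exact mul_le_of_le_one_right (by positivity) this
  have h := Continuous.fourierInv_fourier_eq (continuous_contract hm hB Φ)
    (integrable_contract hm hB Φ) hint
  rw [← h, fourierInv_eq_chr, hF]

/-! ### The tensor product of two Fourier transforms against a test function. -/

section pairing

variable {u v : 𝓢'(Plane, ℂ)} {gu gv : Plane → ℂ} (hu : Rep u gu) (hv : Rep v gv)
  (hgv : Measurable gv) {B : ℝ} (hB : ∀ x, ‖gv x‖ ≤ B) (Φ : 𝓢(Plane2, ℂ))

include hv hgv hB in
-- Exhibits the inner pairing, as a function of `ξ`, as the inverse transform of an explicit rapidly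
-- decreasing function; its regularity in `ξ` can be read off from there.
theorem fourier_apply_sec (ξ : Plane) :
    (𝓕 v : 𝓢'(Plane, ℂ)) (sec Φ ξ) = 𝓕⁻ (contract gv (𝓕 Φ : 𝓢(Plane2, ℂ))) ξ := by
  rw [TemperedDistribution.fourier_apply, hv, fourierInv_eq_chr]
  have hi := integrable_mul_pr hgv hB (𝓕 Φ : 𝓢(Plane2, ℂ))
  have hi2 : Integrable (Function.uncurry fun y x => chr (-ξ) y * (gv x * (𝓕 Φ : 𝓢(Plane2, ℂ)) (pr y x)))
      ((volume : Measure Plane).prod (volume : Measure Plane)) :=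
    hi.bdd_mul (f := fun z : Plane × Plane => chr (-ξ) z.1) (c := 1)
      ((continuous_chr (-ξ)).comp continuous_fst).aestronglyMeasurable
      (Filter.Eventually.of_forall fun z => (norm_chr _ z.1).le)
  simp_rw [fourier_sec, contract_chr_eq, contract, ← integral_const_mul, ← integral_mul_const]
  rw [integral_integral_swap hi2]
  congr 1; funext x; congr 1; funext y; ring

include hu hv hgv hB in
/-- The tensor product of the Fourier transforms of two functions applied to a test function. -/
theorem isTensorPairing_of_rep (hΦ : HasCompactSupport Φ) :
    IsTensorPairing (𝓕 u) (𝓕 v) (fun ξ η => Φ (pr ξ η))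
      (∫ y, contract gv (𝓕 Φ : 𝓢(Plane2, ℂ)) y * gu y) := by
  set G := contract gv (𝓕 Φ : 𝓢(Plane2, ℂ)) with hG
  have hGi : ∀ n : ℕ, Integrable fun y => ‖y‖ ^ n * ‖G y‖ :=
    integrable_pow_mul_contract hgv hB _
  -- The inner pairing must be a Schwartz function of `ξ`: it is smooth because all moments of `G`
  -- are integrable, and it inherits compact support from `Φ`.
  have hsm : ContDiff ℝ (⊤ : ℕ∞) (𝓕⁻ G) := by
    have : 𝓕⁻ G = fun ξ => 𝓕 G (-ξ) := funext fun ξ => Real.fourierInv_eq_fourier_neg G ξ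
    rw [this]
    exact (Real.contDiff_fourier (N := ⊤) fun n _ => hGi n).comp contDiff_neg
  have hcs : HasCompactSupport (𝓕⁻ G) := by
    obtain ⟨R, hR⟩ := hΦ.isCompact.isBounded.exists_norm_le
    refine HasCompactSupport.intro (isCompact_closedBall (0 : Plane) R) fun ξ hξ => ?_
    rw [← fourier_apply_sec hv hgv hB Φ ξ]
    have : sec Φ ξ = 0 := by
      ext x
      rw [sec_apply]
      by_contra hne
      refine hξ ?_
      rw [mem_closedBall_zero_iff]
      exact (norm_le_pr_left ξ x).trans (hR _ (subset_tsupport _ hne))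
    rw [this, map_zero]
  have hs : ∀ ξ, hcs.toSchwartzMap hsm ξ = 𝓕⁻ G ξ := fun ξ => rfl
  refine ⟨hcs.toSchwartzMap hsm, fun ξ => ⟨sec Φ ξ, fun η => sec_apply Φ ξ η, ?_⟩, ?_⟩
  · rw [hs, fourier_apply_sec hv hgv hB]
  · rw [TemperedDistribution.fourier_apply, hu]
    have hc : ((hcs.toSchwartzMap hsm : 𝓢(Plane, ℂ)) : Plane → ℂ) = 𝓕⁻ G := funext hs
    have hinv : 𝓕 (𝓕⁻ G) = G := Continuous.fourier_fourierInv_eq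
      (continuous_contract hgv hB _) (integrable_contract hgv hB _) (by
        have h1 : Integrable (𝓕⁻ G) := hc ▸ (hcs.toSchwartzMap hsm).integrable
        have h2 : 𝓕 G = fun ξ => 𝓕⁻ G (-ξ) := funext fun ξ => by
          rw [Real.fourierInv_eq_fourier_neg, neg_neg]
        rw [h2]
        exact h1.comp_neg)
    rw [SchwartzMap.fourier_coe, hc, hinv]

end pairing

/-- A distribution with finite `L^∞` norm is given by a bounded measurable function. -/
theorem exists_rep_bounded {u : 𝓢'(Plane, ℂ)} (h : distLpNorm ∞ u < ∞) :
    ∃ (g : Plane → ℂ) (B : ℝ), Measurable g ∧ (∀ x, ‖g x‖ ≤ B) ∧ Rep u g := by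
  obtain ⟨g, hgm, hg, hug, -⟩ := exists_rep_eq le_top h
  set B := (eLpNorm g ∞ volume).toReal with hB
  have hae : ∀ᵐ x, ‖g x‖ ≤ B := by
    filter_upwards [ae_le_eLpNormEssSup (f := g) (μ := volume)] with x hx
    rw [hB, eLpNorm_exponent_top, ← toReal_enorm]
    exact ENNReal.toReal_mono (by rw [← eLpNorm_exponent_top]; exact hg.2.ne) hx
  have hset : MeasurableSet {x | ‖g x‖ ≤ B} :=
    measurableSet_le hgm.measurable.norm measurable_const
  -- Cutting off on a null set turns the almost everywhere bound into a bound everywhere.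
  refine ⟨{x | ‖g x‖ ≤ B}.indicator g, B, hgm.measurable.indicator hset, fun x => ?_,
    hug.congr ?_⟩
  · by_cases hx : x ∈ {x | ‖g x‖ ≤ B}
    · rw [Set.indicator_of_mem hx]; exact hx
    · rw [Set.indicator_of_notMem hx, norm_zero]; exact ENNReal.toReal_nonneg
  · filter_upwards [hae] with x hx
    rw [Set.indicator_of_mem (by exact hx)]

theorem memLp_top_of_bounded {g : Plane → ℂ} {B : ℝ} (hg : Measurable g) (hB : ∀ x, ‖g x‖ ≤ B) :
    MemLp g ∞ volume :=
  memLp_top_of_bound hg.aestronglyMeasurable B (Filter.Eventually.of_forall hB)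

theorem Rep.memLp {p : ℝ≥0∞} (hp : 1 ≤ p) {u : 𝓢'(Plane, ℂ)} {g : Plane → ℂ} {B : ℝ}
    (hu : Rep u g) (hg : Measurable g) (hB : ∀ x, ‖g x‖ ≤ B) (h : distLpNorm p u < ∞) :
    MemLp g p volume := by
  obtain ⟨k, -, hk, huk, -⟩ := exists_rep_eq hp h
  exact (memLp_congr_ae (hu.unique huk ((memLp_top_of_bounded hg hB).locallyIntegrable le_top)
    (hk.locallyIntegrable hp))).2 hk

/-! ### Bilinear multipliers as bilinear convolutions. -/

theorem hasTemperateGrowth_comp_add (ψ : 𝓢(Plane, ℂ)) :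
    Function.HasTemperateGrowth fun w : Plane2 => ψ (w.fst + w.snd) := by
  let L : Plane2 →L[ℝ] Plane := (ContinuousLinearMap.fst ℝ Plane Plane +
    ContinuousLinearMap.snd ℝ Plane Plane) ∘L
      (WithLp.prodContinuousLinearEquiv 2 ℝ Plane Plane).toContinuousLinearMap
  exact ψ.hasTemperateGrowth.comp L.hasTemperateGrowth

/-- The test function `M(ξ, η) ψ(ξ + η)`. -/
def tensorTest (M : 𝓢(Plane2, ℂ)) (ψ : 𝓢(Plane, ℂ)) : 𝓢(Plane2, ℂ) :=
  SchwartzMap.smulLeftCLM ℂ (fun w : Plane2 => ψ (w.fst + w.snd)) M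

theorem tensorTest_apply (M : 𝓢(Plane2, ℂ)) (ψ : 𝓢(Plane, ℂ)) (w : Plane2) :
    tensorTest M ψ w = M w * ψ (w.fst + w.snd) := by
  rw [tensorTest, SchwartzMap.smulLeftCLM_apply_apply (hasTemperateGrowth_comp_add ψ), smul_eq_mul,
    mul_comm]

/-- Expanding `ψ(ξ + η)` by Fourier inversion as a superposition of characters shifts both arguments
of the kernel of `M` by the same `z`; this common shift produces the bilinear convolution evaluated
at `z`. -/
theorem fourier_tensorTest (M : 𝓢(Plane2, ℂ)) (ψ : 𝓢(Plane, ℂ)) (y x : Plane) :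
    (𝓕 (tensorTest M ψ) : 𝓢(Plane2, ℂ)) (pr y x) =
      ∫ z, (𝓕 ψ : 𝓢(Plane, ℂ)) z * (𝓕⁻ M : 𝓢(Plane2, ℂ)) (pr (z - y) (z - x)) := by
  have hψ : ∀ ζ, ψ ζ = ∫ z, chr (-ζ) z * (𝓕 ψ : 𝓢(Plane, ℂ)) z := fun ζ => by
    rw [← fourierInv_eq_chr, ← SchwartzMap.fourierInv_coe, FourierTransform.fourierInv_fourier_eq]
  have hchr : Measurable fun q : Plane2 × Plane =>
      (Real.fourierChar (inner ℝ q.1 (pr (q.2 - y) (q.2 - x))) : ℂ) := by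
    have h1 : Continuous fun q : Plane2 × Plane => pr (q.2 - y) (q.2 - x) :=
      continuous_pr.comp (by fun_prop : Continuous fun q : Plane2 × Plane => (q.2 - y, q.2 - x))
    have : Continuous fun q : Plane2 × Plane => inner ℝ q.1 (pr (q.2 - y) (q.2 - x)) := by
      fun_prop
    exact (continuous_subtype_val.comp (Real.continuous_fourierChar.comp this)).measurable
  have hi : Integrable (Function.uncurry fun (w : Plane2) (z : Plane) =>
      (𝓕 ψ : 𝓢(Plane, ℂ)) z * ((Real.fourierChar (inner ℝ w (pr (z - y) (z - x))) : ℂ) * M w))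
      ((volume : Measure Plane2).prod (volume : Measure Plane)) := by
    refine integrable_mul_of_sections (𝓕 ψ : 𝓢(Plane, ℂ)).continuous.measurable
      (lintegral_enorm_lt_top _).ne (M := ∫⁻ w, ‖M w‖ₑ) ?_ M.integrable.2.ne fun z => ?_
    · exact hchr.mul (M.continuous.measurable.comp measurable_fst)
    · simp only [enorm_mul]
      refine lintegral_mono fun w => ?_
      rw [← ofReal_norm (Real.fourierChar _ : ℂ), Circle.norm_coe, ENNReal.ofReal_one, one_mul]
  rw [SchwartzMap.fourier_coe, SchwartzMap.fourierInv_coe, Real.fourier_eq]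
  calc ∫ w, Real.fourierChar (-inner ℝ w (pr y x)) • tensorTest M ψ w
      = ∫ w, ∫ z, (𝓕 ψ : 𝓢(Plane, ℂ)) z *
          ((Real.fourierChar (inner ℝ w (pr (z - y) (z - x))) : ℂ) * M w) := by
        congr 1; funext w
        rw [tensorTest_apply, hψ, Circle.smul_def, smul_eq_mul, ← integral_const_mul,
          ← integral_const_mul]
        congr 1; funext z
        have : inner ℝ w (pr (z - y) (z - x)) =
            -inner ℝ w (pr y x) + -inner ℝ z (-(w.fst + w.snd)) := by
          have e1 : inner ℝ w (pr (z - y) (z - x)) =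
            inner ℝ w.fst (z - y) + inner ℝ w.snd (z - x) := by simp [WithLp.prod_inner_apply]
          have e2 : inner ℝ w (pr y x) = inner ℝ w.fst y + inner ℝ w.snd x := by
            simp [WithLp.prod_inner_apply]
          rw [e1, e2, inner_neg_right, inner_add_right, inner_sub_right, inner_sub_right,
            real_inner_comm w.fst z, real_inner_comm w.snd z]
          ring
        rw [this, AddChar.map_add_eq_mul, Circle.coe_mul, chr]
        ring
    _ = ∫ z, ∫ w, (𝓕 ψ : 𝓢(Plane, ℂ)) z *
          ((Real.fourierChar (inner ℝ w (pr (z - y) (z - x))) : ℂ) * M w) :=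
        integral_integral_swap hi
    _ = _ := by
        congr 1; funext z
        rw [integral_const_mul, Real.fourierInv_eq]
        rfl

/-- The bilinear convolution with the kernel `K`. -/
def bilinConv (K : Plane2 → ℂ) (g k : Plane → ℂ) (z : Plane) : ℂ :=
  ∫ q : Plane × Plane, K (pr q.1 q.2) * (g (z - q.1) * k (z - q.2))

theorem measurePreserving_pair_sub (z : Plane) :
    MeasurePreserving (fun q : Plane × Plane => (z - q.1, z - q.2)) volume volume :=
  (Measure.measurePreserving_sub_left volume z).prod (Measure.measurePreserving_sub_left volume z)

theorem measurableEmbedding_pair_sub (z : Plane) :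
    MeasurableEmbedding fun q : Plane × Plane => (z - q.1, z - q.2) :=
  ((MeasurableEquiv.subLeft z).prodCongr (MeasurableEquiv.subLeft z)).measurableEmbedding

/-- Identifies the tensor pairing with the action of the bilinear convolution on `𝓕 ψ`. Boundedness
of both functions makes every integral absolutely convergent. -/
theorem integral_contract_tensorTest {gu gv : Plane → ℂ} (hgu : Measurable gu) (hgv : Measurable gv)
    {A B : ℝ} (hA : ∀ x, ‖gu x‖ ≤ A) (hB : ∀ x, ‖gv x‖ ≤ B) (M : 𝓢(Plane2, ℂ))
    (ψ : 𝓢(Plane, ℂ)) :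
    ∫ y, contract gv (𝓕 (tensorTest M ψ) : 𝓢(Plane2, ℂ)) y * gu y =
      ∫ z, (𝓕 ψ : 𝓢(Plane, ℂ)) z * bilinConv (𝓕⁻ M : 𝓢(Plane2, ℂ)) gu gv z := by
  set K : 𝓢(Plane2, ℂ) := 𝓕⁻ M with hK
  have hB0 : 0 ≤ B := (norm_nonneg _).trans (hB 0)
  have hA0 : 0 ≤ A := (norm_nonneg _).trans (hA 0)
  have hi0 := integrable_mul_pr hgv hB (𝓕 (tensorTest M ψ) : 𝓢(Plane2, ℂ))
  have hi1 : Integrable (fun q : Plane × Plane =>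
      gu q.1 * (gv q.2 * (𝓕 (tensorTest M ψ) : 𝓢(Plane2, ℂ)) (pr q.1 q.2)))
      ((volume : Measure Plane).prod (volume : Measure Plane)) :=
    hi0.bdd_mul (f := fun q : Plane × Plane => gu q.1) (c := A)
      (hgu.comp measurable_fst).aestronglyMeasurable
      (Filter.Eventually.of_forall fun q => hA q.1)
  have hmF : Measurable (Function.uncurry fun (q : Plane × Plane) (z : Plane) =>
      gu q.1 * (gv q.2 * K (pr (z - q.1) (z - q.2)))) := by
    have h1 : Measurable fun t : (Plane × Plane) × Plane => K (pr (t.2 - t.1.1) (t.2 - t.1.2)) :=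
      (K.continuous.comp (continuous_pr.comp (by fun_prop :
        Continuous fun t : (Plane × Plane) × Plane => (t.2 - t.1.1, t.2 - t.1.2)))).measurable
    simp only [Function.uncurry_def]
    fun_prop
  have hL : ∫⁻ q : Plane × Plane, ‖K (pr q.1 q.2)‖ₑ < ∞ := by
    rw [← lintegral_plane2 fun w => ‖K w‖ₑ]
    exact K.integrable.2
  have hi2 : Integrable (Function.uncurry fun (q : Plane × Plane) (z : Plane) =>
      (𝓕 ψ : 𝓢(Plane, ℂ)) z * (gu q.1 * (gv q.2 * K (pr (z - q.1) (z - q.2)))))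
      ((volume : Measure (Plane × Plane)).prod (volume : Measure Plane)) := by
    refine integrable_mul_of_sections (𝓕 ψ : 𝓢(Plane, ℂ)).continuous.measurable
      (lintegral_enorm_lt_top _).ne hmF
      (M := ENNReal.ofReal A * (ENNReal.ofReal B * ∫⁻ q : Plane × Plane, ‖K (pr q.1 q.2)‖ₑ))
      (ENNReal.mul_ne_top ENNReal.ofReal_ne_top (ENNReal.mul_ne_top ENNReal.ofReal_ne_top hL.ne))
      fun z => ?_
    rw [← (measurePreserving_pair_sub z).lintegral_comp_emb (measurableEmbedding_pair_sub z)
        (fun q : Plane × Plane => ‖K (pr q.1 q.2)‖ₑ),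
      ← lintegral_const_mul' _ _ ENNReal.ofReal_ne_top,
      ← lintegral_const_mul' _ _ ENNReal.ofReal_ne_top]
    refine lintegral_mono fun q => ?_
    simp only [enorm_mul]
    gcongr
    · rw [← ofReal_norm]; exact ENNReal.ofReal_le_ofReal (hA _)
    · rw [← ofReal_norm]; exact ENNReal.ofReal_le_ofReal (hB _)
  calc ∫ y, contract gv (𝓕 (tensorTest M ψ) : 𝓢(Plane2, ℂ)) y * gu y
      = ∫ y, ∫ x, gu y * (gv x * (𝓕 (tensorTest M ψ) : 𝓢(Plane2, ℂ)) (pr y x)) := by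
        congr 1; funext y
        rw [contract, mul_comm, ← integral_const_mul]
    _ = ∫ q : Plane × Plane, gu q.1 * (gv q.2 * (𝓕 (tensorTest M ψ) : 𝓢(Plane2, ℂ)) (pr q.1 q.2)) :=
        (integral_prod _ hi1).symm
    _ = ∫ q : Plane × Plane, ∫ z, (𝓕 ψ : 𝓢(Plane, ℂ)) z *
          (gu q.1 * (gv q.2 * K (pr (z - q.1) (z - q.2)))) := by
        congr 1; funext q
        rw [fourier_tensorTest, ← integral_const_mul, ← integral_const_mul]
        congr 1; funext z; ring
    _ = ∫ z, ∫ q : Plane × Plane, (𝓕 ψ : 𝓢(Plane, ℂ)) z *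
          (gu q.1 * (gv q.2 * K (pr (z - q.1) (z - q.2)))) := integral_integral_swap hi2
    _ = _ := by
        congr 1; funext z
        rw [integral_const_mul, bilinConv,
          ← (measurePreserving_pair_sub z).integral_comp (measurableEmbedding_pair_sub z)
            (fun q : Plane × Plane => K (pr q.1 q.2) * (gu (z - q.1) * gv (z - q.2)))]
        congr 2; funext q
        simp only [sub_sub_cancel]
        ring

/-- Hölder for each fixed pair of translations, then Minkowski over the kernel. The input exponents
may be infinite; only `r` is finite. -/
theorem eLpNorm_bilinConv_le {p p' r : ℝ≥0∞} [p.HolderTriple p' r] (hr : 1 ≤ r) (hr' : r ≠ ∞)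
    {gu gv : Plane → ℂ} (hgu : Measurable gu) (hgv : Measurable gv) (K : 𝓢(Plane2, ℂ)) :
    eLpNorm (bilinConv K gu gv) r volume ≤
      (∫⁻ w, ‖K w‖ₑ) * (eLpNorm gu p volume * eLpNorm gv p' volume) := by
  have hF : Measurable (Function.uncurry fun (z : Plane) (q : Plane × Plane) =>
      gu (z - q.1) * gv (z - q.2)) := by
    simp only [Function.uncurry_def]; fun_prop
  have hM : ∀ q : Plane × Plane, eLpNorm (fun z => gu (z - q.1) * gv (z - q.2)) r volume ≤
      eLpNorm gu p volume * eLpNorm gv p' volume := fun q => by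
    have h1 : eLpNorm (fun z => gu (z - q.1)) p volume = eLpNorm gu p volume :=
      eLpNorm_comp_measurePreserving hgu.aestronglyMeasurable (measurePreserving_sub_right volume _)
    have h2 : eLpNorm (fun z => gv (z - q.2)) p' volume = eLpNorm gv p' volume :=
      eLpNorm_comp_measurePreserving hgv.aestronglyMeasurable (measurePreserving_sub_right volume _)
    have hgu' : AEStronglyMeasurable (fun z => gu (z - q.1)) volume :=
      (hgu.comp (measurable_id.sub_const q.1)).aestronglyMeasurable
    have hgv' : AEStronglyMeasurable (fun z => gv (z - q.2)) volume :=
      (hgv.comp (measurable_id.sub_const q.2)).aestronglyMeasurable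
    have h := eLpNorm_smul_le_mul_eLpNorm (p := p) (q := p') (r := r) hgv' hgu'
    rw [h1, h2] at h
    exact h
  have hK : Measurable fun q : Plane × Plane => K (pr q.1 q.2) :=
    (K.continuous.comp continuous_pr).measurable
  rw [lintegral_plane2]
  exact eLpNorm_integral_mul_le (μ := (volume : Measure Plane))
    (ν := (volume : Measure (Plane × Plane))) hr hr' hK hF hM

theorem measurable_bilinConv {gu gv : Plane → ℂ} (hgu : Measurable gu) (hgv : Measurable gv)
    (K : 𝓢(Plane2, ℂ)) : StronglyMeasurable (bilinConv K gu gv) := by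
  have : StronglyMeasurable (Function.uncurry fun (z : Plane) (q : Plane × Plane) =>
      K (pr q.1 q.2) * (gu (z - q.1) * gv (z - q.2))) := by
    refine Measurable.stronglyMeasurable ?_
    have := (K.continuous.comp continuous_pr).measurable
    simp only [Function.uncurry_def]
    refine Measurable.mul (this.comp measurable_snd) ?_
    fun_prop
  exact this.integral_prod_right

/-- Existence and boundedness of the bilinear multiplier with compactly supported symbol `M`. -/
theorem exists_bilinear (M : 𝓢(Plane2, ℂ)) (hM : HasCompactSupport M) {u v : 𝓢'(Plane, ℂ)}
    (hu : distLpNorm ∞ u < ∞) (hv : distLpNorm ∞ v < ∞)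
    {p p' r : ℝ≥0∞} [p.HolderTriple p' r] (hp : 1 ≤ p) (hp' : 1 ≤ p') (hr : 1 ≤ r) (hr' : r ≠ ∞)
    (hup : distLpNorm p u < ∞) (hvp : distLpNorm p' v < ∞) :
    ∃ w : 𝓢'(Plane, ℂ),
      distLpNorm r w ≤ (∫⁻ z, ‖(𝓕⁻ M : 𝓢(Plane2, ℂ)) z‖ₑ) * (distLpNorm p u * distLpNorm p' v) ∧
      ∀ ψ : 𝓢(Plane, ℂ), IsTensorPairing (𝓕 u) (𝓕 v)
        (fun ξ η => M (pr ξ η) * ψ (ξ + η)) ((𝓕 w : 𝓢'(Plane, ℂ)) ψ) := by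
  -- The `L^∞` hypotheses serve the convergence of the integrals only; the estimate uses the norms
  -- of exponents `p` and `p'`.
  obtain ⟨gu, A, hgu, hA, hug⟩ := exists_rep_bounded hu
  obtain ⟨gv, B, hgv, hB, hvg⟩ := exists_rep_bounded hv
  have hmu := hug.memLp hp hgu hA hup
  have hmv := hvg.memLp hp' hgv hB hvp
  rw [distLpNorm_eq hp hug hmu, distLpNorm_eq hp' hvg hmv]
  have hle := eLpNorm_bilinConv_le (p := p) (p' := p') hr hr' hgu hgv (𝓕⁻ M : 𝓢(Plane2, ℂ))
  have hmem : MemLp (bilinConv (𝓕⁻ M : 𝓢(Plane2, ℂ)) gu gv) r volume :=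
    ⟨(measurable_bilinConv hgu hgv _).aestronglyMeasurable, hle.trans_lt
      (ENNReal.mul_lt_top (𝓕⁻ M : 𝓢(Plane2, ℂ)).integrable.2 (ENNReal.mul_lt_top hmu.2 hmv.2))⟩
  have : Fact (1 ≤ r) := ⟨hr⟩
  have hrep : Rep (Lp.toTemperedDistribution (hmem.toLp _)) (bilinConv (𝓕⁻ M : 𝓢(Plane2, ℂ)) gu gv) :=
    (rep_toTemperedDistribution _).congr hmem.coeFn_toLp
  refine ⟨Lp.toTemperedDistribution (hmem.toLp _), (distLpNorm_le hrep hmem).trans hle,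
    fun ψ => ?_⟩
  have hcs : HasCompactSupport (tensorTest M ψ) := by
    refine hM.mono fun w hw => ?_
    intro h0
    exact hw (by rw [tensorTest_apply, h0, zero_mul])
  have hpair := isTensorPairing_of_rep hug hvg hgv hB (tensorTest M ψ) hcs
  rw [TemperedDistribution.fourier_apply, hrep, ← integral_contract_tensorTest hgu hgv hA hB]
  have e : (fun ξ η => tensorTest M ψ (pr ξ η)) = fun ξ η => M (pr ξ η) * ψ (ξ + η) := by
    funext ξ η
    exact tensorTest_apply M ψ (pr ξ η)
  rwa [e] at hpair

/-! ### Uniform kernel bounds for the dyadic pieces of the symbol -/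

/-- The map from `M` to its kernel in `L¹` is continuous on the Schwartz space, hence controlled by
finitely many seminorms. Uniform kernel bounds thus reduce to uniform bounds on derivatives of
symbols. -/
theorem exists_fourierInv_bound : ∃ (s : Finset (ℕ × ℕ)) (C : ℝ), 0 ≤ C ∧ ∀ M : 𝓢(Plane2, ℂ),
    ∫⁻ w, ‖(𝓕⁻ M : 𝓢(Plane2, ℂ)) w‖ₑ ≤
      ENNReal.ofReal (C * (s.sup (schwartzSeminormFamily ℂ Plane2 ℂ)) M) := by
  let L : 𝓢(Plane2, ℂ) →L[ℂ] Lp ℂ 1 (volume : Measure Plane2) :=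
    (SchwartzMap.toLpCLM ℂ ℂ 1 volume) ∘L (FourierTransform.fourierInvCLM ℂ 𝓢(Plane2, ℂ))
  let q : Seminorm ℂ 𝓢(Plane2, ℂ) := (normSeminorm ℂ (Lp ℂ 1 (volume : Measure Plane2))).comp
    L.toLinearMap
  have hq : Continuous q := continuous_norm.comp L.continuous
  obtain ⟨s, C, -, h⟩ := Seminorm.bound_of_continuous (schwartz_withSeminorms ℂ Plane2 ℂ) q hq
  refine ⟨s, C, C.2, fun M => ?_⟩
  have h1 : ‖(𝓕⁻ M : 𝓢(Plane2, ℂ)).toLp 1‖ ≤ C * (s.sup (schwartzSeminormFamily ℂ Plane2 ℂ)) M :=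
    h M
  rw [SchwartzMap.norm_toLp_one] at h1
  rw [← ofReal_integral_norm_eq_lintegral_enorm (𝓕⁻ M : 𝓢(Plane2, ℂ)).integrable]
  exact ENNReal.ofReal_le_ofReal h1

theorem norm_iteratedFDeriv_slice_le {F : ℝ × Plane2 → ℂ} (hF : ContDiff ℝ (⊤ : ℕ∞) F) (n : ℕ)
    (θ : ℝ) (w : Plane2) :
    ‖iteratedFDeriv ℝ n (fun w => F (θ, w)) w‖ ≤ ‖iteratedFDeriv ℝ n F (θ, w)‖ := by
  have e : (fun w => F (θ, w)) =
      (fun z => F ((θ, 0) + z)) ∘ (ContinuousLinearMap.inr ℝ ℝ Plane2) := by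
    funext w; simp
  have hF' : ContDiff ℝ (⊤ : ℕ∞) fun z => F ((θ, 0) + z) := hF.comp (contDiff_const.add contDiff_id)
  rw [e, ContinuousLinearMap.iteratedFDeriv_comp_right _ hF' w (by exact_mod_cast le_top),
    iteratedFDeriv_comp_add_left]
  refine (ContinuousMultilinearMap.norm_compContinuousLinearMap_le _ _).trans ?_
  have h1 : ‖ContinuousLinearMap.inr ℝ ℝ Plane2‖ ≤ 1 :=
    ContinuousLinearMap.opNorm_le_bound _ zero_le_one fun x => by simp
  have h2 : ∏ _i : Fin n, ‖ContinuousLinearMap.inr ℝ ℝ Plane2‖ ≤ 1 :=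
    Finset.prod_le_one (fun _ _ => norm_nonneg _) fun _ _ => h1
  have h3 : ((θ, 0) : ℝ × Plane2) + ContinuousLinearMap.inr ℝ ℝ Plane2 w = (θ, w) := by simp
  rw [h3]
  exact mul_le_of_le_one_right (norm_nonneg _) h2

/-- A smooth family of functions supported in a fixed ball has kernels bounded in `L¹`, uniformly
for the parameter in a compact set. -/
theorem exists_uniform_kernel_bound {F : ℝ × Plane2 → ℂ} (hF : ContDiff ℝ (⊤ : ℕ∞) F) {R : ℝ}
    (hR : ∀ θ w, F (θ, w) ≠ 0 → ‖w‖ ≤ R) {T : Set ℝ} (hT : IsCompact T) :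
    ∃ C : ℝ≥0∞, C ≠ ∞ ∧ ∀ θ ∈ T, ∃ M : 𝓢(Plane2, ℂ), HasCompactSupport M ∧
      (∀ w, M w = F (θ, w)) ∧ ∫⁻ w, ‖(𝓕⁻ M : 𝓢(Plane2, ℂ)) w‖ₑ ≤ C := by
  obtain ⟨s, C, hC, hs⟩ := exists_fourierInv_bound
  have hbd : ∀ n : ℕ, ∃ B : ℝ, ∀ z ∈ T ×ˢ Metric.closedBall (0 : Plane2) R,
      ‖iteratedFDeriv ℝ n F z‖ ≤ B := fun n =>
    (hT.prod (isCompact_closedBall _ _)).exists_bound_of_continuousOn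
      (hF.continuous_iteratedFDeriv (by exact_mod_cast le_top)).continuousOn
  choose B hB using hbd
  have hR0 : ∀ k : ℕ, 0 ≤ |R| ^ k := fun k => by positivity
  refine ⟨ENNReal.ofReal (C * ∑ κ ∈ s, |R| ^ κ.1 * |B κ.2|), ENNReal.ofReal_ne_top,
    fun θ hθ => ?_⟩
  have hts : tsupport (fun w => F (θ, w)) ⊆ Metric.closedBall (0 : Plane2) R :=
    closure_minimal (fun w hw => mem_closedBall_zero_iff.2 (hR θ w hw)) Metric.isClosed_closedBall
  have hcs : HasCompactSupport fun w => F (θ, w) :=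
    HasCompactSupport.of_support_subset_isCompact (isCompact_closedBall (0 : Plane2) R)
      ((subset_tsupport _).trans hts)
  have hsm : ContDiff ℝ (⊤ : ℕ∞) fun w => F (θ, w) := hF.comp (contDiff_prodMk_right θ)
  refine ⟨hcs.toSchwartzMap hsm, hcs, fun w => rfl, (hs _).trans (ENNReal.ofReal_le_ofReal ?_)⟩
  gcongr
  refine Seminorm.finset_sup_apply_le (Finset.sum_nonneg fun κ _ => by positivity) fun κ hκ => ?_
  refine le_trans ?_ (Finset.single_le_sum (f := fun κ : ℕ × ℕ => |R| ^ κ.1 * |B κ.2|)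
    (fun κ _ => by positivity) hκ)
  rw [schwartzSeminormFamily]
  refine SchwartzMap.seminorm_le_bound ℂ _ _ _ (by positivity) fun w => ?_
  change ‖w‖ ^ κ.1 * ‖iteratedFDeriv ℝ κ.2 (fun w => F (θ, w)) w‖ ≤ _
  by_cases hw : w ∈ Metric.closedBall (0 : Plane2) R
  · have h1 := (norm_iteratedFDeriv_slice_le hF κ.2 θ w).trans (hB κ.2 (θ, w) ⟨hθ, hw⟩)
    have h2 := mem_closedBall_zero_iff.1 hw
    gcongr
    · exact h2.trans (le_abs_self R)
    · exact h1.trans (le_abs_self _)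
  · have : iteratedFDeriv ℝ κ.2 (fun w => F (θ, w)) w = 0 :=
      image_eq_zero_of_notMem_tsupport fun h => hw (hts (tsupport_iteratedFDeriv_subset κ.2 h))
    rw [this, norm_zero, mul_zero]
    positivity

/-! ### Rescaling of the symbol of `T` to a compact family of smooth symbols. -/

section symbol

variable (φ : DyadicPartition)

theorem cutoff_eq (j : ℤ) (ξ : Plane) : φ.cutoff j ξ = φ.cutoff 0 ((2 : ℝ) ^ (-j) • ξ) := by
  simp only [DyadicPartition.cutoff, neg_zero, zpow_zero, one_smul]
  rw [smul_comm]

theorem contDiff_cutoff (j : ℤ) : ContDiff ℝ (⊤ : ℕ∞) (φ.cutoff j) := by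
  unfold DyadicPartition.cutoff
  have := φ.smooth
  exact Complex.ofRealCLM.contDiff.comp (this.comp (by fun_prop))

theorem cutoff_ne_zero {j : ℤ} {ξ : Plane} (h : φ.cutoff j ξ ≠ 0) :
    (2 : ℝ) ^ (j - 1) ≤ 2 * Real.pi * ‖ξ‖ ∧ 2 * Real.pi * ‖ξ‖ ≤ (2 : ℝ) ^ (j + 1) := by
  have h1 : φ.χ ((2 : ℝ) ^ (-j) • ((2 * Real.pi) • ξ)) ≠ 0 := fun h0 => h (by
    unfold DyadicPartition.cutoff; rw [h0]; simp)
  have hn : ‖(2 : ℝ) ^ (-j) • ((2 * Real.pi) • ξ)‖ = ((2 : ℝ) ^ j)⁻¹ * (2 * Real.pi * ‖ξ‖) := by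
    rw [norm_smul, norm_smul, zpow_neg, Real.norm_of_nonneg (by positivity),
      Real.norm_of_nonneg (by positivity)]
  have h2 : 2⁻¹ ≤ ‖(2 : ℝ) ^ (-j) • ((2 * Real.pi) • ξ)‖ ∧
      ‖(2 : ℝ) ^ (-j) • ((2 * Real.pi) • ξ)‖ ≤ 2 := φ.support_subset (subset_tsupport _ h1)
  rw [hn] at h2
  have hj : (0 : ℝ) < 2 ^ j := by positivity
  rw [zpow_sub_one₀ two_ne_zero, zpow_add_one₀ two_ne_zero]
  constructor
  · have := h2.1
    rw [inv_mul_eq_div, le_div_iff₀ hj] at this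
    linarith
  · have := h2.2
    rw [inv_mul_eq_div, div_le_iff₀ hj] at this
    linarith

theorem cutoff_eventually_zero (j : ℤ) : φ.cutoff j =ᶠ[nhds 0] 0 :=
  notMem_tsupport_iff_eventuallyEq.1 (cutoff_support φ j)

theorem pi_mul_two_ge : (1 : ℝ) ≤ 2 * Real.pi := by have := Real.pi_gt_three; linarith

theorem norm_le_of_cutoff_ne_zero {ξ : Plane} (h : φ.cutoff 0 ξ ≠ 0) : ‖ξ‖ ≤ 2 := by
  have h1 := (cutoff_ne_zero φ h).2
  have := pi_mul_two_ge
  have := norm_nonneg ξ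
  norm_num at h1
  nlinarith

/-- The symbol of the operator `T`, localized at unit frequencies after a rescaling of the two
variables in the proportion `sin² θ : cos² θ`. -/
def rescaledSymbol (i : Fin 2) (z : ℝ × Plane2) : ℂ :=
  φ.cutoff 0 z.2.fst * φ.cutoff 0 z.2.snd *
    (((Real.sin z.1 ^ 2 * z.2.fst i - Real.cos z.1 ^ 2 * z.2.snd i) /
      (2 * (Real.sin z.1 ^ 2 * ‖z.2.fst‖ + Real.cos z.1 ^ 2 * ‖z.2.snd‖)) : ℝ) : ℂ)

theorem contDiff_fst2 : ContDiff ℝ (⊤ : ℕ∞) fun w : Plane2 => w.fst :=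
  ((ContinuousLinearMap.fst ℝ Plane Plane) ∘L
      (WithLp.prodContinuousLinearEquiv 2 ℝ Plane Plane).toContinuousLinearMap).contDiff

theorem contDiff_snd2 : ContDiff ℝ (⊤ : ℕ∞) fun w : Plane2 => w.snd :=
  ((ContinuousLinearMap.snd ℝ Plane Plane) ∘L
      (WithLp.prodContinuousLinearEquiv 2 ℝ Plane Plane).toContinuousLinearMap).contDiff

theorem contDiff_coord (i : Fin 2) : ContDiff ℝ (⊤ : ℕ∞) fun ξ : Plane => ξ i :=
  (EuclideanSpace.proj (𝕜 := ℝ) i).contDiff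

/-- Near `ξ = 0` or `η = 0` a cutoff vanishes identically. Elsewhere both norms are smooth and
positive, and `sin²` and `cos²` do not vanish together, so the denominator is nonzero even at the
endpoint angles. -/
theorem contDiff_rescaledSymbol (i : Fin 2) : ContDiff ℝ (⊤ : ℕ∞) (rescaledSymbol φ i) := by
  have hf : ContDiff ℝ (⊤ : ℕ∞) fun z : ℝ × Plane2 => z.2.fst := contDiff_fst2.comp contDiff_snd
  have hs : ContDiff ℝ (⊤ : ℕ∞) fun z : ℝ × Plane2 => z.2.snd := contDiff_snd2.comp contDiff_snd
  rw [contDiff_iff_contDiffAt]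
  intro z
  by_cases h1 : z.2.fst = 0
  · have : rescaledSymbol φ i =ᶠ[nhds z] fun _ => 0 := by
      have ht : Filter.Tendsto (fun z : ℝ × Plane2 => z.2.fst) (nhds z) (nhds 0) := by
        have := hf.continuous.tendsto z
        rwa [h1] at this
      filter_upwards [ht.eventually (cutoff_eventually_zero φ 0)] with y hy
      simp [rescaledSymbol, hy]
    exact contDiffAt_const.congr_of_eventuallyEq this
  by_cases h2 : z.2.snd = 0
  · have : rescaledSymbol φ i =ᶠ[nhds z] fun _ => 0 := by
      have ht : Filter.Tendsto (fun z : ℝ × Plane2 => z.2.snd) (nhds z) (nhds 0) := by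
        have := hs.continuous.tendsto z
        rwa [h2] at this
      filter_upwards [ht.eventually (cutoff_eventually_zero φ 0)] with y hy
      simp [rescaledSymbol, hy]
    exact contDiffAt_const.congr_of_eventuallyEq this
  have hsin : ContDiff ℝ (⊤ : ℕ∞) fun z : ℝ × Plane2 => Real.sin z.1 ^ 2 :=
    (Real.contDiff_sin.comp contDiff_fst).pow 2
  have hcos : ContDiff ℝ (⊤ : ℕ∞) fun z : ℝ × Plane2 => Real.cos z.1 ^ 2 :=
    (Real.contDiff_cos.comp contDiff_fst).pow 2
  have n1 : ContDiffAt ℝ (⊤ : ℕ∞) (fun z : ℝ × Plane2 => ‖z.2.fst‖) z := hf.contDiffAt.norm ℝ h1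
  have n2 : ContDiffAt ℝ (⊤ : ℕ∞) (fun z : ℝ × Plane2 => ‖z.2.snd‖) z := hs.contDiffAt.norm ℝ h2
  have hden : 2 * (Real.sin z.1 ^ 2 * ‖z.2.fst‖ + Real.cos z.1 ^ 2 * ‖z.2.snd‖) ≠ 0 := by
    have p1 := norm_pos_iff.2 h1
    have p2 := norm_pos_iff.2 h2
    have p3 := Real.sin_sq_add_cos_sq z.1
    have p4 := sq_nonneg (Real.sin z.1)
    have p5 := sq_nonneg (Real.cos z.1)
    intro h0
    have q1 : Real.sin z.1 ^ 2 * ‖z.2.fst‖ = 0 := by nlinarith [mul_nonneg p4 p1.le, mul_nonneg p5 p2.le]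
    have q2 : Real.cos z.1 ^ 2 * ‖z.2.snd‖ = 0 := by nlinarith [mul_nonneg p4 p1.le, mul_nonneg p5 p2.le]
    rcases mul_eq_zero.1 q1 with q | q
    · rcases mul_eq_zero.1 q2 with q' | q'
      · linarith
      · exact p2.ne' q'
    · exact p1.ne' q
  have c1 := (contDiff_coord i).comp hf
  have c2 := (contDiff_coord i).comp hs
  refine ContDiffAt.mul (ContDiffAt.mul ((contDiff_cutoff φ 0).comp hf).contDiffAt
    ((contDiff_cutoff φ 0).comp hs).contDiffAt) ?_
  refine (Complex.ofRealCLM.contDiff.contDiffAt).comp z ?_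
  refine ContDiffAt.div ?_ ?_ hden
  · exact (hsin.mul c1).contDiffAt.sub (hcos.mul c2).contDiffAt
  · exact contDiffAt_const.mul ((hsin.contDiffAt.mul n1).add (hcos.contDiffAt.mul n2))

theorem norm_le_of_rescaledSymbol_ne_zero (i : Fin 2) (θ : ℝ) (w : Plane2)
    (h : rescaledSymbol φ i (θ, w) ≠ 0) : ‖w‖ ≤ 4 := by
  have h1 : φ.cutoff 0 w.fst ≠ 0 := fun h0 => h (by simp [rescaledSymbol, h0])
  have h2 : φ.cutoff 0 w.snd ≠ 0 := fun h0 => h (by simp [rescaledSymbol, h0])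
  have e1 := norm_le_of_cutoff_ne_zero φ h1
  have e2 := norm_le_of_cutoff_ne_zero φ h2
  have h3 : ‖w‖ ^ 2 = ‖w.fst‖ ^ 2 + ‖w.snd‖ ^ 2 := WithLp.prod_norm_sq_eq_of_L2 w
  have := norm_nonneg w.fst
  have := norm_nonneg w.snd
  nlinarith [norm_nonneg w]

/-- The map `(ξ, η) ↦ (a ξ, b η)`. -/
def diagEquiv (a b : ℝ) (ha : a ≠ 0) (hb : b ≠ 0) : Plane2 ≃L[ℝ] Plane2 :=
  ((WithLp.prodContinuousLinearEquiv 2 ℝ Plane Plane).trans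
    ((ContinuousLinearEquiv.smulLeft (Units.mk0 a ha)).prodCongr
      (ContinuousLinearEquiv.smulLeft (Units.mk0 b hb)))).trans
    (WithLp.prodContinuousLinearEquiv 2 ℝ Plane Plane).symm

theorem diagEquiv_apply (a b : ℝ) (ha : a ≠ 0) (hb : b ≠ 0) (w : Plane2) :
    diagEquiv a b ha hb w = pr (a • w.fst) (b • w.snd) := rfl

/-- The ratio `2^k : 2^l` ranges over a noncompact set; recorded as `sin² θ : cos² θ` it lives in a
compact interval, on which smoothness gives uniform bounds. Using squares of smooth functions keeps
the family smooth up to the endpoints. -/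
theorem exists_angle {a b : ℝ} (ha : 0 < a) (hb : 0 < b) :
    ∃ θ ∈ Set.Icc 0 (Real.pi / 2), Real.sin θ ^ 2 = a / (a + b) ∧ Real.cos θ ^ 2 = b / (a + b) := by
  have h0 : 0 ≤ a / (a + b) := by positivity
  have h1 : a / (a + b) ≤ 1 := by rw [div_le_one (by positivity)]; linarith
  have hs : Real.sin (Real.arcsin (√(a / (a + b)))) ^ 2 = a / (a + b) := by
    rw [Real.sin_arcsin (by linarith [Real.sqrt_nonneg (a / (a + b))]) (Real.sqrt_le_one.2 h1),
      Real.sq_sqrt h0]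
  refine ⟨Real.arcsin (√(a / (a + b))), ⟨Real.arcsin_nonneg.2 (Real.sqrt_nonneg _),
    Real.arcsin_le_pi_div_two _⟩, hs, ?_⟩
  rw [Real.cos_sq', hs]
  field_simp
  ring

/-- The symbol has degree 0, so the common factor `(2^k + 2^l)⁻¹` cancels between numerator and
denominator. -/
theorem rescaledSymbol_eq (i : Fin 2) (k l : ℤ) {θ : ℝ}
    (hs : Real.sin θ ^ 2 = (2 : ℝ) ^ k / (2 ^ k + 2 ^ l))
    (hc : Real.cos θ ^ 2 = (2 : ℝ) ^ l / (2 ^ k + 2 ^ l)) (ξ η : Plane) :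
    rescaledSymbol φ i (θ, pr ((2 : ℝ) ^ (-k) • ξ) ((2 : ℝ) ^ (-l) • η)) =
      φ.cutoff k ξ * φ.cutoff l η * symbolT i ξ η := by
  rw [rescaledSymbol, symbolT, cutoff_eq φ k, cutoff_eq φ l]
  congr 2
  simp only [hs, hc]
  have hk : (0 : ℝ) < 2 ^ k := by positivity
  have hl : (0 : ℝ) < 2 ^ l := by positivity
  have e1 : (pr ((2 : ℝ) ^ (-k) • ξ) ((2 : ℝ) ^ (-l) • η)).fst = (2 : ℝ) ^ (-k) • ξ := rfl
  have e2 : (pr ((2 : ℝ) ^ (-k) • ξ) ((2 : ℝ) ^ (-l) • η)).snd = (2 : ℝ) ^ (-l) • η := rfl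
  rw [e1, e2]
  simp only [PiLp.smul_apply, smul_eq_mul, norm_smul, norm_inv, norm_zpow, Real.norm_ofNat, zpow_neg]
  have a1 : (2 : ℝ) ^ k / (2 ^ k + 2 ^ l) * (((2 : ℝ) ^ k)⁻¹ * ξ i) -
      (2 : ℝ) ^ l / (2 ^ k + 2 ^ l) * (((2 : ℝ) ^ l)⁻¹ * η i) =
      (2 ^ k + 2 ^ l)⁻¹ * (ξ i - η i) := by field_simp
  have a2 : 2 * ((2 : ℝ) ^ k / (2 ^ k + 2 ^ l) * (((2 : ℝ) ^ k)⁻¹ * ‖ξ‖) +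
      (2 : ℝ) ^ l / (2 ^ k + 2 ^ l) * (((2 : ℝ) ^ l)⁻¹ * ‖η‖)) =
      (2 ^ k + 2 ^ l)⁻¹ * (2 * (‖ξ‖ + ‖η‖)) := by field_simp
  rw [a1, a2, mul_div_mul_left _ _ (by positivity)]

/-- The dyadic pieces of the symbol of `T` have kernels bounded in `L¹`. -/
theorem exists_symbol_kernel (i : Fin 2) : ∃ C : ℝ≥0∞, C ≠ ∞ ∧ ∀ k l : ℤ,
    ∃ M : 𝓢(Plane2, ℂ), HasCompactSupport M ∧
      (∀ ξ η, M (pr ξ η) = φ.cutoff k ξ * φ.cutoff l η * symbolT i ξ η) ∧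
      ∫⁻ w, ‖(𝓕⁻ M : 𝓢(Plane2, ℂ)) w‖ₑ ≤ C := by
  obtain ⟨C, hC, h⟩ := exists_uniform_kernel_bound (contDiff_rescaledSymbol φ i)
    (norm_le_of_rescaledSymbol_ne_zero φ i) (isCompact_Icc (a := (0 : ℝ)) (b := Real.pi / 2))
  refine ⟨C, hC, fun k l => ?_⟩
  obtain ⟨θ, hθ, hs, hc⟩ := exists_angle (a := (2 : ℝ) ^ k) (b := (2 : ℝ) ^ l) (by positivity)
    (by positivity)
  obtain ⟨M, hM, hMF, hMC⟩ := h θ hθ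
  let D := diagEquiv ((2 : ℝ) ^ (-k)) ((2 : ℝ) ^ (-l)) (two_zpow_ne_zero _) (two_zpow_ne_zero _)
  refine ⟨SchwartzMap.compCLMOfContinuousLinearEquiv ℂ D M, ?_, fun ξ η => ?_, ?_⟩
  · exact hM.comp_homeomorph D.toHomeomorph
  · rw [SchwartzMap.compCLMOfContinuousLinearEquiv_apply, Function.comp_apply, hMF]
    exact rescaledSymbol_eq φ i k l hs hc ξ η
  -- The dilation by different factors in the two variables is still symmetric, so it preserves the
  -- `L¹` norm of the kernel.
  · refine le_trans (le_of_eq ?_) hMC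
    simp_rw [SchwartzMap.fourierInv_coe]
    refine lintegral_fourierInv_comp D (fun x y => ?_) M
    simp only [D, diagEquiv_apply]
    simp [WithLp.prod_inner_apply, real_inner_smul_left, real_inner_smul_right]

/-- Boundedness of the dyadic pieces of `T`, uniformly in the frequencies. -/
theorem exists_TBlock_bound {p p' r : ℝ≥0∞} [p.HolderTriple p' r] (hp : 1 ≤ p) (hp' : 1 ≤ p')
    (hr : 1 ≤ r) (hr' : r ≠ ∞) :
    ∃ C : ℝ≥0∞, C ≠ 0 ∧ C ≠ ∞ ∧ ∀ (i : Fin 2) (k l : ℤ) (u v : 𝓢'(Plane, ℂ)),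
      distLpNorm ∞ u < ∞ → distLpNorm ∞ v < ∞ → distLpNorm p u < ∞ → distLpNorm p' v < ∞ →
      ∃ w, IsTBlock φ i k l u v w ∧ distLpNorm r w ≤ C * (distLpNorm p u * distLpNorm p' v) := by
  choose C hC h using exists_symbol_kernel φ
  have hc : ((2 * Real.pi : ℂ) ^ 2) ≠ 0 := by simp [Real.pi_ne_zero]
  -- The factor `(2π)²` is the normalization in `IsTBlock`; the summand `1` keeps the constant
  -- nonzero.
  refine ⟨‖(2 * Real.pi : ℂ) ^ 2‖ₑ * (C 0 + C 1 + 1), ?_, ?_,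
    fun i k l u v hu hv hup hvp => ?_⟩
  · exact mul_ne_zero (enorm_ne_zero.2 hc) (by simp)
  · exact ENNReal.mul_ne_top enorm_ne_top (by simp [hC])
  obtain ⟨M, hM, hMF, hMC⟩ := h i k l
  obtain ⟨w, hw, hpair⟩ := exists_bilinear M hM hu hv hp hp' hr hr' hup hvp
  refine ⟨(2 * Real.pi : ℂ) ^ 2 • w, fun ψ => ⟨(𝓕 w : 𝓢'(Plane, ℂ)) ψ, ?_, ?_⟩, ?_⟩
  · have := hpair ψ
    simp_rw [hMF] at this
    exact this
  · rw [FourierTransform.fourier_smul]; rfl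
  · refine (distLpNorm_smul_le hr _ hc w).trans ?_
    rw [mul_assoc]
    gcongr
    refine hw.trans ?_
    gcongr
    refine hMC.trans ?_
    fin_cases i
    · change C 0 ≤ C 0 + C 1 + 1
      rw [add_assoc]; exact le_self_add
    · change C 1 ≤ C 0 + C 1 + 1
      rw [add_right_comm]; exact le_add_self

end symbol

/-! ### Multipliers with dyadically localized homogeneous symbols -/

/-- The Fourier multiplier with symbol `m`. -/
abbrev FM (m : Plane → ℂ) : 𝓢'(Plane, ℂ) →L[ℂ] 𝓢'(Plane, ℂ) :=
  TemperedDistribution.fourierMultiplierCLM ℂ m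

theorem FM_FM {g₁ g₂ : Plane → ℂ} (h₁ : g₁.HasTemperateGrowth) (h₂ : g₂.HasTemperateGrowth)
    (u : 𝓢'(Plane, ℂ)) : FM g₂ (FM g₁ u) = FM (fun ξ => g₁ ξ * g₂ ξ) u :=
  TemperedDistribution.fourierMultiplierCLM_fourierMultiplierCLM_apply h₁ h₂ u

theorem FM_zero (u : 𝓢'(Plane, ℂ)) : FM (fun _ => 0) u = 0 := by
  simp [FM]

theorem FM_sum {ι : Type*} (s : Finset ι) (g : ι → Plane → ℂ)
    (hg : ∀ i ∈ s, (g i).HasTemperateGrowth) (u : 𝓢'(Plane, ℂ)) :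
    FM (fun ξ => ∑ i ∈ s, g i ξ) u = ∑ i ∈ s, FM (g i) u := by
  have h := TemperedDistribution.fourierMultiplierCLM_sum ℂ hg
  rw [FM, h, sum_apply]

theorem FM_const_mul {g : Plane → ℂ} (hg : g.HasTemperateGrowth) (c : ℂ) (u : 𝓢'(Plane, ℂ)) :
    FM (fun ξ => c * g ξ) u = c • FM g u := by
  have h := TemperedDistribution.fourierMultiplierCLM_smul (F := ℂ) hg c
  exact congrArg (fun T => T u) h

theorem fourier_FM_apply (m : Plane → ℂ) (u : 𝓢'(Plane, ℂ)) (ψ : 𝓢(Plane, ℂ)) :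
    (𝓕 (FM m u) : 𝓢'(Plane, ℂ)) ψ = (𝓕 u : 𝓢'(Plane, ℂ)) (SchwartzMap.smulLeftCLM ℂ m ψ) := by
  rw [FM, TemperedDistribution.fourierMultiplierCLM_apply, FourierTransform.fourier_fourierInv_eq]
  rfl

/-- The symbol of `∂_i`. -/
def dsym (i : Fin 2) (ξ : Plane) : ℂ := (2 * Real.pi * Complex.I) * (ξ i : ℂ)

theorem hasTemperateGrowth_coord (i : Fin 2) :
    (fun ξ : Plane => (ξ i : ℂ)).HasTemperateGrowth := by
  have h : (fun y : Plane => inner ℝ y (e i)).HasTemperateGrowth := by fun_prop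
  have h2 : (fun ξ : Plane => (ξ i : ℂ)) = fun y : Plane => ((inner ℝ y (e i) : ℝ) : ℂ) := by
    funext y; simp [EuclideanSpace.inner_single_right]
  rw [h2]
  fun_prop

theorem hasTemperateGrowth_dsym (i : Fin 2) : (dsym i).HasTemperateGrowth :=
  (Function.HasTemperateGrowth.const _).mul (hasTemperateGrowth_coord i)

theorem lineDeriv_eq_FM (i : Fin 2) (u : 𝓢'(Plane, ℂ)) : ∂_{e i} u = FM (dsym i) u := by
  rw [TemperedDistribution.lineDeriv_eq_fourierMultiplierCLM]
  have h := FM_const_mul (hasTemperateGrowth_coord i) (2 * Real.pi * Complex.I) u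
  have h2 : (fun ξ : Plane => (ξ i : ℂ)) = fun y : Plane => ((inner ℝ y (e i) : ℝ) : ℂ) := by
    funext y; simp [EuclideanSpace.inner_single_right]
  refine Eq.trans ?_ h.symm
  rw [h2]

/-- `σ` is smooth away from the origin and `σ (2^j ξ) = 2^(d j) σ ξ`. -/
structure Homog (d : ℤ) (σ : Plane → ℂ) : Prop where
  smooth : ∀ ξ, ξ ≠ 0 → ContDiffAt ℝ (⊤ : ℕ∞) σ ξ
  homog : ∀ (j : ℤ) ξ, σ ((2 : ℝ) ^ j • ξ) = (2 : ℂ) ^ (d * j) * σ ξ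

theorem Homog.mul {d d' : ℤ} {σ σ' : Plane → ℂ} (h : Homog d σ) (h' : Homog d' σ') :
    Homog (d + d') fun ξ => σ ξ * σ' ξ where
  smooth ξ hξ := (h.smooth ξ hξ).mul (h'.smooth ξ hξ)
  homog j ξ := by
    rw [h.homog, h'.homog, add_mul, zpow_add₀ two_ne_zero]; ring

theorem homog_dsym (i : Fin 2) : Homog 1 (dsym i) where
  smooth ξ _ := by
    refine contDiffAt_const.mul ?_
    exact (Complex.ofRealCLM.contDiff.contDiffAt).comp ξ (contDiff_coord i).contDiffAt
  homog j ξ := by simp [dsym]; ring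

theorem homog_one : Homog 0 fun _ => 1 where
  smooth ξ _ := contDiffAt_const
  homog j ξ := by simp

theorem Homog.neg {d : ℤ} {σ : Plane → ℂ} (h : Homog d σ) : Homog d fun ξ => -σ ξ where
  smooth ξ hξ := (h.smooth ξ hξ).neg
  homog j ξ := by rw [h.homog]; ring

/-- The symbol of `(-Δ)^(-α)`. -/
def rsym (α : ℝ) (ξ : Plane) : ℂ := ((‖(2 * Real.pi) • ξ‖ ^ (-2 * α) : ℝ) : ℂ)

theorem homog_rsym {α : ℝ} {d : ℤ} (h : -2 * α = d) : Homog d (rsym α) where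
  smooth ξ hξ := by
    have h0 : (2 * Real.pi) • ξ ≠ 0 := smul_ne_zero (by positivity) hξ
    have h1 : ContDiffAt ℝ (⊤ : ℕ∞) (fun ξ : Plane => ‖(2 * Real.pi) • ξ‖) ξ :=
      ContDiffAt.norm ℝ (by fun_prop) h0
    exact (Complex.ofRealCLM.contDiff.contDiffAt).comp ξ
      (h1.rpow_const_of_ne (norm_ne_zero_iff.2 h0))
  homog j ξ := by
    rw [rsym, rsym, smul_comm, norm_smul, Real.mul_rpow (norm_nonneg _) (norm_nonneg _), h,
      Real.rpow_intCast, Real.rpow_intCast, Real.norm_of_nonneg (by positivity), ← zpow_mul]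
    push_cast
    rw [mul_comm j d]

/-- A smooth cutoff function supported in a compact set away from the origin. -/
structure Window (c : Plane → ℂ) : Prop where
  smooth : ContDiff ℝ (⊤ : ℕ∞) c
  compact : HasCompactSupport c
  zero : (0 : Plane) ∉ tsupport c

/-- The symbol `σ` localized to frequencies of size `2^j`. -/
def windowed (c σ : Plane → ℂ) (j : ℤ) (ξ : Plane) : ℂ := c ((2 : ℝ) ^ (-j) • ξ) * σ ξ

section

variable {c σ : Plane → ℂ} {d : ℤ}

/-- Homogeneity pulls every localized symbol back to the single Schwartz function `c σ` at unit
frequency, so one multiplier bound serves all scales. -/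
theorem Window.exists_schwartz (hc : Window c) (hσ : Homog d σ) :
    ∃ m : 𝓢(Plane, ℂ), ∀ (j : ℤ) (ξ : Plane),
      windowed c σ j ξ = (2 : ℂ) ^ (d * j) * m ((2 : ℝ) ^ (-j) • ξ) := by
  have hcs : HasCompactSupport fun ξ => c ξ * σ ξ := hc.compact.mul_right
  have hsm : ContDiff ℝ (⊤ : ℕ∞) fun ξ => c ξ * σ ξ := by
    rw [contDiff_iff_contDiffAt]
    intro ξ
    by_cases hξ : ξ = 0
    · have h0 := notMem_tsupport_iff_eventuallyEq.1 hc.zero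
      rw [← hξ] at h0
      refine (contDiffAt_const (c := (0 : ℂ))).congr_of_eventuallyEq ?_
      filter_upwards [h0] with y hy
      simp [hy]
    · exact hc.smooth.contDiffAt.mul (hσ.smooth ξ hξ)
  refine ⟨hcs.toSchwartzMap hsm, fun j ξ => ?_⟩
  change c ((2 : ℝ) ^ (-j) • ξ) * σ ξ =
    (2 : ℂ) ^ (d * j) * (c ((2 : ℝ) ^ (-j) • ξ) * σ ((2 : ℝ) ^ (-j) • ξ))
  have h := hσ.homog j ((2 : ℝ) ^ (-j) • ξ)
  rw [smul_smul, ← zpow_add₀ two_ne_zero, add_neg_cancel, zpow_zero, one_smul] at h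
  rw [h]; ring

theorem Window.hasTemperateGrowth (hc : Window c) (hσ : Homog d σ) (j : ℤ) :
    (windowed c σ j).HasTemperateGrowth := by
  obtain ⟨m, hm⟩ := hc.exists_schwartz hσ
  have h : windowed c σ j = fun ξ => (2 : ℂ) ^ (d * j) *
      dil ((2 : ℝ) ^ (-j)) (two_zpow_ne_zero _) m ξ := funext fun ξ => hm j ξ
  rw [h]
  exact (Function.HasTemperateGrowth.const _).mul (SchwartzMap.hasTemperateGrowth _)

theorem enorm_two_zpow (n : ℤ) : ‖(2 : ℂ) ^ n‖ₑ = (2 : ℝ≥0∞) ^ ((n : ℝ)) := by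
  rw [← ofReal_norm, norm_zpow, Complex.norm_ofNat, ← Real.rpow_intCast,
    ← ENNReal.ofReal_rpow_of_pos two_pos, ENNReal.ofReal_ofNat]

theorem Window.exists_bound (hc : Window c) (hσ : Homog d σ) {p : ℝ≥0∞} (hp : 1 ≤ p)
    (hp' : p ≠ ∞) :
    ∃ C : ℝ≥0∞, C ≠ 0 ∧ C ≠ ∞ ∧ ∀ (j : ℤ) (u : 𝓢'(Plane, ℂ)),
      distLpNorm p (FM (windowed c σ j) u) ≤ C * 2 ^ (d * (j : ℝ)) * distLpNorm p u ∧
      distLpNorm ∞ (FM (windowed c σ j) u) ≤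
        C * 2 ^ ((d + 2 / p.toReal) * (j : ℝ)) * distLpNorm p u ∧
      distLpNorm (2 * p) (FM (windowed c σ j) u) ≤
        C * 2 ^ ((d + 1 / p.toReal) * (j : ℝ)) * distLpNorm p u := by
  obtain ⟨m, hm⟩ := hc.exists_schwartz hσ
  obtain ⟨C, h0, h1, h⟩ := exists_multiplier_bound hp hp' m
  refine ⟨C, h0, h1, fun j u => ?_⟩
  have e1 : FM (windowed c σ j) u =
      (2 : ℂ) ^ (d * j) • FM (fun ξ => m ((2 : ℝ) ^ (-j) • ξ)) u := by
    refine Eq.trans ?_ (FM_const_mul (SchwartzMap.hasTemperateGrowth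
      (dil ((2 : ℝ) ^ (-j)) (two_zpow_ne_zero _) m)) _ u)
    congr 2
    exact funext fun ξ => hm j ξ
  have h2 : (2 : ℂ) ^ (d * j) ≠ 0 := zpow_ne_zero _ two_ne_zero
  have e2 : ‖(2 : ℂ) ^ (d * j)‖ₑ = (2 : ℝ≥0∞) ^ (d * (j : ℝ)) := by
    rw [enorm_two_zpow]; push_cast; rfl
  have key : ∀ {r : ℝ≥0∞} (_ : 1 ≤ r) {x : ℝ≥0∞},
      distLpNorm r (FM (fun ξ => m ((2 : ℝ) ^ (-j) • ξ)) u) ≤ x →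
      distLpNorm r (FM (windowed c σ j) u) ≤ 2 ^ (d * (j : ℝ)) * x := by
    intro r hr x hx
    rw [e1]
    refine (distLpNorm_smul_le hr _ h2 _).trans ?_
    rw [e2]
    gcongr
  obtain ⟨b1, b2, b3⟩ := h j u
  refine ⟨(key hp b1).trans (le_of_eq (by ring)), (key le_top b2).trans (le_of_eq ?_),
    (key ?_ b3).trans (le_of_eq ?_)⟩
  · rw [add_mul, two_rpow_add]; ring
  · exact hp.trans (le_mul_of_one_le_left zero_le one_le_two)
  · rw [add_mul, two_rpow_add]; ring

end

/-! ### Dyadic cutoffs, their fattenings, and multipliers acting on a block. -/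

section partition

variable (φ : DyadicPartition)

theorem window_cutoff : Window (φ.cutoff 0) where
  smooth := contDiff_cutoff φ 0
  compact := HasCompactSupport.of_support_subset_isCompact (isCompact_closedBall (0 : Plane) 2)
    fun _ hξ => mem_closedBall_zero_iff.2 (norm_le_of_cutoff_ne_zero φ hξ)
  zero := cutoff_support φ 0

theorem cutoff_mul_eq_windowed (σ : Plane → ℂ) (j : ℤ) :
    (fun ξ => φ.cutoff j ξ * σ ξ) = windowed (φ.cutoff 0) σ j := by
  funext ξ; rw [windowed, ← cutoff_eq]

theorem cutoff_eq_windowed (j : ℤ) : φ.cutoff j = windowed (φ.cutoff 0) (fun _ => 1) j := by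
  funext ξ; rw [windowed, ← cutoff_eq, mul_one]

theorem hasTemperateGrowth_cutoff (j : ℤ) : (φ.cutoff j).HasTemperateGrowth := by
  rw [cutoff_eq_windowed]
  exact (window_cutoff φ).hasTemperateGrowth homog_one j

/-- The closed annuli of indices differing by 2 may still share a circle, hence the threshold 3 and
the five neighbours in `fat`. -/
theorem cutoff_mul_cutoff {i j : ℤ} (h : 3 ≤ |i - j|) (ξ : Plane) :
    φ.cutoff i ξ * φ.cutoff j ξ = 0 := by
  by_contra h0
  obtain ⟨a1, a2⟩ := cutoff_ne_zero φ (left_ne_zero_of_mul h0)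
  obtain ⟨b1, b2⟩ := cutoff_ne_zero φ (right_ne_zero_of_mul h0)
  have c1 := (zpow_le_zpow_iff_right₀ one_lt_two).1 (a1.trans b2)
  have c2 := (zpow_le_zpow_iff_right₀ one_lt_two).1 (b1.trans a2)
  rw [le_abs] at h
  omega

theorem hasSum_cutoff {ξ : Plane} (hξ : ξ ≠ 0) : HasSum (fun j : ℤ => φ.cutoff j ξ) 1 := by
  have := φ.hasSum_one ((2 * Real.pi) • ξ) (smul_ne_zero (by positivity) hξ)
  exact Complex.ofReal_one ▸ Complex.hasSum_ofReal.2 this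

/-- The sum of five neighbouring cutoffs. -/
def fat (j : ℤ) (ξ : Plane) : ℂ := ∑ i ∈ Finset.Icc (j - 2) (j + 2), φ.cutoff i ξ

/-- On the support of one cutoff all but five terms of the partition of unity vanish, so these five
already sum to 1. -/
theorem fat_mul_cutoff (j : ℤ) (ξ : Plane) : φ.cutoff j ξ * fat φ j ξ = φ.cutoff j ξ := by
  by_cases h : φ.cutoff j ξ = 0
  · simp [h]
  have hξ : ξ ≠ 0 := by
    rintro rfl
    exact h (image_eq_zero_of_notMem_tsupport (cutoff_support φ j))
  have h1 : HasSum (fun i : ℤ => φ.cutoff i ξ) (fat φ j ξ) := by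
    refine hasSum_sum_of_ne_finset_zero fun i hi => ?_
    rw [Finset.mem_Icc] at hi
    have h2 := cutoff_mul_cutoff φ (i := j) (j := i) (by rw [le_abs]; omega) ξ
    exact (mul_eq_zero.1 h2).resolve_left h
  rw [h1.unique (hasSum_cutoff φ hξ), mul_one]

theorem fat_eq_sum (j : ℤ) (ξ : Plane) :
    fat φ j ξ = ∑ i ∈ Finset.Icc (-2 : ℤ) 2, φ.cutoff (j + i) ξ := by
  rw [fat]
  refine Finset.sum_bij' (fun i _ => i - j) (fun i _ => j + i) ?_ ?_ ?_ ?_ ?_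
  all_goals intro i hi; simp only [Finset.mem_Icc] at hi ⊢
  any_goals omega
  congr 1; ring

theorem fat_scale (j : ℤ) (ξ : Plane) : fat φ j ξ = fat φ 0 ((2 : ℝ) ^ (-j) • ξ) := by
  rw [fat_eq_sum, fat_eq_sum]
  refine Finset.sum_congr rfl fun i _ => ?_
  rw [cutoff_eq, cutoff_eq φ (0 + i), smul_smul, ← zpow_add₀ two_ne_zero]
  congr 3; ring

theorem window_fat : Window (fat φ 0) where
  smooth := ContDiff.sum fun i _ => contDiff_cutoff φ i
  compact := by
    refine HasCompactSupport.of_support_subset_isCompact (isCompact_closedBall (0 : Plane) 8)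
      fun ξ hξ => mem_closedBall_zero_iff.2 ?_
    obtain ⟨i, hi, h⟩ := Finset.exists_ne_zero_of_sum_ne_zero hξ
    have h1 := (cutoff_ne_zero φ h).2
    have h2 : (2 : ℝ) ^ (i + 1) ≤ 2 ^ (3 : ℤ) := by
      rw [Finset.mem_Icc] at hi
      exact zpow_le_zpow_right₀ one_le_two (by omega)
    have := pi_mul_two_ge
    have := norm_nonneg ξ
    norm_num at h2
    nlinarith
  zero := by
    rw [notMem_tsupport_iff_eventuallyEq]
    have : ∀ᶠ ξ in nhds (0 : Plane), ∀ i ∈ Finset.Icc ((0 : ℤ) - 2) (0 + 2), φ.cutoff i ξ = 0 := by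
      rw [Filter.eventually_all_finset]
      exact fun i _ => cutoff_eventually_zero φ i
    filter_upwards [this] with ξ hξ
    exact Finset.sum_eq_zero hξ

theorem fat_mul_eq_windowed (σ : Plane → ℂ) (j : ℤ) :
    (fun ξ => fat φ j ξ * σ ξ) = windowed (fat φ 0) σ j := by
  funext ξ; rw [windowed, ← fat_scale]

/-- A multiplier localized by `cutoff j` factors through the fat localization. -/
theorem FM_cutoff_fat {d : ℤ} {σ : Plane → ℂ} (hσ : Homog d σ) (j : ℤ) (u : 𝓢'(Plane, ℂ)) :
    FM (windowed (fat φ 0) (fun _ => 1) j) (FM (windowed (φ.cutoff 0) σ j) u) =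
      FM (windowed (φ.cutoff 0) σ j) u := by
  rw [FM_FM ((window_cutoff φ).hasTemperateGrowth hσ j)
    ((window_fat φ).hasTemperateGrowth homog_one j)]
  congr 2
  funext ξ
  simp only [← cutoff_mul_eq_windowed, ← fat_mul_eq_windowed, mul_one]
  rw [mul_right_comm, fat_mul_cutoff]

/-- On a block the defining series has at most five nonzero terms, so no convergence question arises
and the sum is one multiplier with a smooth symbol. -/
theorem isHomMultiplier_block {d : ℤ} {σ : Plane → ℂ} (hσ : Homog d σ) (k : ℤ)
    (u : 𝓢'(Plane, ℂ)) :
    IsHomMultiplier φ σ (block φ k u) (FM (windowed (fat φ 0) σ k) (block φ k u)) := by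
  have hF : FM (windowed (fat φ 0) σ k) (block φ k u) =
      ∑ j ∈ Finset.Icc (k - 2) (k + 2), FM (fun ξ => φ.cutoff j ξ * σ ξ) (block φ k u) := by
    rw [← FM_sum]
    · rw [← fat_mul_eq_windowed]
      simp_rw [fat, Finset.sum_mul]
    · intro j _
      rw [cutoff_mul_eq_windowed]
      exact (window_cutoff φ).hasTemperateGrowth hσ j
  rw [hF]
  refine hasSum_sum_of_ne_finset_zero fun j hj => ?_
  rw [Finset.mem_Icc] at hj
  have h1 := (window_cutoff φ).hasTemperateGrowth hσ j
  rw [← cutoff_mul_eq_windowed] at h1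
  change FM _ (FM _ u) = 0
  rw [FM_FM (hasTemperateGrowth_cutoff φ k) h1, ← FM_zero u]
  congr 2
  funext ξ
  rw [← mul_assoc, cutoff_mul_cutoff φ (by rw [le_abs]; omega), zero_mul]

/-! ### Algebra of the dyadic pieces of `T` -/

section tblock

variable {φ} {i : Fin 2} {k l : ℤ} {θ v w : 𝓢'(Plane, ℂ)}

theorem eq_zero_of_fourier_apply (h : ∀ ψ : 𝓢(Plane, ℂ), (𝓕 w : 𝓢'(Plane, ℂ)) ψ = 0) : w = 0 := by
  have h1 : (𝓕 w : 𝓢'(Plane, ℂ)) = 0 := by ext ψ; exact h ψ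
  have h2 := congrArg (fun u : 𝓢'(Plane, ℂ) => (𝓕⁻ u : 𝓢'(Plane, ℂ))) h1
  simp only [FourierTransform.fourierInv_fourier_eq] at h2
  rw [h2]
  exact map_zero (FourierTransform.fourierInvCLM ℂ 𝓢'(Plane, ℂ))

theorem smulLeft_eq_zero {m : Plane → ℂ} (hm : m.HasTemperateGrowth) {s : 𝓢(Plane, ℂ)}
    (h : ∀ ξ, m ξ * s ξ = 0) : SchwartzMap.smulLeftCLM ℂ m s = 0 := by
  ext ξ
  rw [SchwartzMap.smulLeftCLM_apply_apply hm, smul_eq_mul, h]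
  rfl

/-- The inner pairing vanishes wherever the cutoff in `ξ` does, so multiplying it by `m` gives zero.
This and `IsTBlock.eq_zero_right` leave finitely many terms of the series for `T` on a pair of
blocks. -/
theorem IsTBlock.eq_zero_left (hw : IsTBlock φ i k l θ v w) {m : Plane → ℂ}
    (hm : m.HasTemperateGrowth) (h0 : ∀ ξ, m ξ * φ.cutoff k ξ = 0) {θ' : 𝓢'(Plane, ℂ)}
    (hθ : θ = FM m θ') : w = 0 := by
  refine eq_zero_of_fourier_apply fun ψ => ?_
  obtain ⟨c, ⟨s, hs, rfl⟩, hc⟩ := hw ψ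
  rw [hc, hθ, fourier_FM_apply, smulLeft_eq_zero hm fun ξ => ?_, map_zero, mul_zero]
  obtain ⟨r, hr, h1⟩ := hs ξ
  by_cases hk : φ.cutoff k ξ = 0
  · have : r = 0 := by ext η; simp [hr, hk]
    rw [h1, this, map_zero, mul_zero]
  · rw [(mul_eq_zero.1 (h0 ξ)).resolve_right hk, zero_mul]

theorem IsTBlock.eq_zero_right (hw : IsTBlock φ i k l θ v w) {m : Plane → ℂ}
    (hm : m.HasTemperateGrowth) (h0 : ∀ ξ, m ξ * φ.cutoff l ξ = 0) {v' : 𝓢'(Plane, ℂ)}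
    (hv : v = FM m v') : w = 0 := by
  refine eq_zero_of_fourier_apply fun ψ => ?_
  obtain ⟨c, ⟨s, hs, rfl⟩, hc⟩ := hw ψ
  have : s = 0 := by
    ext ξ
    obtain ⟨r, hr, h1⟩ := hs ξ
    rw [h1, hv, fourier_FM_apply, smulLeft_eq_zero hm fun η => ?_, map_zero]
    · rfl
    · rw [hr]
      linear_combination (φ.cutoff k ξ * symbolT i ξ η * ψ (ξ + η)) * h0 η
  rw [hc, this, map_zero, mul_zero]

theorem IsTBlock.FM_eq_zero (hw : IsTBlock φ i k l θ v w) {m : Plane → ℂ}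
    (hm : m.HasTemperateGrowth)
    (h0 : ∀ ξ η, φ.cutoff k ξ * φ.cutoff l η * m (ξ + η) = 0) : FM m w = 0 := by
  refine eq_zero_of_fourier_apply fun ψ => ?_
  rw [fourier_FM_apply]
  obtain ⟨c, ⟨s, hs, rfl⟩, hc⟩ := hw (SchwartzMap.smulLeftCLM ℂ m ψ)
  have : s = 0 := by
    ext ξ
    obtain ⟨r, hr, h1⟩ := hs ξ
    have : r = 0 := by
      ext η
      rw [hr]
      beta_reduce
      rw [SchwartzMap.smulLeftCLM_apply_apply hm, smul_eq_mul, zero_apply]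
      linear_combination (symbolT i ξ η * ψ (ξ + η)) * h0 ξ η
    rw [h1, this, map_zero]; rfl
  rw [hc, this, map_zero, mul_zero]

/-- At output frequency `ξ + η` the symbol of `∂_j` splits into its values at `ξ` and at `η`. The
first part falls on `θ`. The second falls on `v_j`, and since the symbol of `T` depends on `i` only,
its sum over `j` is the pairing with `div v = 0`. -/
theorem IsTBlock.leibniz {v w w' : Fin 2 → 𝓢'(Plane, ℂ)} (hdiv : ∑ j, ∂_{e j} (v j) = 0)
    (hw : ∀ j, IsTBlock φ i k l θ (v j) (w j))
    (hw' : ∀ j, IsTBlock φ i k l (∂_{e j} θ) (v j) (w' j)) :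
    ∑ j, ∂_{e j} (w j) = ∑ j, w' j := by
  rw [← sub_eq_zero]
  refine eq_zero_of_fourier_apply fun ψ => ?_
  have hd := hasTemperateGrowth_dsym
  choose c hc hcw using fun j => hw j (SchwartzMap.smulLeftCLM ℂ (dsym j) ψ)
  choose c' hc' hcw' using fun j => hw' j ψ
  choose s hs hcs using hc
  choose s' hs' hcs' using hc'
  have e1 : ∀ j, (𝓕 (∂_{e j} (w j)) : 𝓢'(Plane, ℂ)) ψ = (2 * Real.pi : ℂ) ^ 2 * (𝓕 θ : 𝓢'(Plane, ℂ)) (s j) := by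
    intro j
    rw [lineDeriv_eq_FM, fourier_FM_apply, hcw, hcs]
  have e2 : ∀ j, (𝓕 (w' j) : 𝓢'(Plane, ℂ)) ψ = (2 * Real.pi : ℂ) ^ 2 *
      (𝓕 θ : 𝓢'(Plane, ℂ)) (SchwartzMap.smulLeftCLM ℂ (dsym j) (s' j)) := by
    intro j
    rw [hcw', hcs', lineDeriv_eq_FM, fourier_FM_apply]
  have e3 : ∑ j, s j = ∑ j, SchwartzMap.smulLeftCLM ℂ (dsym j) (s' j) := by
    ext ξ
    choose r hr hsr using fun j => hs j ξ
    choose r' hr' hsr' using fun j => hs' j ξ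
    -- One test function serves both `j`, which is what lets the divergence of `v` assemble.
    have hrr : ∀ j, r' j = r' 0 := fun j => by ext η; rw [hr', hr']
    have h1 : ∀ j, r j = dsym j ξ • r' 0 + SchwartzMap.smulLeftCLM ℂ (dsym j) (r' 0) := by
      intro j
      ext η
      rw [hr]
      beta_reduce
      rw [SchwartzMap.smulLeftCLM_apply_apply (hd j), add_apply, smul_apply,
        SchwartzMap.smulLeftCLM_apply_apply (hd j), hr']
      simp only [smul_eq_mul, dsym, PiLp.add_apply]
      push_cast
      ring
    have h2 : ∑ j, (𝓕 (v j) : 𝓢'(Plane, ℂ)) (SchwartzMap.smulLeftCLM ℂ (dsym j) (r' 0)) = 0 := by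
      have h3 : ∀ j, (𝓕 (v j) : 𝓢'(Plane, ℂ)) (SchwartzMap.smulLeftCLM ℂ (dsym j) (r' 0)) =
          (𝓕 (∂_{e j} (v j)) : 𝓢'(Plane, ℂ)) (r' 0) := fun j => by
        rw [lineDeriv_eq_FM, fourier_FM_apply]
      simp_rw [h3]
      have h4 := congrArg (fun u : 𝓢'(Plane, ℂ) => (𝓕 u : 𝓢'(Plane, ℂ)) (r' 0)) hdiv
      simp only [Fin.sum_univ_two, FourierTransform.fourier_add, add_apply] at h4 ⊢
      rw [h4]
      have h5 : (𝓕 (0 : 𝓢'(Plane, ℂ)) : 𝓢'(Plane, ℂ)) = 0 :=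
        map_zero (FourierTransform.fourierCLM ℂ 𝓢'(Plane, ℂ))
      rw [h5]; rfl
    rw [Fin.sum_univ_two] at h2
    simp only [Fin.sum_univ_two, add_apply, SchwartzMap.smulLeftCLM_apply_apply (hd _), hsr, h1,
      hsr', map_add, map_smul, smul_eq_mul, hrr 1]
    linear_combination h2
  have e4 : (𝓕 (∑ j, ∂_{e j} (w j) - ∑ j, w' j) : 𝓢'(Plane, ℂ)) =
      ∑ j, 𝓕 (∂_{e j} (w j)) - ∑ j, 𝓕 (w' j) := by
    have := map_sub (FourierTransform.fourierCLM ℂ 𝓢'(Plane, ℂ)) (∑ j, ∂_{e j} (w j)) (∑ j, w' j)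
    simp only [map_sum] at this
    exact this
  rw [e4]
  have e5 := congrArg (fun s : 𝓢(Plane, ℂ) => (𝓕 θ : 𝓢'(Plane, ℂ)) s) e3
  simp only [Fin.sum_univ_two, sub_apply, add_apply, e1, e2, map_add] at e5 ⊢
  linear_combination (2 * Real.pi : ℂ) ^ 2 * e5

end tblock

end partition

/-! ### The bilinear operator at a pair of frequencies -/

theorem Window.exists_bound_finite {ι : Type*} [Fintype ι] {c : Plane → ℂ} (hc : Window c) {d : ℤ}
    {σ : ι → Plane → ℂ} (hσ : ∀ i, Homog d (σ i)) {p : ℝ≥0∞} (hp : 1 ≤ p) (hp' : p ≠ ∞) :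
    ∃ C : ℝ≥0∞, C ≠ ∞ ∧ ∀ (i : ι) (j : ℤ) (u : 𝓢'(Plane, ℂ)),
      distLpNorm p (FM (windowed c (σ i) j) u) ≤ C * 2 ^ (d * (j : ℝ)) * distLpNorm p u ∧
      distLpNorm ∞ (FM (windowed c (σ i) j) u) ≤
        C * 2 ^ ((d + 2 / p.toReal) * (j : ℝ)) * distLpNorm p u ∧
      distLpNorm (2 * p) (FM (windowed c (σ i) j) u) ≤
        C * 2 ^ ((d + 1 / p.toReal) * (j : ℝ)) * distLpNorm p u := by
  choose C h0 h1 h using fun i => hc.exists_bound (hσ i) hp hp'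
  have hle : ∀ i, C i ≤ ∑ i, C i := fun i =>
    Finset.single_le_sum (f := C) (fun _ _ => zero_le) (Finset.mem_univ i)
  refine ⟨∑ i, C i, ENNReal.sum_ne_top.2 fun i _ => h1 i, fun i j u => ?_⟩
  obtain ⟨b1, b2, b3⟩ := h i j u
  exact ⟨b1.trans (by gcongr; exact hle i), b2.trans (by gcongr; exact hle i),
    b3.trans (by gcongr; exact hle i)⟩

theorem FM_windowed {c τ σ : Plane → ℂ} (hc : Window c) {d : ℤ} (hτ : Homog d τ)
    (hσ : σ.HasTemperateGrowth) (j : ℤ) (u : 𝓢'(Plane, ℂ)) :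
    FM σ (FM (windowed c τ j) u) = FM (windowed c (fun ξ => τ ξ * σ ξ) j) u := by
  rw [FM_FM (hc.hasTemperateGrowth hτ j) hσ]
  congr 2
  funext ξ
  simp only [windowed, mul_assoc]

theorem windowed_FM {c τ σ : Plane → ℂ} (hc : Window c) {d : ℤ} (hτ : Homog d τ)
    (hσ : σ.HasTemperateGrowth) (j : ℤ) (u : 𝓢'(Plane, ℂ)) :
    FM (windowed c τ j) (FM σ u) = FM (windowed c (fun ξ => σ ξ * τ ξ) j) u := by
  rw [FM_FM hσ (hc.hasTemperateGrowth hτ j)]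
  congr 2
  funext ξ
  simp only [windowed]
  ring

/-- The symbols of the components of `∇^⊥`. -/
def psym : Fin 2 → Plane → ℂ := ![fun ξ => -dsym 1 ξ, dsym 0]

theorem homog_psym (j : Fin 2) : Homog 1 (psym j) := by
  fin_cases j
  · exact (homog_dsym 1).neg
  · exact homog_dsym 0

theorem hasTemperateGrowth_psym (j : Fin 2) : (psym j).HasTemperateGrowth := by
  fin_cases j
  · exact (hasTemperateGrowth_dsym 1).neg
  · exact hasTemperateGrowth_dsym 0

theorem perpGrad_eq_FM (u : 𝓢'(Plane, ℂ)) (j : Fin 2) : perpGrad u j = FM (psym j) u := by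
  fin_cases j
  · have h := FM_const_mul (hasTemperateGrowth_dsym 1) (-1) u
    simp only [neg_one_mul] at h
    change -∂_{e 1} u = FM (fun ξ => -dsym 1 ξ) u
    rw [h, lineDeriv_eq_FM]
    exact (neg_one_smul ℂ (FM (dsym 1) u)).symm
  · exact lineDeriv_eq_FM 0 u

theorem sum_lineDeriv_perpGrad (u : 𝓢'(Plane, ℂ)) : ∑ j, ∂_{e j} (perpGrad u j) = 0 := by
  simp only [lineDeriv_eq_FM, perpGrad_eq_FM, Fin.sum_univ_two]
  rw [FM_FM (hasTemperateGrowth_psym 0) (hasTemperateGrowth_dsym 0),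
    FM_FM (hasTemperateGrowth_psym 1) (hasTemperateGrowth_dsym 1)]
  have h := FM_const_mul ((hasTemperateGrowth_dsym 0).mul (hasTemperateGrowth_dsym 1)) (-1) u
  have e1 : (fun ξ => psym 0 ξ * dsym 0 ξ) = fun ξ => -1 * (dsym 0 * dsym 1) ξ := by
    funext ξ
    simp only [psym, Matrix.cons_val_zero, Pi.mul_apply]
    ring
  have e2 : (fun ξ => psym 1 ξ * dsym 1 ξ) = dsym 0 * dsym 1 := rfl
  rw [e1, e2, h, neg_one_smul ℂ (FM (dsym 0 * dsym 1) u), neg_add_cancel]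

/-! ### The operator `T` on a pair of frequency blocks. -/

section

variable (φ : DyadicPartition)

/-- The dyadic piece of the operator `T`, with the value `0` where it is not defined. -/
def tblock (i : Fin 2) (k l : ℤ) (θ v : 𝓢'(Plane, ℂ)) : 𝓢'(Plane, ℂ) :=
  open Classical in if h : ∃ w, IsTBlock φ i k l θ v w then h.choose else 0

theorem IsTBlock.eq_tblock {φ : DyadicPartition} {i : Fin 2} {k l : ℤ} {θ v w : 𝓢'(Plane, ℂ)}
    (h : IsTBlock φ i k l θ v w) : w = tblock φ i k l θ v := by
  have h' : ∃ w, IsTBlock φ i k l θ v w := ⟨w, h⟩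
  rw [tblock, dif_pos h']
  exact h.unique h'.choose_spec

/-- The exponents `(p, ∞, p)` suffice for existence; by uniqueness, estimates with other exponents
concern the same distribution. -/
theorem isTBlock_tblock {i : Fin 2} {k l : ℤ} {θ v : 𝓢'(Plane, ℂ)} {p : ℝ≥0∞} (hp : 1 ≤ p)
    (hp' : p ≠ ∞) (h1 : distLpNorm ∞ θ < ∞) (h2 : distLpNorm ∞ v < ∞)
    (h3 : distLpNorm p θ < ∞) : IsTBlock φ i k l θ v (tblock φ i k l θ v) := by
  obtain ⟨C, -, -, h⟩ := exists_TBlock_bound φ (p := p) (p' := ∞) (r := p) hp le_top hp hp'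
  obtain ⟨w, hw, -⟩ := h i k l θ v h1 h2 h3 h2
  exact hw.eq_tblock ▸ hw

/-- `T_i[θ, v]` for `θ` and `v` of frequencies about `2^k` and `2^l`. -/
def tlocal (i : Fin 2) (k l : ℤ) (θ v : 𝓢'(Plane, ℂ)) : 𝓢'(Plane, ℂ) :=
  ∑ κ ∈ Finset.Icc (k - 2) (k + 2) ×ˢ Finset.Icc (l - 2) (l + 2), tblock φ i κ.1 κ.2 θ v

theorem exists_tlocal_bound {p p' r : ℝ≥0∞} [p.HolderTriple p' r] (hp : 1 ≤ p) (hp' : 1 ≤ p')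
    (hr : 1 ≤ r) (hr' : r ≠ ∞) :
    ∃ C : ℝ≥0∞, C ≠ ∞ ∧ ∀ (i : Fin 2) (k l : ℤ) (u v : 𝓢'(Plane, ℂ)),
      distLpNorm ∞ u < ∞ → distLpNorm ∞ v < ∞ → distLpNorm p u < ∞ → distLpNorm p' v < ∞ →
      distLpNorm r (tlocal φ i k l u v) ≤ C * (distLpNorm p u * distLpNorm p' v) := by
  obtain ⟨C, -, hC, h⟩ := exists_TBlock_bound φ (p := p) (p' := p') (r := r) hp hp' hr hr'
  refine ⟨25 * C, ENNReal.mul_ne_top (by simp) hC, fun i k l u v h1 h2 h3 h4 => ?_⟩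
  refine (distLpNorm_sum_le hr _ _).trans ?_
  refine (Finset.sum_le_card_nsmul _ _ (C * (distLpNorm p u * distLpNorm p' v)) fun κ _ => ?_).trans
    (le_of_eq ?_)
  · obtain ⟨w, hw, hb⟩ := h i κ.1 κ.2 u v h1 h2 h3 h4
    rwa [← hw.eq_tblock]
  · have e1 : (Finset.Icc (k - 2) (k + 2) ×ˢ Finset.Icc (l - 2) (l + 2)).card = 25 := by
      rw [Finset.card_product, Int.card_Icc, Int.card_Icc,
        show k + 2 + 1 - (k - 2) = 5 by ring, show l + 2 + 1 - (l - 2) = 5 by ring]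
      rfl
    rw [e1, nsmul_eq_mul, mul_assoc]
    norm_num

/-- Symbol conditions that let an output frequency vanish. -/
theorem cutoff_triple_eq_zero {k l k' l' j : ℤ} (hk : |k' - k| ≤ 2) (hl : |l' - l| ≤ 2)
    (h : max k l + 6 ≤ j ∨ (8 ≤ |k - l| ∧ j ≤ max k l - 6)) (ξ η : Plane) :
    φ.cutoff k' ξ * φ.cutoff l' η * φ.cutoff j (ξ + η) = 0 := by
  by_contra h0
  obtain ⟨a1, a2⟩ := cutoff_ne_zero φ (left_ne_zero_of_mul (left_ne_zero_of_mul h0))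
  obtain ⟨b1, b2⟩ := cutoff_ne_zero φ (right_ne_zero_of_mul (left_ne_zero_of_mul h0))
  obtain ⟨c1, c2⟩ := cutoff_ne_zero φ (right_ne_zero_of_mul h0)
  rw [abs_le] at hk hl
  have hpi : (0 : ℝ) < 2 * Real.pi := by positivity
  have t1 : 2 * Real.pi * ‖ξ + η‖ ≤ 2 * Real.pi * ‖ξ‖ + 2 * Real.pi * ‖η‖ := by
    rw [← mul_add]; gcongr; exact norm_add_le _ _
  have t2 : 2 * Real.pi * ‖ξ‖ ≤ 2 * Real.pi * ‖ξ + η‖ + 2 * Real.pi * ‖η‖ := by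
    rw [← mul_add]; gcongr
    simpa using norm_sub_le (ξ + η) η
  have t3 : 2 * Real.pi * ‖η‖ ≤ 2 * Real.pi * ‖ξ + η‖ + 2 * Real.pi * ‖ξ‖ := by
    rw [← mul_add]; gcongr
    simpa using norm_sub_le (ξ + η) ξ
  have mono : ∀ {m n : ℤ}, m ≤ n → (2 : ℝ) ^ m ≤ 2 ^ n := fun h =>
    zpow_le_zpow_right₀ one_le_two h
  -- In the first case the output would be at least `2^(max k l + 5)`, with inputs of at most
  -- `2^(max k l + 3)` each. In the second, the larger input, at least `2^(M - 3)`, would be bounded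
  -- by the sum of the output and the other input, each at most `2^(M - 5)`.
  rcases h with h | ⟨h1, h2⟩
  · have m1 : (2 : ℝ) ^ (k' + 1) ≤ 2 ^ (max k l + 3) := mono (by omega)
    have m2 : (2 : ℝ) ^ (l' + 1) ≤ 2 ^ (max k l + 3) := mono (by omega)
    have m3 : (2 : ℝ) ^ (max k l + 5) ≤ 2 ^ (j - 1) := mono (by omega)
    have e1 : (2 : ℝ) ^ (max k l + 5) = 4 * 2 ^ (max k l + 3) := by
      rw [show max k l + 5 = (max k l + 3) + 2 by ring, zpow_add₀ two_ne_zero]; norm_num; ring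
    have : (0 : ℝ) < 2 ^ (max k l + 3) := by positivity
    linarith
  · set M := max k l with hM
    have m1 : (2 : ℝ) ^ (j + 1) ≤ 2 ^ (M - 5) := mono (by omega)
    have e1 : (2 : ℝ) ^ (M - 3) = 4 * 2 ^ (M - 5) := by
      rw [show M - 3 = (M - 5) + 2 by ring, zpow_add₀ two_ne_zero]; norm_num; ring
    have : (0 : ℝ) < 2 ^ (M - 5) := by positivity
    rcases le_total k l with hkl | hkl
    · have m2 : (2 : ℝ) ^ (k' + 1) ≤ 2 ^ (M - 5) := mono (by
        rw [abs_of_nonpos (by omega)] at h1; omega)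
      have m3 : (2 : ℝ) ^ (M - 3) ≤ 2 ^ (l' - 1) := mono (by omega)
      linarith
    · have m2 : (2 : ℝ) ^ (l' + 1) ≤ 2 ^ (M - 5) := mono (by
        rw [abs_of_nonneg (by omega)] at h1; omega)
      have m3 : (2 : ℝ) ^ (M - 3) ≤ 2 ^ (k' - 1) := mono (by omega)
      linarith

section local_data

variable {φ} {i : Fin 2} {k l : ℤ} {θ v : 𝓢'(Plane, ℂ)} {p : ℝ≥0∞}

theorem isT_tlocal (hp : 1 ≤ p) (hp' : p ≠ ∞) (h1 : distLpNorm ∞ θ < ∞) (h2 : distLpNorm ∞ v < ∞)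
    (h3 : distLpNorm p θ < ∞) {θ' v' : 𝓢'(Plane, ℂ)} (hθ : θ = block φ k θ')
    (hv : v = block φ l v') : IsT φ i θ v (tlocal φ i k l θ v) := by
  have hT : ∀ κ : ℤ × ℤ, IsTBlock φ i κ.1 κ.2 θ v (tblock φ i κ.1 κ.2 θ v) := fun κ =>
    isTBlock_tblock φ hp hp' h1 h2 h3
  refine ⟨fun κ => tblock φ i κ.1 κ.2 θ v, hT, hasSum_sum_of_ne_finset_zero fun κ hκ => ?_⟩
  rw [Finset.mem_product, not_and_or, Finset.mem_Icc, Finset.mem_Icc] at hκ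
  rcases hκ with hκ | hκ
  · exact (hT κ).eq_zero_left (hasTemperateGrowth_cutoff φ k)
      (cutoff_mul_cutoff φ (by rw [le_abs]; omega)) hθ
  · exact (hT κ).eq_zero_right (hasTemperateGrowth_cutoff φ l)
      (cutoff_mul_cutoff φ (by rw [le_abs]; omega)) hv

theorem FM_tlocal_eq_zero (hp : 1 ≤ p) (hp' : p ≠ ∞) (h1 : distLpNorm ∞ θ < ∞)
    (h2 : distLpNorm ∞ v < ∞) (h3 : distLpNorm p θ < ∞) {j : ℤ}
    (h : max k l + 6 ≤ j ∨ (8 ≤ |k - l| ∧ j ≤ max k l - 6)) {d : ℤ} {σ : Plane → ℂ}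
    (hσ : Homog d σ) : FM (windowed (φ.cutoff 0) σ j) (tlocal φ i k l θ v) = 0 := by
  rw [tlocal, map_sum]
  refine Finset.sum_eq_zero fun κ hκ => ?_
  rw [Finset.mem_product, Finset.mem_Icc, Finset.mem_Icc] at hκ
  refine (isTBlock_tblock φ hp hp' h1 h2 h3).FM_eq_zero
    ((window_cutoff φ).hasTemperateGrowth hσ j) fun ξ η => ?_
  rw [← cutoff_mul_eq_windowed, ← mul_assoc,
    cutoff_triple_eq_zero φ (abs_le.2 ⟨by omega, by omega⟩) (abs_le.2 ⟨by omega, by omega⟩) h,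
    zero_mul]

theorem leibniz_tlocal (hp : 1 ≤ p) (hp' : p ≠ ∞) {v : Fin 2 → 𝓢'(Plane, ℂ)}
    (h1 : distLpNorm ∞ θ < ∞) (h2 : ∀ j, distLpNorm ∞ (v j) < ∞) (h3 : distLpNorm p θ < ∞)
    (h1' : ∀ j, distLpNorm ∞ (∂_{e j} θ) < ∞) (h3' : ∀ j, distLpNorm p (∂_{e j} θ) < ∞)
    (hdiv : ∑ j, ∂_{e j} (v j) = 0) :
    ∑ j, ∂_{e j} (tlocal φ i k l θ (v j)) = ∑ j, tlocal φ i k l (∂_{e j} θ) (v j) := by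
  simp only [tlocal, lineDeriv_eq_FM, map_sum]
  refine Finset.sum_comm.trans (Eq.trans ?_ Finset.sum_comm)
  refine Finset.sum_congr rfl fun κ _ => ?_
  have := IsTBlock.leibniz (φ := φ) (i := i) (k := κ.1) (l := κ.2) hdiv
    (fun j => isTBlock_tblock φ hp hp' h1 (h2 j) h3)
    (fun j => isTBlock_tblock φ hp hp' (h1' j) (h2 j) (h3' j))
  simpa only [lineDeriv_eq_FM] using this

end local_data

end

/-! ### Estimates for the interaction of two frequencies -/

theorem homog_rsym_half : Homog (-1) (rsym (1 / 2)) := homog_rsym (by norm_num)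

theorem homog_rsym_one : Homog (-2) (rsym 1) := homog_rsym (by norm_num)

section

variable (φ : DyadicPartition)

/-- `(-Δ)^(-1/2) φ_k * F`. -/
def invHalf (k : ℤ) (F : 𝓢'(Plane, ℂ)) : 𝓢'(Plane, ℂ) :=
  FM (windowed (fat φ 0) (rsym (1 / 2)) k) (block φ k F)

/-- Exhibits the factors as blocks, the form in which `isT_tlocal` needs them. -/
theorem FM_windowed_block {d : ℤ} {σ : Plane → ℂ} (hσ : Homog d σ) (k : ℤ) (F : 𝓢'(Plane, ℂ)) :
    FM (windowed (fat φ 0) σ k) (block φ k F) = block φ k (FM (windowed (fat φ 0) σ k) F) := by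
  have h1 := (window_fat φ).hasTemperateGrowth hσ k
  have h2 := hasTemperateGrowth_cutoff φ k
  change FM _ (FM _ F) = FM _ (FM _ F)
  rw [FM_FM h1 h2, FM_FM h2 h1]
  simp_rw [mul_comm]

theorem homog_perp (j : Fin 2) : Homog 0 fun ξ => rsym (1 / 2) ξ * psym j ξ :=
  homog_rsym_half.mul (homog_psym j)

theorem homog_deriv (j : Fin 2) : Homog 0 fun ξ => rsym (1 / 2) ξ * dsym j ξ :=
  homog_rsym_half.mul (homog_dsym j)

theorem perpGrad_invHalf (l : ℤ) (G : 𝓢'(Plane, ℂ)) (j : Fin 2) :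
    perpGrad (invHalf φ l G) j =
      FM (windowed (fat φ 0) (fun ξ => rsym (1 / 2) ξ * psym j ξ) l) (block φ l G) := by
  rw [perpGrad_eq_FM, invHalf, FM_windowed (window_fat φ) homog_rsym_half
    (hasTemperateGrowth_psym j)]

theorem lineDeriv_invHalf (k : ℤ) (F : 𝓢'(Plane, ℂ)) (j : Fin 2) :
    ∂_{e j} (invHalf φ k F) =
      FM (windowed (fat φ 0) (fun ξ => rsym (1 / 2) ξ * dsym j ξ) k) (block φ k F) := by
  rw [lineDeriv_eq_FM, invHalf, FM_windowed (window_fat φ) homog_rsym_half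
    (hasTemperateGrowth_dsym j)]

/-- The matrix `T[(-Δ)^(-1/2) φ_k * F, ∇^⊥ (-Δ)^(-1/2) φ_l * G]`. -/
def amat (k l : ℤ) (F G : 𝓢'(Plane, ℂ)) (i j : Fin 2) : 𝓢'(Plane, ℂ) :=
  tlocal φ i k l (invHalf φ k F) (perpGrad (invHalf φ l G) j)

/-- The part of `B[φ_k * F, φ_l * G]` of frequency about `2^n`. -/
def piece (k l : ℤ) (F G : 𝓢'(Plane, ℂ)) (n : ℤ) : 𝓢'(Plane, ℂ) :=
  FM (windowed (φ.cutoff 0) (rsym 1) n) (divDiv (amat φ k l F G))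

variable {p : ℝ≥0∞} (hp : 1 ≤ p) (hp' : p ≠ ∞)

include hp hp'

theorem exists_invHalf_bound : ∃ C : ℝ≥0∞, C ≠ ∞ ∧ ∀ (k : ℤ) (F : 𝓢'(Plane, ℂ)),
    distLpNorm p (invHalf φ k F) ≤ C * 2 ^ (-(k : ℝ)) * distLpNorm p (block φ k F) ∧
    distLpNorm ∞ (invHalf φ k F) ≤
      C * 2 ^ ((-1 + 2 / p.toReal) * (k : ℝ)) * distLpNorm p (block φ k F) := by
  obtain ⟨C, -, hC, h⟩ := (window_fat φ).exists_bound homog_rsym_half hp hp'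
  refine ⟨C, hC, fun k F => ?_⟩
  obtain ⟨h1, h2, -⟩ := h k (block φ k F)
  push_cast at h1 h2
  rw [neg_one_mul] at h1
  exact ⟨h1, h2⟩

theorem exists_perp_bound : ∃ C : ℝ≥0∞, C ≠ ∞ ∧ ∀ (l : ℤ) (G : 𝓢'(Plane, ℂ)) (j : Fin 2),
    distLpNorm p (perpGrad (invHalf φ l G) j) ≤ C * distLpNorm p (block φ l G) ∧
    distLpNorm ∞ (perpGrad (invHalf φ l G) j) ≤
      C * 2 ^ (2 / p.toReal * (l : ℝ)) * distLpNorm p (block φ l G) := by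
  obtain ⟨C, hC, h⟩ := (window_fat φ).exists_bound_finite homog_perp hp hp'
  refine ⟨C, hC, fun l G j => ?_⟩
  obtain ⟨h1, h2, -⟩ := h j l (block φ l G)
  simp only [Int.cast_zero, zero_mul, ENNReal.rpow_zero, mul_one, zero_add] at h1 h2
  rw [perpGrad_invHalf]
  exact ⟨h1, h2⟩

theorem exists_deriv_bound : ∃ C : ℝ≥0∞, C ≠ ∞ ∧ ∀ (k : ℤ) (F : 𝓢'(Plane, ℂ)) (j : Fin 2),
    distLpNorm p (∂_{e j} (invHalf φ k F)) ≤ C * distLpNorm p (block φ k F) ∧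
    distLpNorm ∞ (∂_{e j} (invHalf φ k F)) ≤
      C * 2 ^ (2 / p.toReal * (k : ℝ)) * distLpNorm p (block φ k F) := by
  obtain ⟨C, hC, h⟩ := (window_fat φ).exists_bound_finite homog_deriv hp hp'
  refine ⟨C, hC, fun k F j => ?_⟩
  obtain ⟨h1, h2, -⟩ := h j k (block φ k F)
  simp only [Int.cast_zero, zero_mul, ENNReal.rpow_zero, mul_one, zero_add] at h1 h2
  rw [lineDeriv_invHalf]
  exact ⟨h1, h2⟩

omit hp hp' in
theorem mul_mul_lt_top {a b c : ℝ≥0∞} {x : ℝ} (ha : a ≠ ∞) (hc : c < ∞) (h : b ≤ a * 2 ^ x * c) :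
    b < ∞ :=
  h.trans_lt (ENNReal.mul_lt_top (ENNReal.mul_lt_top ha.lt_top (two_rpow_ne_top _).lt_top) hc)

section finite

variable {k l : ℤ} {F G : 𝓢'(Plane, ℂ)} (hF : distLpNorm p (block φ k F) < ∞)

include hF

theorem invHalf_lt_top : distLpNorm p (invHalf φ k F) < ∞ ∧ distLpNorm ∞ (invHalf φ k F) < ∞ := by
  obtain ⟨C, hC, h⟩ := exists_invHalf_bound φ hp hp'
  exact ⟨mul_mul_lt_top hC hF (h k F).1, mul_mul_lt_top hC hF (h k F).2⟩

theorem perpGrad_invHalf_lt_top (j : Fin 2) : distLpNorm p (perpGrad (invHalf φ k F) j) < ∞ ∧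
    distLpNorm ∞ (perpGrad (invHalf φ k F) j) < ∞ := by
  obtain ⟨C, hC, h⟩ := exists_perp_bound φ hp hp'
  exact ⟨(h k F j).1.trans_lt (ENNReal.mul_lt_top hC.lt_top hF),
    mul_mul_lt_top hC hF (h k F j).2⟩

theorem lineDeriv_invHalf_lt_top (j : Fin 2) : distLpNorm p (∂_{e j} (invHalf φ k F)) < ∞ ∧
    distLpNorm ∞ (∂_{e j} (invHalf φ k F)) < ∞ := by
  obtain ⟨C, hC, h⟩ := exists_deriv_bound φ hp hp'
  exact ⟨(h k F j).1.trans_lt (ENNReal.mul_lt_top hC.lt_top hF),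
    mul_mul_lt_top hC hF (h k F j).2⟩

variable (hG : distLpNorm p (block φ l G) < ∞)

include hG

theorem isT_amat (i j : Fin 2) :
    IsT φ i (invHalf φ k F) (perpGrad (invHalf φ l G) j) (amat φ k l F G i j) := by
  have h1 := invHalf_lt_top φ hp hp' hF
  have h2 := perpGrad_invHalf_lt_top φ hp hp' hG j
  exact isT_tlocal hp hp' h1.2 h2.2 h1.1 (FM_windowed_block φ homog_rsym_half k F)
    ((perpGrad_invHalf φ l G j).trans (FM_windowed_block φ (homog_perp j) l G))

end finite

omit hp hp' in
theorem homog_second (κ : Fin 2 × Fin 2) : Homog 0 fun ξ => dsym κ.2 ξ * (dsym κ.1 ξ * rsym 1 ξ) :=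
  (homog_dsym κ.2).mul ((homog_dsym κ.1).mul homog_rsym_one)

omit hp hp' in
theorem homog_first (i : Fin 2) : Homog (-1) fun ξ => dsym i ξ * rsym 1 ξ :=
  (homog_dsym i).mul homog_rsym_one

omit hp hp' in
-- Both derivatives combine with `(-Δ)⁻¹` into symbols of degree 0, bounded on `L^p` uniformly in
-- `n`.
theorem FM_divDiv (A : Fin 2 → Fin 2 → 𝓢'(Plane, ℂ)) (n : ℤ) :
    FM (windowed (φ.cutoff 0) (rsym 1) n) (divDiv A) = ∑ i, ∑ j,
      FM (windowed (φ.cutoff 0) (fun ξ => dsym j ξ * (dsym i ξ * rsym 1 ξ)) n) (A i j) := by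
  simp only [divDiv, map_sum, lineDeriv_eq_FM]
  refine Finset.sum_congr rfl fun i _ => Finset.sum_congr rfl fun j _ => ?_
  rw [windowed_FM (window_cutoff φ) homog_rsym_one (hasTemperateGrowth_dsym i),
    windowed_FM (window_cutoff φ) (homog_first i) (hasTemperateGrowth_dsym j)]

omit hp hp' in
-- Only the outer derivative is absorbed, giving a symbol of degree `-1` and hence the factor
-- `2^(-n)`; the inner divergence is left for the Leibniz rule.
theorem FM_divDiv_first (A : Fin 2 → Fin 2 → 𝓢'(Plane, ℂ)) (n : ℤ) :
    FM (windowed (φ.cutoff 0) (rsym 1) n) (divDiv A) = ∑ i,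
      FM (windowed (φ.cutoff 0) (fun ξ => dsym i ξ * rsym 1 ξ) n) (∑ j, ∂_{e j} (A i j)) := by
  simp only [divDiv, map_sum, lineDeriv_eq_FM]
  refine Finset.sum_congr rfl fun i _ => Finset.sum_congr rfl fun j _ => ?_
  rw [windowed_FM (window_cutoff φ) homog_rsym_one (hasTemperateGrowth_dsym i)]

theorem piece_eq_zero {k l n : ℤ} {F G : 𝓢'(Plane, ℂ)} (hF : distLpNorm p (block φ k F) < ∞)
    (hG : distLpNorm p (block φ l G) < ∞)
    (h : max k l + 6 ≤ n ∨ (8 ≤ |k - l| ∧ n ≤ max k l - 6)) : piece φ k l F G n = 0 := by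
  have h1 := invHalf_lt_top φ hp hp' hF
  rw [piece, FM_divDiv]
  refine Finset.sum_eq_zero fun i _ => Finset.sum_eq_zero fun j _ => ?_
  exact FM_tlocal_eq_zero hp hp' h1.2 (perpGrad_invHalf_lt_top φ hp hp' hG j).2 h1.1 h
    (homog_second (i, j))

/-- The estimate with the second factor in `L^∞`. -/
theorem exists_piece_bound : ∃ C : ℝ≥0∞, C ≠ ∞ ∧ ∀ (k l n : ℤ) (F G : 𝓢'(Plane, ℂ)),
    distLpNorm p (block φ k F) < ∞ → distLpNorm p (block φ l G) < ∞ →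
    distLpNorm p (piece φ k l F G n) ≤ C * 2 ^ (-(k : ℝ) + 2 / p.toReal * l) *
      (distLpNorm p (block φ k F) * distLpNorm p (block φ l G)) := by
  obtain ⟨C₁, hC₁, h₁⟩ := exists_invHalf_bound φ hp hp'
  obtain ⟨C₂, hC₂, h₂⟩ := exists_perp_bound φ hp hp'
  obtain ⟨C₃, hC₃, h₃⟩ := exists_tlocal_bound φ (p := p) (p' := ∞) (r := p) hp le_top hp hp'
  obtain ⟨C₄, hC₄, h₄⟩ := (window_cutoff φ).exists_bound_finite homog_second hp hp'
  refine ⟨4 * (C₄ * (C₃ * (C₁ * C₂))), ENNReal.mul_ne_top (by simp) (ENNReal.mul_ne_top hC₄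
    (ENNReal.mul_ne_top hC₃ (ENNReal.mul_ne_top hC₁ hC₂))), fun k l n F G hF hG => ?_⟩
  have f1 := invHalf_lt_top φ hp hp' hF
  have hA : ∀ i j, distLpNorm p (amat φ k l F G i j) ≤ C₃ * ((C₁ * 2 ^ (-(k : ℝ)) *
      distLpNorm p (block φ k F)) * (C₂ * 2 ^ (2 / p.toReal * (l : ℝ)) *
      distLpNorm p (block φ l G))) := fun i j => by
    have f2 := perpGrad_invHalf_lt_top φ hp hp' hG j
    refine (h₃ i k l _ _ f1.2 f2.2 f1.1 f2.2).trans ?_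
    gcongr
    · exact (h₁ k F).1
    · exact (h₂ l G j).2
  rw [piece, FM_divDiv]
  refine (distLpNorm_sum_le hp _ _).trans ?_
  refine (Finset.sum_le_sum fun i _ => (distLpNorm_sum_le hp _ _).trans
    (Finset.sum_le_sum fun j _ => ((h₄ (i, j) n _).1.trans (mul_le_mul_right (hA i j) _)))).trans ?_
  simp only [Int.cast_zero, zero_mul, ENNReal.rpow_zero, mul_one, Finset.sum_const,
    Finset.card_univ, Fintype.card_fin, nsmul_eq_mul]
  rw [two_rpow_add]
  refine le_of_eq ?_
  push_cast
  ring

/-- The `L^r` estimate for the matrix, `r = p / 2`. -/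
theorem exists_amat_bound {r : ℝ≥0∞} [p.HolderTriple p r] (hr : 1 ≤ r) (hr' : r ≠ ∞) :
    ∃ C : ℝ≥0∞, C ≠ ∞ ∧ ∀ (k l : ℤ) (F G : 𝓢'(Plane, ℂ)) (i j : Fin 2),
    distLpNorm p (block φ k F) < ∞ → distLpNorm p (block φ l G) < ∞ →
    distLpNorm r (amat φ k l F G i j) ≤ C * 2 ^ (-(k : ℝ)) *
      (distLpNorm p (block φ k F) * distLpNorm p (block φ l G)) := by
  obtain ⟨C₁, hC₁, h₁⟩ := exists_invHalf_bound φ hp hp'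
  obtain ⟨C₂, hC₂, h₂⟩ := exists_perp_bound φ hp hp'
  obtain ⟨C₃, hC₃, h₃⟩ := exists_tlocal_bound φ (p := p) (p' := p) (r := r) hp hp hr hr'
  refine ⟨C₃ * (C₁ * C₂), ENNReal.mul_ne_top hC₃ (ENNReal.mul_ne_top hC₁ hC₂),
    fun k l F G i j hF hG => ?_⟩
  have f1 := invHalf_lt_top φ hp hp' hF
  have f2 := perpGrad_invHalf_lt_top φ hp hp' hG j
  refine (h₃ i k l _ _ f1.2 f2.2 f1.1 f2.1).trans ?_
  refine (mul_le_mul_right (mul_le_mul' (h₁ k F).1 (h₂ l G j).1) _).trans (le_of_eq ?_)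
  ring

/-- The estimate through `L^r`, `r = p / 2`. -/
theorem exists_piece_bound_half {r : ℝ≥0∞} [p.HolderTriple p r] (hr : 1 ≤ r) (hr' : r ≠ ∞)
    (hpr : p = 2 * r) : ∃ C : ℝ≥0∞, C ≠ ∞ ∧ ∀ (k l n : ℤ) (F G : 𝓢'(Plane, ℂ)),
    distLpNorm p (block φ k F) < ∞ → distLpNorm p (block φ l G) < ∞ →
    distLpNorm p (piece φ k l F G n) ≤ C * 2 ^ (-(k : ℝ) + 2 / p.toReal * n) *
      (distLpNorm p (block φ k F) * distLpNorm p (block φ l G)) := by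
  obtain ⟨C₃, hC₃, h₃⟩ := exists_amat_bound φ hp hp' hr hr'
  obtain ⟨C₄, hC₄, h₄⟩ := (window_cutoff φ).exists_bound_finite homog_second hr hr'
  refine ⟨4 * (C₄ * C₃), ENNReal.mul_ne_top (by simp) (ENNReal.mul_ne_top hC₄ hC₃),
    fun k l n F G hF hG => ?_⟩
  rw [piece, FM_divDiv]
  refine (distLpNorm_sum_le hp _ _).trans ?_
  have hx : 1 / r.toReal = 2 / p.toReal := by
    rw [hpr, ENNReal.toReal_mul, ENNReal.toReal_ofNat]
    have : r.toReal ≠ 0 := ENNReal.toReal_ne_zero.2 ⟨(zero_lt_one.trans_le hr).ne', hr'⟩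
    field_simp
  have hB : ∀ i j, distLpNorm p (FM (windowed (φ.cutoff 0)
      (fun ξ => dsym j ξ * (dsym i ξ * rsym 1 ξ)) n) (amat φ k l F G i j)) ≤
      C₄ * 2 ^ (2 / p.toReal * (n : ℝ)) * (C₃ * 2 ^ (-(k : ℝ)) *
      (distLpNorm p (block φ k F) * distLpNorm p (block φ l G))) := fun i j => by
    -- Bernstein from `L^r` to `L^(2r) = L^p` at the output frequency, at the cost `2^(n/r)` with
    -- `1/r = 2/p`.
    have := (h₄ (i, j) n (amat φ k l F G i j)).2.2
    rw [← hpr, hx, Int.cast_zero, zero_add] at this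
    exact this.trans (mul_le_mul_right (h₃ k l F G i j hF hG) _)
  refine (Finset.sum_le_sum fun i _ => (distLpNorm_sum_le hp _ _).trans
    (Finset.sum_le_sum fun j _ => hB i j)).trans ?_
  simp only [Finset.sum_const, Finset.card_univ, Fintype.card_fin, nsmul_eq_mul]
  rw [two_rpow_add]
  refine le_of_eq ?_
  push_cast
  ring

/-- The estimate with the derivative moved to the first factor, which is taken in `L^∞`. -/
theorem exists_piece_bound_leibniz : ∃ C : ℝ≥0∞, C ≠ ∞ ∧ ∀ (k l n : ℤ) (F G : 𝓢'(Plane, ℂ)),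
    distLpNorm p (block φ k F) < ∞ → distLpNorm p (block φ l G) < ∞ →
    distLpNorm p (piece φ k l F G n) ≤ C * 2 ^ (-(n : ℝ) + 2 / p.toReal * k) *
      (distLpNorm p (block φ k F) * distLpNorm p (block φ l G)) := by
  obtain ⟨C₁, hC₁, h₁⟩ := exists_deriv_bound φ hp hp'
  obtain ⟨C₂, hC₂, h₂⟩ := exists_perp_bound φ hp hp'
  obtain ⟨C₃, hC₃, h₃⟩ := exists_tlocal_bound φ (p := ∞) (p' := p) (r := p) le_top hp hp hp'
  obtain ⟨C₄, hC₄, h₄⟩ := (window_cutoff φ).exists_bound_finite homog_first hp hp'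
  refine ⟨4 * (C₄ * (C₃ * (C₁ * C₂))), ENNReal.mul_ne_top (by simp) (ENNReal.mul_ne_top hC₄
    (ENNReal.mul_ne_top hC₃ (ENNReal.mul_ne_top hC₁ hC₂))), fun k l n F G hF hG => ?_⟩
  have f1 := invHalf_lt_top φ hp hp' hF
  have f2 := perpGrad_invHalf_lt_top φ hp hp' hG
  have f3 := lineDeriv_invHalf_lt_top φ hp hp' hF
  have hA : ∀ i, distLpNorm p (∑ j, ∂_{e j} (amat φ k l F G i j)) ≤
      2 * (C₃ * ((C₁ * 2 ^ (2 / p.toReal * (k : ℝ)) * distLpNorm p (block φ k F)) *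
        (C₂ * distLpNorm p (block φ l G)))) := fun i => by
    simp only [amat]
    -- The derivative cancels `(-Δ)^(-1/2)` on the first factor, which then enters through its `L^∞`
    -- norm without the factor `2^(-k)`.
    rw [leibniz_tlocal hp hp' f1.2 (fun j => (f2 j).2) f1.1 (fun j => (f3 j).2)
      (fun j => (f3 j).1) (sum_lineDeriv_perpGrad _)]
    refine (distLpNorm_sum_le hp _ _).trans ((Finset.sum_le_sum fun j _ =>
      (h₃ i k l _ _ (f3 j).2 (f2 j).2 (f3 j).2 (f2 j).1).trans (mul_le_mul_right
        (mul_le_mul' (h₁ k F j).2 (h₂ l G j).1) _)).trans (le_of_eq ?_))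
    simp
  rw [piece, FM_divDiv_first]
  refine (distLpNorm_sum_le hp _ _).trans ?_
  refine (Finset.sum_le_sum fun i _ => (h₄ i n _).1.trans (mul_le_mul_right (hA i) _)).trans ?_
  simp only [Finset.sum_const, Finset.card_univ, Fintype.card_fin, nsmul_eq_mul]
  rw [two_rpow_add]
  refine le_of_eq ?_
  push_cast
  rw [neg_one_mul]
  ring

end

/-! ### Convergence of series of distributions -/

/-- A series of distributions dominated by a continuous seminorm converges. -/
theorem summable_of_seminorm {ι : Type*} {u : ι → 𝓢'(Plane, ℂ)} {q : Seminorm ℂ 𝓢(Plane, ℂ)}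
    (hq : Continuous q) {B : ι → ℝ≥0∞} (hB : ∑' i, B i ≠ ∞)
    (h : ∀ i ψ, ‖u i ψ‖ₑ ≤ B i * ENNReal.ofReal (q ψ)) : Summable u := by
  have hfin : ∀ i, B i ≠ ∞ := ENNReal.ne_top_of_tsum_ne_top hB
  have hBs : Summable fun i => (B i).toReal := ENNReal.summable_toReal hB
  have hn : ∀ i ψ, ‖u i ψ‖ ≤ (B i).toReal * q ψ := fun i ψ => by
    have := ENNReal.toReal_mono (ENNReal.mul_ne_top (hfin i) ENNReal.ofReal_ne_top) (h i ψ)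
    rwa [toReal_enorm, ENNReal.toReal_mul, ENNReal.toReal_ofReal (apply_nonneg q ψ)] at this
  have hs : ∀ ψ, Summable fun i => u i ψ := fun ψ =>
    Summable.of_norm_bounded (hBs.mul_right (q ψ)) fun i => hn i ψ
  let L : 𝓢(Plane, ℂ) →ₗ[ℂ] ℂ :=
    { toFun := fun ψ => ∑' i, u i ψ
      map_add' := fun ψ χ => by simp_rw [map_add]; exact (hs ψ).tsum_add (hs χ)
      map_smul' := fun c ψ => by
        simp_rw [map_smul, smul_eq_mul, RingHom.id_apply]; exact (hs ψ).tsum_mul_left c }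
  have hL : ∀ ψ, ‖L ψ‖ ≤ (∑' i, (B i).toReal) * q ψ := fun ψ => by
    rw [← tsum_mul_right]
    exact tsum_of_norm_bounded (hBs.mul_right (q ψ)).hasSum fun i => hn i ψ
  have hLc : Continuous L := by
    refine continuous_of_continuousAt_zero L ?_
    have h0 : Filter.Tendsto (fun ψ => (∑' i, (B i).toReal) * q ψ) (nhds 0) (nhds 0) := by
      have : Continuous fun ψ => (∑' i, (B i).toReal) * q ψ := continuous_const.mul hq
      simpa using this.tendsto 0
    rw [ContinuousAt, map_zero]
    exact squeeze_zero_norm hL h0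
  let w : 𝓢'(Plane, ℂ) := ContinuousLinearMap.toPointwiseConvergenceCLM _ _ _ _ ⟨L, hLc⟩
  refine ⟨w, ?_⟩
  rw [HasSum, PointwiseConvergenceCLM.tendsto_iff_forall_tendsto]
  intro ψ
  have : HasSum (fun i => u i ψ) (w ψ) := (hs ψ).hasSum
  refine this.congr fun s => ?_
  rw [sum_apply]

/-- A series of distributions whose `L^p` norms are summable converges. -/
theorem summable_of_distLpNorm {p : ℝ≥0∞} (hp : 1 ≤ p) {ι : Type*} {u : ι → 𝓢'(Plane, ℂ)}
    (ht : ∑' i, distLpNorm p (u i) ≠ ∞) : Summable u := by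
  have : Fact (1 ≤ p) := ⟨hp⟩
  have hfin : ∀ i, distLpNorm p (u i) < ∞ := fun i =>
    (ENNReal.le_tsum i).trans_lt (lt_top_iff_ne_top.2 ht)
  choose g _ hg hug he using fun i => exists_rep_eq hp (hfin i)
  let f : ι → Lp ℂ p (volume : Measure Plane) := fun i => (hg i).toLp (g i)
  have hnorm : ∀ i, ‖f i‖ₑ = distLpNorm p (u i) := fun i => by
    rw [Lp.enorm_toLp, he]
  have hsum : Summable fun i => ‖f i‖ := by
    have : ∀ i, ‖f i‖ = (distLpNorm p (u i)).toReal := fun i => by rw [← hnorm, toReal_enorm]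
    simp_rw [this]
    exact ENNReal.summable_toReal ht
  have hS' := hsum.of_norm.hasSum.mapL (Lp.toTemperedDistributionCLM ℂ volume p)
  have hu : ∀ i, Lp.toTemperedDistributionCLM ℂ volume p (f i) = u i := fun i =>
    ((hug i).eq_toTemperedDistribution (hg i)).symm
  simp_rw [hu] at hS'
  exact hS'.summable

/-- The `L¹` norms of a Schwartz function and of its Laplacian. -/
theorem exists_testSeminorm : ∃ q : Seminorm ℂ 𝓢(Plane, ℂ), Continuous q ∧ ∀ ψ : 𝓢(Plane, ℂ),
    ∫⁻ x, ‖ψ x‖ₑ ≤ ENNReal.ofReal (q ψ) ∧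
    ∀ i : Fin 2, ∫⁻ x, ‖(∂_{e i} (∂_{e i} ψ) : 𝓢(Plane, ℂ)) x‖ₑ ≤ ENNReal.ofReal (q ψ) := by
  let T : 𝓢(Plane, ℂ) →L[ℂ] Lp ℂ 1 (volume : Measure Plane) := SchwartzMap.toLpCLM ℂ ℂ 1 volume
  let D : Fin 2 → 𝓢(Plane, ℂ) →L[ℂ] 𝓢(Plane, ℂ) := fun i =>
    LineDeriv.lineDerivOpCLM ℂ 𝓢(Plane, ℂ) (e i)
  let n : Seminorm ℂ (Lp ℂ 1 (volume : Measure Plane)) := normSeminorm ℂ _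
  have hT : ∀ ψ : 𝓢(Plane, ℂ), ∫⁻ x, ‖ψ x‖ₑ = ENNReal.ofReal (n (T ψ)) := fun ψ => by
    rw [← ofReal_integral_norm_eq_lintegral_enorm ψ.integrable, ← SchwartzMap.norm_toLp_one]
    rfl
  let q : Seminorm ℂ 𝓢(Plane, ℂ) := n.comp T.toLinearMap +
    ∑ i, n.comp (T ∘L D i ∘L D i).toLinearMap
  have hq : ∀ ψ, q ψ = n (T ψ) + ∑ i, n (T (D i (D i ψ))) := fun ψ => by
    simp only [q, add_apply, Seminorm.comp_apply, Fin.sum_univ_two]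
    rfl
  refine ⟨q, ?_, fun ψ => ⟨?_, fun i => ?_⟩⟩
  · have hn : Continuous n := continuous_norm
    rw [show (q : 𝓢(Plane, ℂ) → ℝ) = fun ψ => n (T ψ) + ∑ i, n (T (D i (D i ψ))) from funext hq]
    fun_prop
  · rw [hT, hq]
    exact ENNReal.ofReal_le_ofReal (le_add_of_nonneg_right
      (Finset.sum_nonneg fun i _ => apply_nonneg n _))
  · rw [hT, hq]
    refine ENNReal.ofReal_le_ofReal (le_add_of_nonneg_of_le (apply_nonneg n _) ?_)
    exact Finset.single_le_sum (f := fun i => n (T (D i (D i ψ))))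
      (fun i _ => apply_nonneg n _) (Finset.mem_univ i)

/-! ### Pairing a frequency-localized distribution with a test function. -/

section

variable (φ : DyadicPartition)

theorem rsym_one_mul {ξ : Plane} (hξ : ξ ≠ 0) :
    -(dsym 0 ξ * dsym 0 ξ + dsym 1 ξ * dsym 1 ξ) * rsym 1 ξ = 1 := by
  have h1 : ‖(2 * Real.pi) • ξ‖ ≠ 0 := norm_ne_zero_iff.2 (smul_ne_zero (by positivity) hξ)
  have h2 : ‖(2 * Real.pi) • ξ‖ ^ 2 = (2 * Real.pi) ^ 2 * (ξ 0 ^ 2 + ξ 1 ^ 2) := by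
    rw [EuclideanSpace.norm_sq_eq]
    simp [mul_pow]
    ring
  have h3 : rsym 1 ξ = (((‖(2 * Real.pi) • ξ‖ ^ 2)⁻¹ : ℝ) : ℂ) := by
    rw [rsym, show (-2 * 1 : ℝ) = -(2 : ℝ) by norm_num, Real.rpow_neg (norm_nonneg _),
      Real.rpow_two]
  have h4 : -(dsym 0 ξ * dsym 0 ξ + dsym 1 ξ * dsym 1 ξ) =
      ((‖(2 * Real.pi) • ξ‖ ^ 2 : ℝ) : ℂ) := by
    rw [h2, dsym, dsym]
    push_cast
    linear_combination (-(2 * Real.pi : ℂ) ^ 2 * ((ξ 0 : ℂ) ^ 2 + (ξ 1 : ℂ) ^ 2)) * Complex.I_sq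
  rw [h3, h4, ← Complex.ofReal_mul, mul_inv_cancel₀ (pow_ne_zero 2 h1), Complex.ofReal_one]

/-- A distribution of frequency about `2^n` is a second derivative. -/
theorem fat_eq_sum_lineDeriv (n : ℤ) (u : 𝓢'(Plane, ℂ)) :
    FM (windowed (fat φ 0) (fun _ => 1) n) u =
      -∑ i, ∂_{e i} (∂_{e i} (FM (windowed (fat φ 0) (rsym 1) n) u)) := by
  have hw := window_fat φ
  have hd := fun i => hasTemperateGrowth_dsym i
  simp only [lineDeriv_eq_FM, Fin.sum_univ_two]
  rw [FM_windowed hw homog_rsym_one (hd 0), FM_windowed hw homog_rsym_one (hd 1),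
    FM_windowed hw (homog_rsym_one.mul (homog_dsym 0)) (hd 0),
    FM_windowed hw (homog_rsym_one.mul (homog_dsym 1)) (hd 1)]
  have t0 := hw.hasTemperateGrowth ((homog_rsym_one.mul (homog_dsym 0)).mul (homog_dsym 0)) n
  have t1 := hw.hasTemperateGrowth ((homog_rsym_one.mul (homog_dsym 1)).mul (homog_dsym 1)) n
  have h1 := FM_const_mul (t0.add t1) (-1) u
  have h2 := TemperedDistribution.fourierMultiplierCLM_sum ℂ (s := Finset.univ)
    (g := ![windowed (fat φ 0) (fun ξ => rsym 1 ξ * dsym 0 ξ * dsym 0 ξ) n,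
      windowed (fat φ 0) (fun ξ => rsym 1 ξ * dsym 1 ξ * dsym 1 ξ) n])
    (fun i _ => by fin_cases i; exacts [t0, t1])
  simp only [Fin.sum_univ_two, Matrix.cons_val_zero, Matrix.cons_val_one] at h2
  rw [← neg_one_smul ℂ, ← add_apply, ← h2]
  refine Eq.trans ?_ h1
  congr 2
  funext ξ
  simp only [windowed, Pi.add_apply]
  by_cases hξ : ξ = 0
  · have : fat φ 0 0 = 0 := image_eq_zero_of_notMem_tsupport hw.zero
    simp [hξ, this]
  · linear_combination -(fat φ 0 ((2 : ℝ) ^ (-n) • ξ)) * rsym_one_mul hξ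

/-- The action of a distribution of frequency about `2^n` on a test function. -/
theorem exists_pairing_bound {p : ℝ≥0∞} (hp : 1 ≤ p) (hp' : p ≠ ∞) :
    ∃ (C : ℝ≥0∞) (q : Seminorm ℂ 𝓢(Plane, ℂ)), C ≠ ∞ ∧ Continuous q ∧
      ∀ (n : ℤ) (u : 𝓢'(Plane, ℂ)) (ψ : 𝓢(Plane, ℂ)),
        FM (windowed (fat φ 0) (fun _ => 1) n) u = u →
        ‖u ψ‖ₑ ≤ C * (2 ^ (-|(n : ℝ)|) * (2 ^ ((2 / p.toReal - 1) * (n : ℝ)) * distLpNorm p u)) *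
          ENNReal.ofReal (q ψ) := by
  obtain ⟨q, hq, hqb⟩ := exists_testSeminorm
  obtain ⟨C₁, -, hC₁, h₁⟩ := (window_fat φ).exists_bound homog_one hp hp'
  obtain ⟨C₂, -, hC₂, h₂⟩ := (window_fat φ).exists_bound homog_rsym_one hp hp'
  refine ⟨C₁ + 2 * C₂, q, ENNReal.add_ne_top.2 ⟨hC₁, ENNReal.mul_ne_top (by simp) hC₂⟩, hq,
    fun n u ψ hu => ?_⟩
  -- At high frequency `u = -Δ (-Δ)⁻¹ u`, and moving `Δ` to `ψ` gains `2^(-2n)` over Bernstein's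
  -- `2^(2n/p)`. At low frequency Bernstein alone gives `2^(2n/p) = 2^n 2^((2/p-1)n)`.
  rcases le_total 0 n with hn | hn
  · have e1 : u ψ = -∑ i : Fin 2, FM (windowed (fat φ 0) (rsym 1) n) u (∂_{e i} (∂_{e i} ψ)) := by
      conv_lhs => rw [← hu, fat_eq_sum_lineDeriv]
      simp only [Fin.sum_univ_two, neg_apply, add_apply,
        TemperedDistribution.lineDerivOp_apply_apply, LineDeriv.lineDerivOp_neg, neg_neg]
    have hx : (2 : ℝ≥0∞) ^ (-|(n : ℝ)|) * 2 ^ ((2 / p.toReal - 1) * (n : ℝ)) =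
        2 ^ ((((-2 : ℤ) : ℝ) + 2 / p.toReal) * (n : ℝ)) := by
      rw [← two_rpow_add, abs_of_nonneg (by exact_mod_cast hn)]
      congr 1; push_cast; ring
    have hb := (h₂ n u).2.1
    rw [← hx] at hb
    rw [e1, enorm_neg]
    refine (enorm_sum_le _ _).trans ((Finset.sum_le_sum fun i _ => (enorm_apply_le _).trans
      (mul_le_mul' hb ((hqb ψ).2 i))).trans ?_)
    rw [Finset.sum_const, Finset.card_univ, Fintype.card_fin, nsmul_eq_mul, ← mul_assoc]
    refine mul_le_mul' ?_ le_rfl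
    calc _ = 2 * C₂ * (2 ^ (-|(n : ℝ)|) * (2 ^ ((2 / p.toReal - 1) * (n : ℝ)) *
          distLpNorm p u)) := by push_cast; ring
      _ ≤ _ := by gcongr; exact le_add_self
  · have hx : (2 : ℝ≥0∞) ^ (-|(n : ℝ)|) * 2 ^ ((2 / p.toReal - 1) * (n : ℝ)) =
        2 ^ ((((0 : ℤ) : ℝ) + 2 / p.toReal) * (n : ℝ)) := by
      rw [← two_rpow_add, abs_of_nonpos (by exact_mod_cast hn)]
      congr 1; push_cast; ring
    have hb := (h₁ n u).2.1
    rw [← hx, hu] at hb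
    refine (enorm_apply_le _).trans (mul_le_mul' (hb.trans ?_) (hqb ψ).1)
    calc _ = C₁ * (2 ^ (-|(n : ℝ)|) * (2 ^ ((2 / p.toReal - 1) * (n : ℝ)) *
          distLpNorm p u)) := by ring
      _ ≤ _ := by gcongr; exact le_self_add

/-! ### Almost orthogonality in `L²` -/

theorem enorm_cutoff_sq_le (j : ℤ) (ξ : Plane) : ‖φ.cutoff j ξ‖ₑ ^ 2 ≤ ENNReal.ofReal
    (φ.χ ((2 : ℝ) ^ (-j) • ((2 * Real.pi) • ξ))) := by
  have h0 := φ.nonneg ((2 : ℝ) ^ (-j) • ((2 * Real.pi) • ξ))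
  have h1 := φ.le_one ((2 : ℝ) ^ (-j) • ((2 * Real.pi) • ξ))
  rw [← ofReal_norm, DyadicPartition.cutoff, Complex.norm_real, Real.norm_of_nonneg h0,
    ← ENNReal.ofReal_pow h0]
  exact ENNReal.ofReal_le_ofReal (by nlinarith)

theorem tsum_enorm_cutoff_sq_le (ξ : Plane) : ∑' j, ‖φ.cutoff j ξ‖ₑ ^ 2 ≤ 1 := by
  by_cases hξ : ξ = 0
  · have : ∀ j, φ.cutoff j ξ = 0 := fun j => by
      rw [hξ]; exact image_eq_zero_of_notMem_tsupport (cutoff_support φ j)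
    simp [this]
  · have h := φ.hasSum_one ((2 * Real.pi) • ξ) (smul_ne_zero (by positivity) hξ)
    refine (ENNReal.tsum_le_tsum fun j => enorm_cutoff_sq_le φ j ξ).trans ?_
    rw [← ENNReal.ofReal_tsum_of_nonneg (fun j => φ.nonneg _) h.summable, h.tsum_eq,
      ENNReal.ofReal_one]

/-- Plancherel turns the blocks into products with the cutoffs, whose squares sum to at most 1
because the cutoffs lie in `[0, 1]` and sum to at most 1. -/
theorem tsum_block_two_le (F : 𝓢'(Plane, ℂ)) :
    ∑' j, distLpNorm 2 (block φ j F) ^ 2 ≤ distLpNorm 2 F ^ 2 := by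
  by_cases hF : distLpNorm 2 F = ∞
  · rw [hF]; simp
  obtain ⟨g, -, hg, hFg, he⟩ := exists_rep_eq one_le_two (lt_top_iff_ne_top.2 hF)
  let f : Lp ℂ 2 (volume : Measure Plane) := hg.toLp g
  have hf : F = Lp.toTemperedDistribution f := hFg.eq_toTemperedDistribution hg
  have hfn : ‖f‖ₑ = distLpNorm 2 F := by rw [Lp.enorm_toLp, he]
  let fh : Lp ℂ 2 (volume : Measure Plane) := 𝓕 f
  have hfh : ‖fh‖ₑ = ‖f‖ₑ := by
    rw [← ofReal_norm, ← ofReal_norm, Lp.norm_fourier_eq]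
  have hsq : ∀ h : Lp ℂ 2 (volume : Measure Plane), ‖h‖ₑ ^ 2 = ∫⁻ x, ‖h x‖ₑ ^ 2 := fun h => by
    rw [Lp.enorm_def, eLpNorm_eq_lintegral_rpow_enorm_toReal (by simp) (by simp)]
    rw [← ENNReal.rpow_natCast, ← ENNReal.rpow_mul]
    simp
  have hb : ∀ j, distLpNorm 2 (block φ j F) ^ 2 ≤ ∫⁻ x, ‖φ.cutoff j x‖ₑ ^ 2 * ‖fh x‖ₑ ^ 2 := by
    intro j
    have hm : MemLp (φ.cutoff j) ∞ (volume : Measure Plane) :=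
      memLp_top_of_bounded (contDiff_cutoff φ j).continuous.measurable (B := 1) fun ξ => by
        rw [DyadicPartition.cutoff, Complex.norm_real, Real.norm_of_nonneg (φ.nonneg _)]
        exact φ.le_one _
    let h : Lp ℂ 2 (volume : Measure Plane) := (hm.toLp _) • fh
    have h1 : block φ j F = Lp.toTemperedDistribution (𝓕⁻ h : Lp ℂ 2 (volume : Measure Plane)) := by
      rw [← Lp.fourierInv_toTemperedDistribution_eq,
        Lp.toTemperedDistribution_smul_eq (hasTemperateGrowth_cutoff φ j) hm,
        ← Lp.fourier_toTemperedDistribution_eq, ← hf]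
      rfl
    have h2 : ‖(𝓕⁻ h : Lp ℂ 2 (volume : Measure Plane))‖ₑ = ‖h‖ₑ := by
      rw [← ofReal_norm, ← ofReal_norm, ← Lp.norm_fourier_eq,
        FourierTransform.fourier_fourierInv_eq]
    have h3 : distLpNorm 2 (block φ j F) ≤ ‖h‖ₑ := by
      rw [h1, ← h2, Lp.enorm_def]
      exact distLpNorm_le (rep_toTemperedDistribution _) (Lp.memLp _)
    refine (pow_le_pow_left₀ zero_le h3 2).trans (le_of_eq ?_)
    rw [hsq]
    refine lintegral_congr_ae ?_
    filter_upwards [Lp.coeFn_lpSMul (r := 2) (hm.toLp _) fh, hm.coeFn_toLp] with x hx hx'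
    rw [hx, Pi.smul_apply', hx', smul_eq_mul, enorm_mul, mul_pow]
  refine (ENNReal.tsum_le_tsum hb).trans ?_
  have hmeas : ∀ j, AEMeasurable (fun x => ‖φ.cutoff j x‖ₑ ^ 2 * ‖fh x‖ₑ ^ 2) volume := fun j =>
    (((contDiff_cutoff φ j).continuous.measurable.enorm).pow_const 2).aemeasurable.mul
      ((Lp.aestronglyMeasurable fh).enorm.pow_const 2)
  rw [← lintegral_tsum hmeas, ← hfn, ← hfh, hsq]
  refine lintegral_mono fun x => ?_
  rw [ENNReal.tsum_mul_right]
  exact mul_le_of_le_one_left zero_le (tsum_enorm_cutoff_sq_le φ x)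

end

/-! ### Decay of the interactions -/

/-- Reduces each weighted estimate to a linear inequality between exponents of 2: `M` is a bounded
loss and `w` the logarithm of the decay. -/
theorem weight_le {N C A B : ℝ≥0∞} {s n x k l M w : ℝ} (hN : N ≤ C * 2 ^ x * (A * B))
    (hx : s * n + x ≤ M + w + s * k + s * l) :
    2 ^ (s * n) * N ≤ C * 2 ^ M * 2 ^ w * ((2 ^ (s * k) * A) * (2 ^ (s * l) * B)) := by
  calc 2 ^ (s * n) * N ≤ 2 ^ (s * n) * (C * 2 ^ x * (A * B)) := by gcongr
    _ = C * 2 ^ (s * n + x) * (A * B) := by rw [two_rpow_add]; ring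
    _ ≤ C * 2 ^ (M + w + s * k + s * l) * (A * B) := by
      gcongr
      exact one_le_two
    _ = _ := by rw [two_rpow_add, two_rpow_add, two_rpow_add]; ring

theorem mul_le_of_abs_le {s D c : ℝ} (hs : |s| ≤ 1) (hD : |D| ≤ c) : s * D ≤ c := by
  refine (le_abs_self _).trans ?_
  rw [abs_mul]
  nlinarith [abs_nonneg s, abs_nonneg D]

/-- The geometric weight `2^(-δ |m|)`. -/
def wt (δ : ℝ) (m : ℤ) : ℝ≥0∞ := 2 ^ (-δ * |(m : ℝ)|)

theorem wt_mul_wt (δ : ℝ) (m n : ℤ) : wt δ m * wt δ n = 2 ^ (-δ * |(m : ℝ)| + -δ * |(n : ℝ)|) :=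
  (two_rpow_add _ _).symm

section

variable (φ : DyadicPartition) {p : ℝ≥0∞} (hp : 1 ≤ p) (hp' : p ≠ ∞)

include hp hp'

theorem two_div_toReal_mem : 0 < 2 / p.toReal ∧ 2 / p.toReal ≤ 2 := by
  have hp1 : 1 ≤ p.toReal := by
    rwa [← ENNReal.toReal_one, ENNReal.toReal_le_toReal ENNReal.one_ne_top hp']
  exact ⟨by positivity, div_le_self two_pos.le hp1⟩

/-- Separated frequencies. -/
theorem exists_decay_separated {δ : ℝ} (hδ : 0 ≤ δ) (hδ' : δ ≤ 1 / 2) :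
    ∃ C : ℝ≥0∞, C ≠ ∞ ∧ ∀ (k l n : ℤ) (F G : 𝓢'(Plane, ℂ)),
    distLpNorm p (block φ k F) < ∞ → distLpNorm p (block φ l G) < ∞ → 8 ≤ |k - l| →
    2 ^ ((2 / p.toReal - 1) * (n : ℝ)) * distLpNorm p (piece φ k l F G n) ≤
      C * (wt δ (k - l) * wt δ (n - k)) *
        ((2 ^ ((2 / p.toReal - 1) * (k : ℝ)) * distLpNorm p (block φ k F)) *
          (2 ^ ((2 / p.toReal - 1) * (l : ℝ)) * distLpNorm p (block φ l G))) := by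
  obtain ⟨C₁, hC₁, h₁⟩ := exists_piece_bound φ hp hp'
  obtain ⟨C₂, hC₂, h₂⟩ := exists_piece_bound_leibniz φ hp hp'
  obtain ⟨t0, t2⟩ := two_div_toReal_mem hp hp'
  set t := 2 / p.toReal with ht
  -- The power 13 absorbs the shifts of size at most 5 between `n` and `max k l`, with room to
  -- spare.
  refine ⟨(C₁ + C₂) * 2 ^ (13 : ℝ), ENNReal.mul_ne_top (ENNReal.add_ne_top.2 ⟨hC₁, hC₂⟩)
    (two_rpow_ne_top _), fun k l n F G hF hG hkl => ?_⟩
  rw [wt_mul_wt]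
  by_cases hn : max k l + 6 ≤ n ∨ n ≤ max k l - 6
  · rw [piece_eq_zero φ hp hp' hF hG (hn.imp_right fun h => ⟨hkl, h⟩), distLpNorm_zero, mul_zero]
    exact zero_le
  have hs : |t - 1| ≤ 1 := abs_le.2 ⟨by linarith, by linarith⟩
  rcases le_total k l with h | h
  · have hmax : max k l = l := max_eq_right h
    have e1 : |((k - l : ℤ) : ℝ)| = l - k := by
      rw [abs_of_nonpos (by exact_mod_cast sub_nonpos.2 h)]; push_cast; ring
    have b1 : (n : ℝ) - l ≤ 5 := by exact_mod_cast (by omega : n - l ≤ 5)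
    have b2 : -5 ≤ (n : ℝ) - l := by exact_mod_cast (by omega : -5 ≤ n - l)
    have b3 : (8 : ℝ) ≤ l - k := by
      rw [abs_of_nonpos (by omega)] at hkl
      exact_mod_cast (by omega : 8 ≤ l - k)
    have e2 : |((n - k : ℤ) : ℝ)| = n - k := by
      rw [abs_of_nonneg (by push_cast; linarith)]; push_cast; ring
    have hb := mul_le_of_abs_le hs (D := (n : ℝ) - l) (c := 5) (abs_le.2 ⟨b2, b1⟩)
    -- The Leibniz bound leaves the exponent `s(n-l) - (n-k) ≤ 5 - (n-k)`. As `n - k ≥ l - k - 5`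
    -- and `δ ≤ 1/2`, this pays for both weights.
    refine weight_le ((h₂ k l n F G hF hG).trans (by gcongr; exact le_add_self)) ?_
    rw [e1, e2]
    nlinarith
  · have hmax : max k l = k := max_eq_left h
    have e1 : |((k - l : ℤ) : ℝ)| = k - l := by
      rw [abs_of_nonneg (by exact_mod_cast sub_nonneg.2 h)]; push_cast; ring
    have b1 : (n : ℝ) - k ≤ 5 := by exact_mod_cast (by omega : n - k ≤ 5)
    have b2 : -5 ≤ (n : ℝ) - k := by exact_mod_cast (by omega : -5 ≤ n - k)
    have b3 : (8 : ℝ) ≤ k - l := by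
      rw [abs_of_nonneg (by omega)] at hkl
      exact_mod_cast (by omega : 8 ≤ k - l)
    have e2 : |((n - k : ℤ) : ℝ)| ≤ 5 := by push_cast; exact abs_le.2 ⟨b2, b1⟩
    have hb := mul_le_of_abs_le hs (D := (n : ℝ) - k) (c := 5) (abs_le.2 ⟨b2, b1⟩)
    -- The exponent left is `s(n-k) - (k-l)`, where `|n - k| ≤ 5`.
    refine weight_le ((h₁ k l n F G hF hG).trans (by gcongr; exact le_self_add)) ?_
    rw [e1]
    have := abs_nonneg ((n - k : ℤ) : ℝ)
    nlinarith

omit hp hp' in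
theorem holderTriple_half (hp2 : 2 ≤ p) (hp' : p ≠ ∞) :
    p.HolderTriple p (p / 2) ∧ 1 ≤ p / 2 ∧ p / 2 ≠ ∞ ∧ p = 2 * (p / 2) := by
  have h2 : p = 2 * (p / 2) := (ENNReal.mul_div_cancel two_ne_zero ENNReal.ofNat_ne_top).symm
  have h0 : p ≠ 0 := (two_pos.trans_le hp2).ne'
  refine ⟨⟨?_⟩, ?_, ENNReal.div_ne_top hp' two_ne_zero, h2⟩
  · rw [ENNReal.inv_div (Or.inr hp') (Or.inr h0), ENNReal.div_eq_inv_mul, ← two_mul, mul_comm]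
  · rw [ENNReal.le_div_iff_mul_le (by simp) (by simp), one_mul]
    exact hp2

/-- Comparable frequencies, `p ≥ 2`. -/
theorem exists_decay_comparable_half (hp2 : 2 ≤ p) {δ : ℝ} (hδ : 0 ≤ δ)
    (hδ' : δ ≤ 1 / 2) (hδt : δ ≤ 4 / p.toReal - 1) :
    ∃ C : ℝ≥0∞, C ≠ ∞ ∧ ∀ (k l n : ℤ) (F G : 𝓢'(Plane, ℂ)),
    distLpNorm p (block φ k F) < ∞ → distLpNorm p (block φ l G) < ∞ → |k - l| ≤ 7 →
    2 ^ ((2 / p.toReal - 1) * (n : ℝ)) * distLpNorm p (piece φ k l F G n) ≤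
      C * (wt δ (k - l) * wt δ (n - k)) *
        ((2 ^ ((2 / p.toReal - 1) * (k : ℝ)) * distLpNorm p (block φ k F)) *
          (2 ^ ((2 / p.toReal - 1) * (l : ℝ)) * distLpNorm p (block φ l G))) := by
  obtain ⟨hH, hr1, hr2, hr3⟩ := holderTriple_half hp2 hp'
  obtain ⟨C₁, hC₁, h₁⟩ := exists_piece_bound_half φ hp hp' hr1 hr2 hr3
  obtain ⟨t0, t2⟩ := two_div_toReal_mem hp hp'
  have ht' : 4 / p.toReal = 2 * (2 / p.toReal) := by ring
  have hp2' : 2 ≤ p.toReal := by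
    rw [← ENNReal.toReal_ofNat, ENNReal.toReal_le_toReal ENNReal.ofNat_ne_top hp']; exact hp2
  have t1 : 2 / p.toReal ≤ 1 := by rw [div_le_one (by linarith)]; exact hp2'
  rw [ht'] at hδt
  set t := 2 / p.toReal with ht
  refine ⟨C₁ * 2 ^ (60 : ℝ), ENNReal.mul_ne_top hC₁ (two_rpow_ne_top _),
    fun k l n F G hF hG hkl => ?_⟩
  rw [wt_mul_wt]
  by_cases hn : max k l + 6 ≤ n
  · rw [piece_eq_zero φ hp hp' hF hG (Or.inl hn), distLpNorm_zero, mul_zero]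
    exact zero_le
  rw [abs_le] at hkl
  have b1 : (n : ℝ) - k ≤ 12 := by exact_mod_cast (by omega : n - k ≤ 12)
  have b2 : (k : ℝ) - l ≤ 7 := by exact_mod_cast hkl.2
  have b3 : -7 ≤ (k : ℝ) - l := by exact_mod_cast hkl.1
  have e1 : |((k - l : ℤ) : ℝ)| ≤ 7 := by push_cast; exact abs_le.2 ⟨b3, b2⟩
  have hs : |t - 1| ≤ 1 := abs_le.2 ⟨by linarith, by linarith⟩
  have hb := mul_le_of_abs_le hs (D := (k : ℝ) - l) (c := 7) (abs_le.2 ⟨b3, b2⟩)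
  refine weight_le (h₁ k l n F G hF hG) ?_
  have e3 := abs_nonneg ((k - l : ℤ) : ℝ)
  have e4 : ((n - k : ℤ) : ℝ) = n - k := by push_cast; ring
  rw [e4]
  -- The exponent left is `(2t-1)(n-k) + s(k-l)`. For `n ≥ k` it is bounded since `n - k ≤ 12`; for
  -- `n ≤ k` the condition `δ ≤ 2t - 1` gives the decay.
  have key : (2 * t - 1) * ((n : ℝ) - k) + δ * |(n : ℝ) - k| ≤ 24 := by
    rcases le_total 0 ((n : ℝ) - k) with h | h
    · rw [abs_of_nonneg h]; nlinarith
    · rw [abs_of_nonpos h]; nlinarith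
  nlinarith

/-- Comparable frequencies, `p < 2`. -/
theorem exists_decay_comparable_one {δ : ℝ} (hδ : 0 ≤ δ)
    (hδ' : δ ≤ 1 / 2) (hδt : δ ≤ 2 / p.toReal - 1) :
    ∃ C : ℝ≥0∞, C ≠ ∞ ∧ ∀ (k l n : ℤ) (F G : 𝓢'(Plane, ℂ)),
    distLpNorm p (block φ k F) < ∞ → distLpNorm p (block φ l G) < ∞ → |k - l| ≤ 7 →
    2 ^ ((2 / p.toReal - 1) * (n : ℝ)) * distLpNorm p (piece φ k l F G n) ≤
      C * (wt δ (k - l) * wt δ (n - k)) *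
        ((2 ^ ((2 / p.toReal - 1) * (k : ℝ)) * distLpNorm p (block φ k F)) *
          (2 ^ ((2 / p.toReal - 1) * (l : ℝ)) * distLpNorm p (block φ l G))) := by
  obtain ⟨C₁, hC₁, h₁⟩ := exists_piece_bound φ hp hp'
  obtain ⟨t0, t2⟩ := two_div_toReal_mem hp hp'
  set t := 2 / p.toReal with ht
  refine ⟨C₁ * 2 ^ (60 : ℝ), ENNReal.mul_ne_top hC₁ (two_rpow_ne_top _),
    fun k l n F G hF hG hkl => ?_⟩
  rw [wt_mul_wt]
  by_cases hn : max k l + 6 ≤ n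
  · rw [piece_eq_zero φ hp hp' hF hG (Or.inl hn), distLpNorm_zero, mul_zero]
    exact zero_le
  rw [abs_le] at hkl
  have b1 : (n : ℝ) - k ≤ 12 := by exact_mod_cast (by omega : n - k ≤ 12)
  have b2 : (k : ℝ) - l ≤ 7 := by exact_mod_cast hkl.2
  have b3 : -7 ≤ (k : ℝ) - l := by exact_mod_cast hkl.1
  have e1 : |((k - l : ℤ) : ℝ)| ≤ 7 := by push_cast; exact abs_le.2 ⟨b3, b2⟩
  refine weight_le (h₁ k l n F G hF hG) ?_
  have e3 := abs_nonneg ((k - l : ℤ) : ℝ)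
  have e4 : ((n - k : ℤ) : ℝ) = n - k := by push_cast; ring
  rw [e4]
  -- The exponent left is `s(n-k) - (k-l)`, and `δ ≤ s` gives the decay for `n ≤ k`.
  have key : (t - 1) * ((n : ℝ) - k) + δ * |(n : ℝ) - k| ≤ 24 := by
    rcases le_total 0 ((n : ℝ) - k) with h | h
    · rw [abs_of_nonneg h]; nlinarith
    · rw [abs_of_nonpos h]; nlinarith
  nlinarith

omit hp' in
/-- All pairs of frequencies, `p < 4`. -/
theorem exists_decay_subcritical (hp4 : p < 4) : ∃ δ : ℝ, 0 < δ ∧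
    ∃ C : ℝ≥0∞, C ≠ ∞ ∧ ∀ (k l n : ℤ) (F G : 𝓢'(Plane, ℂ)),
    distLpNorm p (block φ k F) < ∞ → distLpNorm p (block φ l G) < ∞ →
    2 ^ ((2 / p.toReal - 1) * (n : ℝ)) * distLpNorm p (piece φ k l F G n) ≤
      C * (wt δ (k - l) * wt δ (n - k)) *
        ((2 ^ ((2 / p.toReal - 1) * (k : ℝ)) * distLpNorm p (block φ k F)) *
          (2 ^ ((2 / p.toReal - 1) * (l : ℝ)) * distLpNorm p (block φ l G))) := by
  have hp' : p ≠ ∞ := hp4.ne_top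
  have hpr : p.toReal < 4 := by
    rw [← ENNReal.toReal_ofNat, ENNReal.toReal_lt_toReal hp' ENNReal.ofNat_ne_top]; exact hp4
  have hpos : 0 < p.toReal := ENNReal.toReal_pos (zero_lt_one.trans_le hp).ne' hp'
  have hcomp : ∃ δ : ℝ, 0 < δ ∧ δ ≤ 1 / 2 ∧ ∃ C : ℝ≥0∞, C ≠ ∞ ∧
      ∀ (k l n : ℤ) (F G : 𝓢'(Plane, ℂ)),
      distLpNorm p (block φ k F) < ∞ → distLpNorm p (block φ l G) < ∞ → |k - l| ≤ 7 →
      2 ^ ((2 / p.toReal - 1) * (n : ℝ)) * distLpNorm p (piece φ k l F G n) ≤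
        C * (wt δ (k - l) * wt δ (n - k)) *
          ((2 ^ ((2 / p.toReal - 1) * (k : ℝ)) * distLpNorm p (block φ k F)) *
            (2 ^ ((2 / p.toReal - 1) * (l : ℝ)) * distLpNorm p (block φ l G))) := by
    -- The space `L^(p/2)` is available only for `p ≥ 2`; for `p < 2` the regularity `s` is itself
    -- positive and the first bound decays.
    rcases le_or_gt 2 p with h2 | h2
    · have h0 : 0 < 4 / p.toReal - 1 := by rw [sub_pos, lt_div_iff₀ hpos]; linarith
      exact ⟨min (1 / 2) (4 / p.toReal - 1), lt_min (by norm_num) h0, min_le_left _ _,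
        exists_decay_comparable_half φ hp hp' h2 (le_min (by norm_num) h0.le)
          (min_le_left _ _) (min_le_right _ _)⟩
    · have hpr2 : p.toReal < 2 := by
        rw [← ENNReal.toReal_ofNat, ENNReal.toReal_lt_toReal hp' ENNReal.ofNat_ne_top]; exact h2
      have h0 : 0 < 2 / p.toReal - 1 := by rw [sub_pos, lt_div_iff₀ hpos]; linarith
      exact ⟨min (1 / 2) (2 / p.toReal - 1), lt_min (by norm_num) h0, min_le_left _ _,
        exists_decay_comparable_one φ hp hp' (le_min (by norm_num) h0.le)
          (min_le_left _ _) (min_le_right _ _)⟩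
  obtain ⟨δ, hδ, hδ', C₁, hC₁, h₁⟩ := hcomp
  obtain ⟨C₂, hC₂, h₂⟩ := exists_decay_separated φ hp hp' hδ.le hδ'
  refine ⟨δ, hδ, C₁ + C₂, ENNReal.add_ne_top.2 ⟨hC₁, hC₂⟩, fun k l n F G hF hG => ?_⟩
  rcases le_or_gt (|k - l|) 7 with h | h
  · refine (h₁ k l n F G hF hG h).trans ?_
    gcongr
    exact le_self_add
  · refine (h₂ k l n F G hF hG h).trans ?_
    gcongr
    exact le_add_self

end

/-! ### Sequences -/

theorem tsum_wt_ne_top {δ : ℝ} (hδ : 0 < δ) : ∑' m, wt δ m ≠ ∞ := by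
  have h1 : ∀ m, wt δ m = ENNReal.ofReal ((2 : ℝ) ^ (-δ * |(m : ℝ)|)) := fun m => by
    rw [wt, ← ENNReal.ofReal_rpow_of_pos two_pos, ENNReal.ofReal_ofNat]
  have hr : (2 : ℝ) ^ (-δ) < 1 := Real.rpow_lt_one_of_one_lt_of_neg one_lt_two (by linarith)
  have hg := summable_geometric_of_lt_one (by positivity) hr
  have h2 : ∀ n : ℕ, (2 : ℝ) ^ (-δ * |((n : ℤ) : ℝ)|) = ((2 : ℝ) ^ (-δ)) ^ n := fun n => by
    rw [Int.cast_natCast, abs_of_nonneg (by positivity), Real.rpow_mul two_pos.le,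
      Real.rpow_natCast]
  have h3 : ∀ n : ℕ, (2 : ℝ) ^ (-δ * |((-(n : ℤ) : ℤ) : ℝ)|) = ((2 : ℝ) ^ (-δ)) ^ n := fun n => by
    rw [Int.cast_neg, abs_neg, h2]
  have hs : Summable fun m : ℤ => (2 : ℝ) ^ (-δ * |(m : ℝ)|) :=
    Summable.of_nat_of_neg (by simp_rw [h2]; exact hg) (by simp_rw [h3]; exact hg)
  simp_rw [h1]
  exact hs.tsum_ofReal_ne_top

theorem tsum_wt_sub (δ : ℝ) (k : ℤ) : ∑' l, wt δ (k - l) = ∑' m, wt δ m :=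
  (Equiv.subLeft k).tsum_eq (wt δ)

theorem seqNorm_top (a : ℤ → ℝ≥0∞) : seqNorm ∞ a = ⨆ j, a j := if_pos rfl

theorem seqNorm_of_ne_top {q : ℝ≥0∞} (hq : q ≠ ∞) (a : ℤ → ℝ≥0∞) :
    seqNorm q a = (∑' j, a j ^ q.toReal) ^ (1 / q.toReal) := if_neg hq

theorem le_seqNorm {q : ℝ≥0∞} (hq : 1 ≤ q) (a : ℤ → ℝ≥0∞) (j : ℤ) : a j ≤ seqNorm q a := by
  by_cases h : q = ∞
  · rw [h, seqNorm_top]; exact le_iSup a j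
  have h0 : 0 < q.toReal := ENNReal.toReal_pos (zero_lt_one.trans_le hq).ne' h
  rw [seqNorm_of_ne_top h, one_div, ENNReal.le_rpow_inv_iff h0]
  exact ENNReal.le_tsum j

theorem seqNorm_mono {q : ℝ≥0∞} {a b : ℤ → ℝ≥0∞} (h : ∀ j, a j ≤ b j) :
    seqNorm q a ≤ seqNorm q b := by
  by_cases hq : q = ∞
  · rw [hq, seqNorm_top, seqNorm_top]; exact iSup_mono h
  rw [seqNorm_of_ne_top hq, seqNorm_of_ne_top hq]
  gcongr with j
  exact h j

theorem seqNorm_const_mul {q : ℝ≥0∞} (hq : 1 ≤ q) (c : ℝ≥0∞) (a : ℤ → ℝ≥0∞) :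
    seqNorm q (fun j => c * a j) = c * seqNorm q a := by
  by_cases h : q = ∞
  · rw [h, seqNorm_top, seqNorm_top, ENNReal.mul_iSup]
  have h0 : 0 < q.toReal := ENNReal.toReal_pos (zero_lt_one.trans_le hq).ne' h
  rw [seqNorm_of_ne_top h, seqNorm_of_ne_top h]
  simp_rw [ENNReal.mul_rpow_of_nonneg _ _ h0.le]
  rw [ENNReal.tsum_mul_left, ENNReal.mul_rpow_of_nonneg _ _ (by positivity), ← ENNReal.rpow_mul,
    mul_one_div_cancel h0.ne', ENNReal.rpow_one]

theorem seqNorm_eq_eLpNorm {q : ℝ≥0∞} (hq : 1 ≤ q) (hq' : q ≠ ∞) (a : ℤ → ℝ≥0∞) :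
    seqNorm q a = eLpNorm a q Measure.count := by
  rw [seqNorm_of_ne_top hq', eLpNorm_eq_lintegral_rpow_enorm_toReal (zero_lt_one.trans_le hq).ne' hq',
    lintegral_count]
  simp

theorem seqNorm_add_le {q : ℝ≥0∞} (hq : 1 ≤ q) (hq' : q ≠ ∞) (a b : ℤ → ℝ≥0∞) :
    seqNorm q (fun j => a j + b j) ≤ seqNorm q a + seqNorm q b := by
  simp_rw [seqNorm_eq_eLpNorm hq hq']
  exact eLpNorm_add_le (Measurable.of_discrete.aestronglyMeasurable)
    (Measurable.of_discrete.aestronglyMeasurable) hq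

theorem seqNorm_sum_le {q : ℝ≥0∞} (hq : 1 ≤ q) (hq' : q ≠ ∞) {ι : Type*} (s : Finset ι)
    (a : ι → ℤ → ℝ≥0∞) :
    seqNorm q (fun j => ∑ i ∈ s, a i j) ≤ ∑ i ∈ s, seqNorm q (a i) := by
  classical
  induction s using Finset.induction_on with
  | empty =>
    have h0 : 0 < q.toReal := ENNReal.toReal_pos (zero_lt_one.trans_le hq).ne' hq'
    simp [seqNorm_of_ne_top hq', h0]
  | insert i s hi ih =>
    simp_rw [Finset.sum_insert hi]
    exact (seqNorm_add_le hq hq' _ _).trans (by gcongr)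

/-- Young's inequality. -/
theorem seqNorm_conv_le {q : ℝ≥0∞} (hq : 1 ≤ q) (w a : ℤ → ℝ≥0∞) :
    seqNorm q (fun n => ∑' k, w (n - k) * a k) ≤ (∑' m, w m) * seqNorm q a := by
  have hshift : ∀ n, ∑' k, w (n - k) * a k = ∑' m, w m * a (n - m) := fun n => by
    rw [← (Equiv.subLeft n).tsum_eq fun m => w m * a (n - m)]
    simp
  simp_rw [hshift]
  by_cases h : q = ∞
  · rw [h, seqNorm_top, seqNorm_top]
    refine iSup_le fun n => ?_
    rw [← ENNReal.tsum_mul_right]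
    gcongr with m
    exact le_iSup a (n - m)
  have h1 : 1 ≤ q.toReal := by
    rwa [← ENNReal.toReal_one, ENNReal.toReal_le_toReal ENNReal.one_ne_top h]
  have h0 : 0 < q.toReal := by linarith
  -- Young's inequality is Minkowski's for the translates of `a` averaged against `w`.
  let ν : Measure ℤ := Measure.count.withDensity w
  have hν : ∀ f : ℤ → ℝ≥0∞, ∫⁻ m, f m ∂ν = ∑' m, w m * f m := fun f => by
    rw [lintegral_withDensity_eq_lintegral_mul _ Measurable.of_discrete Measurable.of_discrete,
      lintegral_count]
    rfl
  have hν1 : ν Set.univ = ∑' m, w m := by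
    rw [← lintegral_one, hν]; simp
  have key := lintegral_rpow_lintegral_le (Measure.count : Measure ℤ) ν h1
    (F := fun n m => a (n - m)) Measurable.of_discrete (M := seqNorm q a) (fun m => by
      rw [lintegral_count, seqNorm_of_ne_top h, ← ENNReal.rpow_mul, one_div_mul_cancel h0.ne',
        ENNReal.rpow_one]
      exact ((Equiv.subRight m).tsum_eq fun n => a n ^ q.toReal).le)
  simp_rw [hν, lintegral_count, hν1] at key
  rwa [seqNorm_of_ne_top h, one_div, ENNReal.rpow_inv_le_iff h0]

/-! ### The bilinear operator -/

section

variable (φ : DyadicPartition) {p : ℝ≥0∞} (hp : 1 ≤ p) (hp' : p ≠ ∞)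

theorem FM_comm {g₁ g₂ : Plane → ℂ} (h₁ : g₁.HasTemperateGrowth) (h₂ : g₂.HasTemperateGrowth)
    (u : 𝓢'(Plane, ℂ)) : FM g₂ (FM g₁ u) = FM g₁ (FM g₂ u) := by
  rw [FM_FM h₁ h₂, FM_FM h₂ h₁]
  simp_rw [mul_comm]

/-- Only the cutoffs adjacent to `n` meet `φ̂_n`, and together they equal 1 there. Hence the `n`-th
block of `σ(D) X` is the `n`-th term of its defining series, so the pieces really are the blocks of
`B`. -/
theorem hasSum_block {d : ℤ} {σ : Plane → ℂ} (hσ : Homog d σ) (n : ℤ) (X : 𝓢'(Plane, ℂ)) :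
    HasSum (fun j => block φ n (FM (windowed (φ.cutoff 0) σ j) X))
      (FM (windowed (φ.cutoff 0) σ n) X) := by
  have h := isHomMultiplier_block φ hσ n X
  have ht := hasTemperateGrowth_cutoff φ n
  have e1 : FM (windowed (fat φ 0) σ n) (block φ n X) = FM (windowed (φ.cutoff 0) σ n) X := by
    change FM _ (FM _ X) = _
    rw [FM_FM ht ((window_fat φ).hasTemperateGrowth hσ n)]
    congr 2
    funext ξ
    simp only [← fat_mul_eq_windowed, ← cutoff_mul_eq_windowed]
    rw [← mul_assoc, fat_mul_cutoff]
  rw [IsHomMultiplier, e1] at h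
  refine h.congr_fun fun j => ?_
  rw [cutoff_mul_eq_windowed]
  exact FM_comm ((window_cutoff φ).hasTemperateGrowth hσ j) ht X

include hp hp'

/-- Existence of `B[F, G]` and its dyadic blocks, from a bound for the sums of the pieces. -/
theorem exists_isB {F G : 𝓢'(Plane, ℂ)} (hF : ∀ k, distLpNorm p (block φ k F) < ∞)
    (hG : ∀ k, distLpNorm p (block φ k G) < ∞) {K : ℝ≥0∞} (hK : K ≠ ∞)
    (hb : ∀ n : ℤ, ∑' κ : ℤ × ℤ, 2 ^ ((2 / p.toReal - 1) * (n : ℝ)) *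
      distLpNorm p (piece φ κ.1 κ.2 F G n) ≤ K) :
    ∃ h : 𝓢'(Plane, ℂ), IsB φ (polynomials.mkQ F) (polynomials.mkQ G) h ∧
      ∀ n, HasSum (fun κ : ℤ × ℤ => piece φ κ.1 κ.2 F G n) (block φ n h) := by
  obtain ⟨C, q, hC, hq, hpair⟩ := exists_pairing_bound φ hp hp'
  -- The factor `2^(-|n|)` makes the triple series summable although the pair sums are only bounded
  -- uniformly in `n`. Summing by fibres then gives `B[φ_k * F, φ_l * G]` for each pair and its
  -- unconditional sum.
  let B : (ℤ × ℤ) × ℤ → ℝ≥0∞ := fun x => C * (2 ^ (-|(x.2 : ℝ)|) *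
    (2 ^ ((2 / p.toReal - 1) * (x.2 : ℝ)) * distLpNorm p (piece φ x.1.1 x.1.2 F G x.2)))
  have hB : ∑' x, B x ≠ ∞ := by
    have hw : ∑' n : ℤ, (2 : ℝ≥0∞) ^ (-|(n : ℝ)|) ≠ ∞ := by
      have := tsum_wt_ne_top one_pos
      simpa only [wt, neg_one_mul] using this
    refine ne_top_of_le_ne_top (ENNReal.mul_ne_top hC (ENNReal.mul_ne_top hw hK)) ?_
    rw [ENNReal.tsum_mul_left, ENNReal.tsum_prod', ENNReal.tsum_comm]
    refine mul_le_mul_right ?_ C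
    rw [← ENNReal.tsum_mul_right]
    refine ENNReal.tsum_le_tsum fun n => ?_
    have := mul_le_mul_right (hb n) (2 ^ (-|(n : ℝ)|))
    rwa [← ENNReal.tsum_mul_left] at this
  have hpt : ∀ x ψ, ‖piece φ x.1.1 x.1.2 F G x.2 ψ‖ₑ ≤ B x * ENNReal.ofReal (q ψ) := fun x ψ =>
    hpair x.2 _ ψ (FM_cutoff_fat φ homog_rsym_one x.2 _)
  have hs : Summable fun x : (ℤ × ℤ) × ℤ => piece φ x.1.1 x.1.2 F G x.2 :=
    summable_of_seminorm hq hB hpt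
  have hsκ : ∀ κ : ℤ × ℤ, Summable fun n => piece φ κ.1 κ.2 F G n := fun κ => by
    refine summable_of_seminorm hq (B := fun n => B (κ, n)) ?_ fun n ψ => hpt (κ, n) ψ
    rw [ENNReal.tsum_prod'] at hB
    exact ENNReal.ne_top_of_tsum_ne_top hB κ
  have hbsum := hs.hasSum.prod_fiberwise fun κ => (hsκ κ).hasSum
  refine ⟨_, ⟨_, fun κ => ?_, hbsum⟩, fun n => ?_⟩
  · refine ⟨invHalf φ κ.1 F, invHalf φ κ.2 G, amat φ κ.1 κ.2 F G,
      isHomMultiplier_block φ homog_rsym_half κ.1 F, isHomMultiplier_block φ homog_rsym_half κ.2 G,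
      fun i j => isT_amat φ hp hp' (hF κ.1) (hG κ.2) i j, ?_⟩
    refine (hsκ κ).hasSum.congr_fun fun n => ?_
    change FM (fun ξ => φ.cutoff n ξ * rsym 1 ξ) _ = _
    rw [cutoff_mul_eq_windowed]
    rfl
  · refine (hbsum.mapL (block φ n)).congr_fun fun κ => ?_
    exact ((hasSum_block φ homog_rsym_one n (divDiv (amat φ κ.1 κ.2 F G))).unique
      ((hsκ κ).hasSum.mapL (block φ n)))

omit hp hp' in
-- The second sequence enters only through its supremum; the weight in `k - l` pays for the sum over
-- `l`, and a convolution in `k` remains.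
theorem tsum_conv_le {δ : ℝ} {C D : ℝ≥0∞} {N : ℤ → ℤ → ℤ → ℝ≥0∞} {a b : ℤ → ℝ≥0∞}
    (hN : ∀ k l n, N k l n ≤ C * (wt δ (k - l) * wt δ (n - k)) * (a k * b l))
    (hD : ∀ l, b l ≤ D) (n : ℤ) :
    ∑' κ : ℤ × ℤ, N κ.1 κ.2 n ≤ C * (∑' m, wt δ m) * D * ∑' k, wt δ (n - k) * a k := by
  rw [ENNReal.tsum_prod', ← ENNReal.tsum_mul_left]
  refine ENNReal.tsum_le_tsum fun k => ?_
  calc ∑' l, N k l n ≤ ∑' l, wt δ (k - l) * (C * D * (wt δ (n - k) * a k)) := by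
        refine ENNReal.tsum_le_tsum fun l => (hN k l n).trans ?_
        calc _ ≤ C * (wt δ (k - l) * wt δ (n - k)) * (a k * D) := by gcongr; exact hD l
          _ = _ := by ring
    _ = _ := by rw [ENNReal.tsum_mul_right, tsum_wt_sub]; ring

omit hp hp' in
-- Since `ℓ^q` embeds in `ℓ^∞`, one convolution and Young's inequality suffice for every `q ≥ 1`.
theorem seqNorm_tsum_conv_le {q : ℝ≥0∞} (hq : 1 ≤ q) {δ : ℝ} {C : ℝ≥0∞} {N : ℤ → ℤ → ℤ → ℝ≥0∞}
    {a b : ℤ → ℝ≥0∞}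
    (hN : ∀ k l n, N k l n ≤ C * (wt δ (k - l) * wt δ (n - k)) * (a k * b l)) :
    seqNorm q (fun n => ∑' κ : ℤ × ℤ, N κ.1 κ.2 n) ≤
      C * (∑' m, wt δ m) ^ 2 * (seqNorm q a * seqNorm q b) := by
  refine (seqNorm_mono (tsum_conv_le hN (le_seqNorm hq b))).trans ?_
  rw [seqNorm_const_mul hq]
  refine (mul_le_mul_right (seqNorm_conv_le hq (wt δ) a) _).trans (le_of_eq ?_)
  ring

/-- The dyadic blocks of `F`, weighted as in the critical Besov norm. -/
def coef (p : ℝ≥0∞) (F : 𝓢'(Plane, ℂ)) (k : ℤ) : ℝ≥0∞ :=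
  2 ^ ((2 / p.toReal - 1) * (k : ℝ)) * distLpNorm p (block φ k F)

omit hp hp' in
theorem besovNorm_mkQ (q : ℝ≥0∞) (F : 𝓢'(Plane, ℂ)) :
    besovNorm φ (2 / p.toReal - 1) p q (polynomials.mkQ F) = seqNorm q (coef φ p F) := by
  rw [besovNorm]
  congr 1
  funext j
  rw [coef, ← ENNReal.ofReal_rpow_of_pos two_pos, ENNReal.ofReal_ofNat]
  rfl

omit hp hp' in
theorem block_lt_top {q : ℝ≥0∞} (hq : 1 ≤ q) {F : 𝓢'(Plane, ℂ)}
    (h : seqNorm q (coef φ p F) < ∞) (k : ℤ) : distLpNorm p (block φ k F) < ∞ := by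
  have := (le_seqNorm hq (coef φ p F) k).trans_lt h
  rw [coef] at this
  by_contra h0
  rw [not_lt_top_iff.1 h0, ENNReal.mul_top (two_rpow_ne_zero _)] at this
  exact lt_irrefl _ this

omit hp hp' in
/-- The norm of `B[F, G]` from the norms of the pieces. -/
theorem coef_le_tsum (hp : 1 ≤ p) {F G h : 𝓢'(Plane, ℂ)} {n : ℤ}
    (hs : HasSum (fun κ : ℤ × ℤ => piece φ κ.1 κ.2 F G n) (block φ n h)) :
    coef φ p h n ≤ ∑' κ : ℤ × ℤ, 2 ^ ((2 / p.toReal - 1) * (n : ℝ)) *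
      distLpNorm p (piece φ κ.1 κ.2 F G n) := by
  rw [coef, ENNReal.tsum_mul_left]
  exact mul_le_mul_right (distLpNorm_le_tsum hp hs) _

omit hp' in
theorem exists_bound_subcritical (hp4 : p < 4) {q : ℝ≥0∞} (hq : 1 ≤ q) :
    ∃ C : ℝ≥0∞, C ≠ ∞ ∧ ∀ F G : 𝓢'(Plane, ℂ),
      seqNorm q (coef φ p F) < ∞ → seqNorm q (coef φ p G) < ∞ →
      ∃ h : 𝓢'(Plane, ℂ), IsB φ (polynomials.mkQ F) (polynomials.mkQ G) h ∧
        seqNorm q (coef φ p h) ≤ C * (seqNorm q (coef φ p F) * seqNorm q (coef φ p G)) := by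
  have hp' : p ≠ ∞ := hp4.ne_top
  obtain ⟨δ, hδ, C, hC, hd⟩ := exists_decay_subcritical φ hp hp4
  have hW := tsum_wt_ne_top hδ
  have hCW : C * (∑' m, wt δ m) ^ 2 ≠ ∞ := ENNReal.mul_ne_top hC (ENNReal.pow_ne_top hW)
  refine ⟨C * (∑' m, wt δ m) ^ 2, hCW, fun F G hF hG => ?_⟩
  have hFk := block_lt_top φ hq hF
  have hGk := block_lt_top φ hq hG
  have hN := seqNorm_tsum_conv_le hq (N := fun k l n => 2 ^ ((2 / p.toReal - 1) * (n : ℝ)) *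
    distLpNorm p (piece φ k l F G n)) fun k l n => hd k l n F G (hFk k) (hGk l)
  obtain ⟨h, hB, hs⟩ := exists_isB φ hp hp' hFk hGk
    (ENNReal.mul_ne_top hCW (ENNReal.mul_ne_top hF.ne hG.ne))
    (fun n => (le_seqNorm hq _ n).trans hN)
  exact ⟨h, hB, (seqNorm_mono fun n => coef_le_tsum φ hp (hs n)).trans hN⟩

end

/-! ### The critical case -/

theorem tsum_mul_le_seqNorm (a b : ℤ → ℝ≥0∞) : ∑' k, a k * b k ≤ seqNorm 2 a * seqNorm 2 b := by
  have h := ENNReal.lintegral_mul_le_Lp_mul_Lq (Measure.count : Measure ℤ)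
    Real.HolderConjugate.two_two (f := a) (g := b) Measurable.of_discrete.aemeasurable
    Measurable.of_discrete.aemeasurable
  simp only [lintegral_count, Pi.mul_apply] at h
  simpa only [seqNorm_of_ne_top ENNReal.ofNat_ne_top, ENNReal.toReal_ofNat] using h

/-- Pairs of comparable frequencies. -/
def Comparable (κ : ℤ × ℤ) : Prop := |κ.1 - κ.2| ≤ 7

instance (κ : ℤ × ℤ) : Decidable (Comparable κ) := inferInstanceAs (Decidable (_ ≤ _))

/-- Comparable pairs form a band of fifteen diagonals: Young for the band, then Cauchy–Schwarz. -/
theorem exists_tsum_comparable_le : ∃ W : ℝ≥0∞, W ≠ ∞ ∧ ∀ a b : ℤ → ℝ≥0∞,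
    ∑' κ : ℤ × ℤ, (if Comparable κ then a κ.1 * b κ.2 else 0) ≤
      W * (seqNorm 2 a * seqNorm 2 b) := by
  let w : ℤ → ℝ≥0∞ := fun m => if |m| ≤ 7 then 1 else 0
  refine ⟨∑' m, w m, ?_, fun a b => ?_⟩
  · rw [tsum_eq_sum (s := Finset.Icc (-7) 7) fun m hm => if_neg fun h => hm
      (Finset.mem_Icc.2 (abs_le.1 h))]
    exact ENNReal.sum_ne_top.2 fun m _ => by by_cases h : |m| ≤ 7 <;> simp [h]
  · have h1 : ∑' κ : ℤ × ℤ, (if Comparable κ then a κ.1 * b κ.2 else 0) =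
        ∑' k, a k * ∑' l, w (k - l) * b l := by
      rw [ENNReal.tsum_prod']
      refine tsum_congr fun k => ?_
      rw [← ENNReal.tsum_mul_left]
      refine tsum_congr fun l => ?_
      by_cases h : |k - l| ≤ 7 <;> simp [Comparable, w, h]
    rw [h1]
    refine (tsum_mul_le_seqNorm _ _).trans ?_
    refine (mul_le_mul_right (seqNorm_conv_le one_le_two w b) _).trans (le_of_eq ?_)
    ring

section

variable (φ : DyadicPartition)

theorem holderTriple_four : (4 : ℝ≥0∞).HolderTriple 4 2 := by
  have h : (4 : ℝ≥0∞) / 2 = 2 := by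
    rw [show (4 : ℝ≥0∞) = 2 * 2 by norm_num, ENNReal.mul_div_cancel_right two_ne_zero
      ENNReal.ofNat_ne_top]
  have := (holderTriple_half (p := 4) (by norm_num) ENNReal.ofNat_ne_top).1
  rwa [h] at this

theorem fat_eq_block_sum (n : ℤ) (F : 𝓢'(Plane, ℂ)) :
    FM (windowed (fat φ 0) (fun _ => 1) n) F =
      ∑ m ∈ Finset.Icc (-2 : ℤ) 2, block φ (n + m) F := by
  have h := FM_sum (Finset.Icc (-2 : ℤ) 2) (fun m => φ.cutoff (n + m))
    (fun m _ => hasTemperateGrowth_cutoff φ (n + m)) F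
  refine Eq.trans ?_ h
  congr 2
  funext ξ
  rw [← fat_mul_eq_windowed, ← fat_eq_sum]
  exact mul_one _

theorem seqNorm_block_two_le (m : ℤ) (F : 𝓢'(Plane, ℂ)) :
    seqNorm 2 (fun n => distLpNorm 2 (block φ (n + m) F)) ≤ distLpNorm 2 F := by
  rw [seqNorm_of_ne_top ENNReal.ofNat_ne_top, ENNReal.toReal_ofNat, one_div,
    ENNReal.rpow_inv_le_iff two_pos]
  simp only [ENNReal.rpow_ofNat]
  exact ((Equiv.addRight m).tsum_eq fun n => distLpNorm 2 (block φ n F) ^ 2).trans_le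
    (tsum_block_two_le φ F)

/-- A multiplier of degree zero maps `L²` to the Besov space of exponents `(4, 2)`. -/
theorem exists_bound_two_four : ∃ C : ℝ≥0∞, C ≠ ∞ ∧ ∀ (i j : Fin 2) (F : 𝓢'(Plane, ℂ)),
    seqNorm 2 (fun n => 2 ^ ((2 / (4 : ℝ≥0∞).toReal - 1) * (n : ℝ)) * distLpNorm 4
      (FM (windowed (φ.cutoff 0) (fun ξ => dsym j ξ * (dsym i ξ * rsym 1 ξ)) n) F)) ≤
      C * distLpNorm 2 F := by
  obtain ⟨C, hC, h⟩ := (window_cutoff φ).exists_bound_finite homog_second (p := 2) one_le_two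
    ENNReal.ofNat_ne_top
  refine ⟨C * 5, ENNReal.mul_ne_top hC (by simp), fun i j F => ?_⟩
  have hb : ∀ n : ℤ, 2 ^ ((2 / (4 : ℝ≥0∞).toReal - 1) * (n : ℝ)) * distLpNorm 4
      (FM (windowed (φ.cutoff 0) (fun ξ => dsym j ξ * (dsym i ξ * rsym 1 ξ)) n) F) ≤
      C * ∑ m ∈ Finset.Icc (-2 : ℤ) 2, distLpNorm 2 (block φ (n + m) F) := by
    intro n
    have h1 := (window_cutoff φ).hasTemperateGrowth (homog_second (i, j)) n
    have h2 := (window_fat φ).hasTemperateGrowth homog_one n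
    -- Inserting the fat cutoff replaces the `L²` norm of `F` by those of five neighbouring blocks,
    -- which are square summable in `n`.
    have e1 := (FM_comm h2 h1 F).trans (FM_cutoff_fat φ (homog_second (i, j)) n F)
    have hn := (h (i, j) n (FM (windowed (fat φ 0) (fun _ => 1) n) F)).2.2
    rw [e1, show (2 : ℝ≥0∞) * 2 = 4 by norm_num] at hn
    have hf : distLpNorm 2 (FM (windowed (fat φ 0) (fun _ => 1) n) F) ≤
        ∑ m ∈ Finset.Icc (-2 : ℤ) 2, distLpNorm 2 (block φ (n + m) F) := by
      rw [fat_eq_block_sum]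
      exact distLpNorm_sum_le one_le_two _ _
    calc _ ≤ 2 ^ ((2 / (4 : ℝ≥0∞).toReal - 1) * (n : ℝ)) * (C *
          2 ^ ((((0 : ℤ) : ℝ) + 1 / (2 : ℝ≥0∞).toReal) * (n : ℝ)) *
          ∑ m ∈ Finset.Icc (-2 : ℤ) 2, distLpNorm 2 (block φ (n + m) F)) := by
          gcongr
          exact hn.trans (by gcongr)
      _ = C * 2 ^ ((2 / (4 : ℝ≥0∞).toReal - 1) * (n : ℝ) +
          (((0 : ℤ) : ℝ) + 1 / (2 : ℝ≥0∞).toReal) * (n : ℝ)) *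
          ∑ m ∈ Finset.Icc (-2 : ℤ) 2, distLpNorm 2 (block φ (n + m) F) := by
          rw [two_rpow_add]; ring
      _ = _ := by
        -- The loss `2^(n/2)` from `L²` to `L⁴` is exactly compensated by the Besov weight
        -- `2^(-n/2)`.
        have : (2 / (4 : ℝ≥0∞).toReal - 1) * (n : ℝ) +
            (((0 : ℤ) : ℝ) + 1 / (2 : ℝ≥0∞).toReal) * (n : ℝ) = 0 := by
          simp only [ENNReal.toReal_ofNat, Int.cast_zero]; ring
        rw [this, ENNReal.rpow_zero, mul_one]
  refine (seqNorm_mono hb).trans ?_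
  rw [seqNorm_const_mul one_le_two, mul_assoc]
  refine mul_le_mul_right ((seqNorm_sum_le one_le_two ENNReal.ofNat_ne_top _ _).trans ?_) C
  refine (Finset.sum_le_card_nsmul _ _ _ fun m _ => seqNorm_block_two_le φ m F).trans
    (le_of_eq ?_)
  rw [Int.card_Icc, nsmul_eq_mul]
  rfl

/-- The matrices of comparable frequencies are summable in `L²`. -/
theorem exists_amat_sum : ∃ C : ℝ≥0∞, C ≠ ∞ ∧ ∀ F G : 𝓢'(Plane, ℂ),
    seqNorm 2 (coef φ 4 F) < ∞ → seqNorm 2 (coef φ 4 G) < ∞ → ∀ i j : Fin 2,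
    ∃ A : 𝓢'(Plane, ℂ),
      HasSum (fun κ : ℤ × ℤ => if Comparable κ then amat φ κ.1 κ.2 F G i j else 0) A ∧
      distLpNorm 2 A ≤ C * (seqNorm 2 (coef φ 4 F) * seqNorm 2 (coef φ 4 G)) := by
  have := holderTriple_four
  obtain ⟨C, hC, h⟩ := exists_amat_bound φ (p := 4) (r := 2) (by norm_num) ENNReal.ofNat_ne_top
    one_le_two ENNReal.ofNat_ne_top
  obtain ⟨W, hW, hw⟩ := exists_tsum_comparable_le
  have hCW : C * 2 ^ (4 : ℝ) * W ≠ ∞ :=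
    ENNReal.mul_ne_top (ENNReal.mul_ne_top hC (two_rpow_ne_top _)) hW
  refine ⟨C * 2 ^ (4 : ℝ) * W, hCW, fun F G hF hG i j => ?_⟩
  have hb : ∀ κ : ℤ × ℤ, distLpNorm 2 (if Comparable κ then amat φ κ.1 κ.2 F G i j else 0) ≤
      C * 2 ^ (4 : ℝ) * (if Comparable κ then coef φ 4 F κ.1 * coef φ 4 G κ.2 else 0) := by
    intro κ
    by_cases hκ : Comparable κ
    · rw [if_pos hκ, if_pos hκ]
      have h1 := h κ.1 κ.2 F G i j (block_lt_top φ one_le_two hF κ.1)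
        (block_lt_top φ one_le_two hG κ.2)
      -- Since `l - k ≤ 7`, the factor `2^(-k)` is at most `2^4` times the product of the weights
      -- `2^(-k/2)` and `2^(-l/2)`.
      have h2 := weight_le (s := 2 / (4 : ℝ≥0∞).toReal - 1) (n := 0) (k := κ.1) (l := κ.2)
        (M := 4) (w := 0) h1 (by
          have h3 : ((κ.2 : ℝ)) - κ.1 ≤ 7 := by
            have := (abs_le.1 hκ).1
            exact_mod_cast (by omega : κ.2 - κ.1 ≤ 7)
          simp only [ENNReal.toReal_ofNat]
          linarith)
      simpa only [coef, mul_zero, ENNReal.rpow_zero, one_mul, mul_one] using h2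
    · rw [if_neg hκ, if_neg hκ, distLpNorm_zero]
      exact zero_le
  have ht : ∑' κ : ℤ × ℤ, distLpNorm 2 (if Comparable κ then amat φ κ.1 κ.2 F G i j else 0) ≤
      C * 2 ^ (4 : ℝ) * W * (seqNorm 2 (coef φ 4 F) * seqNorm 2 (coef φ 4 G)) := by
    refine (ENNReal.tsum_le_tsum hb).trans ?_
    rw [ENNReal.tsum_mul_left, mul_assoc _ W]
    exact mul_le_mul_right (hw _ _) _
  have hfin := ne_top_of_le_ne_top (ENNReal.mul_ne_top hCW (ENNReal.mul_ne_top hF.ne hG.ne)) ht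
  obtain ⟨A, hA⟩ := summable_of_distLpNorm one_le_two hfin
  exact ⟨A, hA, (distLpNorm_le_tsum one_le_two hA).trans ht⟩

/-- The part of `B[F, G]` from comparable frequencies. -/
theorem exists_comparable_sum : ∃ C : ℝ≥0∞, C ≠ ∞ ∧ ∀ F G : 𝓢'(Plane, ℂ),
    seqNorm 2 (coef φ 4 F) < ∞ → seqNorm 2 (coef φ 4 G) < ∞ →
    ∃ H : ℤ → 𝓢'(Plane, ℂ),
      (∀ n, HasSum (fun κ : ℤ × ℤ => if Comparable κ then piece φ κ.1 κ.2 F G n else 0) (H n)) ∧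
      seqNorm 2 (fun n => 2 ^ ((2 / (4 : ℝ≥0∞).toReal - 1) * (n : ℝ)) * distLpNorm 4 (H n)) ≤
        C * (seqNorm 2 (coef φ 4 F) * seqNorm 2 (coef φ 4 G)) := by
  obtain ⟨C₁, hC₁, h₁⟩ := exists_bound_two_four φ
  obtain ⟨C₂, hC₂, h₂⟩ := exists_amat_sum φ
  refine ⟨4 * (C₁ * C₂), ENNReal.mul_ne_top (by simp) (ENNReal.mul_ne_top hC₁ hC₂),
    fun F G hF hG => ?_⟩
  choose A hA hAb using h₂ F G hF hG
  have h14 : (1 : ℝ≥0∞) ≤ 4 := by norm_num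
  let σ : Fin 2 → Fin 2 → ℤ → Plane → ℂ := fun i j n =>
    windowed (φ.cutoff 0) (fun ξ => dsym j ξ * (dsym i ξ * rsym 1 ξ)) n
  refine ⟨fun n => ∑ i, ∑ j, FM (σ i j n) (A i j), fun n => ?_, ?_⟩
  · refine (hasSum_sum fun i _ => hasSum_sum fun j _ =>
      (hA i j).mapL (FM (σ i j n))).congr_fun fun κ => ?_
    by_cases hκ : Comparable κ
    · simp only [if_pos hκ]
      rw [piece, FM_divDiv]
    · simp only [if_neg hκ, map_zero, Finset.sum_const_zero]
  · have hb : ∀ n : ℤ, 2 ^ ((2 / (4 : ℝ≥0∞).toReal - 1) * (n : ℝ)) *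
        distLpNorm 4 (∑ i, ∑ j, FM (σ i j n) (A i j)) ≤
        ∑ i, ∑ j, 2 ^ ((2 / (4 : ℝ≥0∞).toReal - 1) * (n : ℝ)) *
          distLpNorm 4 (FM (σ i j n) (A i j)) := fun n => by
      simp_rw [← Finset.mul_sum]
      gcongr
      exact (distLpNorm_sum_le h14 _ _).trans
        (Finset.sum_le_sum fun i _ => distLpNorm_sum_le h14 _ _)
    refine (seqNorm_mono hb).trans ?_
    refine (seqNorm_sum_le one_le_two ENNReal.ofNat_ne_top _ _).trans ?_
    refine (Finset.sum_le_sum fun i _ => (seqNorm_sum_le one_le_two ENNReal.ofNat_ne_top _ _).trans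
      (Finset.sum_le_sum fun j _ => (h₁ i j (A i j)).trans
        (mul_le_mul_right (hAb i j) C₁))).trans (le_of_eq ?_)
    simp only [Finset.sum_const, Finset.card_univ, Fintype.card_fin, nsmul_eq_mul]
    push_cast
    ring

/-- Separated pairs are treated as for `p < 4`. Comparable pairs are summed before the output is
localized, because their pieces cannot be summed in norm with an `ℓ²` bound in `n` by decay. -/
theorem exists_bound_critical :
    ∃ C : ℝ≥0∞, C ≠ ∞ ∧ ∀ F G : 𝓢'(Plane, ℂ),
      seqNorm 2 (coef φ 4 F) < ∞ → seqNorm 2 (coef φ 4 G) < ∞ →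
      ∃ h : 𝓢'(Plane, ℂ), IsB φ (polynomials.mkQ F) (polynomials.mkQ G) h ∧
        seqNorm 2 (coef φ 4 h) ≤ C * (seqNorm 2 (coef φ 4 F) * seqNorm 2 (coef φ 4 G)) := by
  have h14 : (1 : ℝ≥0∞) ≤ 4 := by norm_num
  have h4 : (4 : ℝ≥0∞) ≠ ∞ := ENNReal.ofNat_ne_top
  obtain ⟨C₁, hC₁, h₁⟩ := exists_decay_separated φ h14 h4 (δ := 1 / 2) (by norm_num) le_rfl
  -- With `δ = 0` this is a bound without decay. It gives only a supremum in `n`, enough for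
  -- convergence; the `ℓ²` norm comes from `h₃`.
  obtain ⟨C₂, hC₂, h₂⟩ := exists_decay_comparable_half φ h14 h4 (by norm_num) (δ := 0) le_rfl
    (by norm_num) (by norm_num)
  obtain ⟨C₃, hC₃, h₃⟩ := exists_comparable_sum φ
  obtain ⟨W, hW, hw⟩ := exists_tsum_comparable_le
  have hW' := tsum_wt_ne_top (δ := 1 / 2) (by norm_num)
  set V := C₁ * (∑' m, wt (1 / 2) m) ^ 2 with hV
  have hVt : V ≠ ∞ := ENNReal.mul_ne_top hC₁ (ENNReal.pow_ne_top hW')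
  refine ⟨C₃ + V, ENNReal.add_ne_top.2 ⟨hC₃, hVt⟩, fun F G hF hG => ?_⟩
  have hFk := block_lt_top φ one_le_two hF
  have hGk := block_lt_top φ one_le_two hG
  set s : ℝ := 2 / (4 : ℝ≥0∞).toReal - 1 with hs
  set P := seqNorm 2 (coef φ 4 F) * seqNorm 2 (coef φ 4 G) with hP
  have hPt : P ≠ ∞ := ENNReal.mul_ne_top hF.ne hG.ne
  let N : ℤ → ℤ → ℤ → ℝ≥0∞ := fun k l n => if Comparable (k, l) then 0 else
    2 ^ (s * (n : ℝ)) * distLpNorm 4 (piece φ k l F G n)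
  have hsep : seqNorm 2 (fun n => ∑' κ : ℤ × ℤ, N κ.1 κ.2 n) ≤ V * P := by
    refine seqNorm_tsum_conv_le one_le_two (N := N) (δ := 1 / 2) fun k l n => ?_
    by_cases hκ : Comparable (k, l)
    · simp only [N, if_pos hκ]; exact zero_le
    · simp only [N, if_neg hκ]
      exact h₁ k l n F G (hFk k) (hGk l) (by
        have : ¬ |k - l| ≤ 7 := hκ
        omega)
  have hcomp : ∀ n : ℤ, ∑' κ : ℤ × ℤ, (if Comparable κ then
      2 ^ (s * (n : ℝ)) * distLpNorm 4 (piece φ κ.1 κ.2 F G n) else 0) ≤ C₂ * (W * P) := by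
    intro n
    refine le_trans ?_ (mul_le_mul_right (hw (coef φ 4 F) (coef φ 4 G)) C₂)
    rw [← ENNReal.tsum_mul_left]
    refine ENNReal.tsum_le_tsum fun κ => ?_
    by_cases hκ : Comparable κ
    · rw [if_pos hκ, if_pos hκ]
      have := h₂ κ.1 κ.2 n F G (hFk κ.1) (hGk κ.2) hκ
      simpa only [coef, wt, neg_zero, zero_mul, ENNReal.rpow_zero, mul_one] using this
    · rw [if_neg hκ, if_neg hκ, mul_zero]
  have hsplit : ∀ (n : ℤ) (κ : ℤ × ℤ), 2 ^ (s * (n : ℝ)) * distLpNorm 4 (piece φ κ.1 κ.2 F G n) =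
      (if Comparable κ then 2 ^ (s * (n : ℝ)) * distLpNorm 4 (piece φ κ.1 κ.2 F G n) else 0) +
        N κ.1 κ.2 n := fun n κ => by
    by_cases hκ : Comparable κ
    · simp only [N, if_pos hκ, add_zero]
    · simp only [N, if_neg hκ, zero_add]
  obtain ⟨h, hB, hsum⟩ := exists_isB φ h14 h4 hFk hGk (K := C₂ * (W * P) + V * P)
    (ENNReal.add_ne_top.2 ⟨ENNReal.mul_ne_top hC₂ (ENNReal.mul_ne_top hW hPt),
      ENNReal.mul_ne_top hVt hPt⟩) (fun n => by
      rw [← hs]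
      rw [tsum_congr (hsplit n), ENNReal.tsum_add]
      exact add_le_add (hcomp n) ((le_seqNorm one_le_two _ n).trans hsep))
  refine ⟨h, hB, ?_⟩
  obtain ⟨H, hH, hHb⟩ := h₃ F G hF hG
  have hb : ∀ n, coef φ 4 h n ≤ 2 ^ (s * (n : ℝ)) * distLpNorm 4 (H n) +
      ∑' κ : ℤ × ℤ, N κ.1 κ.2 n := by
    intro n
    have hrest : HasSum (fun κ : ℤ × ℤ => if Comparable κ then 0 else piece φ κ.1 κ.2 F G n)
        (block φ n h - H n) := by
      refine ((hsum n).sub (hH n)).congr_fun fun κ => ?_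
      by_cases hκ : Comparable κ
      · simp only [if_pos hκ, sub_self]
      · simp only [if_neg hκ, sub_zero]
    have h5 : distLpNorm 4 (block φ n h) ≤ distLpNorm 4 (H n) + distLpNorm 4 (block φ n h - H n) := by
      have := distLpNorm_add_le h14 (H n) (block φ n h - H n)
      rwa [add_sub_cancel] at this
    rw [coef, ← hs]
    refine (mul_le_mul_right h5 _).trans ?_
    rw [mul_add]
    gcongr
    refine (mul_le_mul_right (distLpNorm_le_tsum h14 hrest) _).trans (le_of_eq ?_)
    rw [← ENNReal.tsum_mul_left]
    refine tsum_congr fun κ => ?_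
    by_cases hκ : Comparable κ
    · simp only [N, if_pos hκ, distLpNorm_zero, mul_zero]
    · simp only [N, if_neg hκ]
  refine (seqNorm_mono hb).trans ((seqNorm_add_le one_le_two ENNReal.ofNat_ne_top _ _).trans ?_)
  rw [add_mul]
  exact add_le_add hHb hsep

end

/-- The bilinear estimate in the critical Besov spaces. -/
theorem exists_bound (φ : DyadicPartition) {p q : ℝ≥0∞}
    (hpq : (1 ≤ p ∧ p < 4 ∧ 1 ≤ q) ∨ (p = 4 ∧ q = 2)) :
    ∃ C : ℝ≥0∞, C ≠ ∞ ∧ ∀ F G : 𝓢'(Plane, ℂ),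
      seqNorm q (coef φ p F) < ∞ → seqNorm q (coef φ p G) < ∞ →
      ∃ h : 𝓢'(Plane, ℂ), IsB φ (polynomials.mkQ F) (polynomials.mkQ G) h ∧
        seqNorm q (coef φ p h) ≤ C * (seqNorm q (coef φ p F) * seqNorm q (coef φ p G)) := by
  rcases hpq with ⟨hp, hp4, hq⟩ | ⟨rfl, rfl⟩
  · exact exists_bound_subcritical φ hp hp4 hq
  · exact exists_bound_critical φ

end QG

end

theorem lemma3p1 (φ : QG.DyadicPartition) (p q : ℝ≥0∞)
    (hpq : (1 ≤ p ∧ p < 4 ∧ 1 ≤ q) ∨ (p = 4 ∧ q = 2)) :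
    ∃ C : ℝ, 0 < C ∧
      ∀ f ∈ QG.besovSpace φ (2 / p.toReal - 1) p q,
      ∀ g ∈ QG.besovSpace φ (2 / p.toReal - 1) p q,
        ∃ h : 𝓢'(QG.Plane, ℂ), QG.IsB φ f g h ∧
          QG.besovNorm φ (2 / p.toReal - 1) p q (QG.polynomials.mkQ h) ≤
            ENNReal.ofReal C * QG.besovNorm φ (2 / p.toReal - 1) p q f *
              QG.besovNorm φ (2 / p.toReal - 1) p q g := by
  obtain ⟨C, hC, hb⟩ := QG.exists_bound φ hpq
  -- The added 1 makes the real constant strictly positive.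
  refine ⟨C.toReal + 1, by positivity, fun f hf g hg => ?_⟩
  obtain ⟨F, rfl⟩ := QG.polynomials.mkQ_surjective f
  obtain ⟨G, rfl⟩ := QG.polynomials.mkQ_surjective g
  simp only [QG.besovSpace, Set.mem_ofPred_eq, QG.besovNorm_mkQ] at hf hg
  obtain ⟨h, hB, hle⟩ := hb F G hf hg
  refine ⟨h, hB, ?_⟩
  simp only [QG.besovNorm_mkQ]
  refine hle.trans ?_
  rw [← mul_assoc]
  gcongr
  rw [← ENNReal.ofReal_toReal hC]
  exact ENNReal.ofReal_le_ofReal (by rw [ENNReal.toReal_ofReal ENNReal.toReal_nonneg]; linarith)
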